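/- Let $n\ge 0$, $m\ge 1$, let $f, f_{u_1},\dots,f_{u_m}\in\mathbb{R}[x]^n$, $g_1,\dots,g_{n_g}\in\mathbb{R}[x]$ and $l_x,l_{u_1},\dots,l_{u_m}\in\mathbb{R}[x]$ be polynomial data in $x\in\mathbb{R}^n$, let $\bar u>0$ and $\beta>0$, and put $X=\{x\in\mathbb{R}^n : g_i(x)\ge 0,\ i=1,\dots,n_g\}$ and $U=[0,\bar u]^m$. Assume that $X$ is compact, that $l(x,u):=l_x(x)+\sum_{i=1}^m l_{u_i}(x)u_i\ge 0$ on $X\times U$, and that $M>\beta^{-1}\sup_{x\in X,u\in U} l(x,u)$ (the supremum being read as $0$ if $X=\emptyset$). For $x_0\in X$ let $V(x_0)$ be the infimum of $$\int_0^{\tau} e^{-\beta t}\, l(x(t),u(t))\,dt+e^{-\beta\tau}M$$ over all $\tau\in[0,\infty]$ (with $e^{-\beta\infty}=0$), measurable $u$ and continuous $x$ such that $x(t)=x_0+\int_0^t \big(f(x(s))+\sum_{i=1}^m f_{u_i}(x(s))u_i(s)\big)ds$ and $(x(t),u(t))\in X\times U$ for all $t\in[0,\tau]$ (for all $t\in[0,\infty)$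 if $\tau=\infty$). Let $p^\star$ be the infimum of $$p(\rho,\rho_0,\rho_T,\sigma)=\int_X l_x\rho\,dx+\sum_{i=1}^m\int_X l_{u_i}\sigma_i\,dx+M\int_X\rho_T\,dx$$ over $(\rho,\rho_0,\rho_T,\sigma)\in C^1(X)\times C(X)\times C(X)\times C^1(X)^m$ such that $$\rho_T-\rho_0+\beta\rho+\operatorname{div}(\rho f)+\sum_{i=1}^m\operatorname{div}(\sigma_i f_{u_i})=0 \ \text{ in the interior of } X,$$ $\rho\le 0$ on $\partial X$, and $\rho_0\ge 1$, $\rho_T\ge 0$, $0\le\sigma_i\le\bar u\rho$ ($i=1,\dots,m$) on $X$. Here $C^1(X)$ is the set of continuous functions on $X$ that are differentiable in the interior of $X$ with a derivative that extends continuously to $X$. For $d\in\mathbb{N}$ let $\mathbb{R}[x]_e$ be the space of polynomials of degree at most $e$ ($\{0\}$ if $e<0$), $\Sigma_{2k}$ the set of polynomials of degree at most $2k$ that are sums of squares of polynomials ($\{0\}$ if $k<0$), $\bar g=\prod_i g_i$, and $$Q_e(X)=\Big\{s_0+\sum_{i=1}^{n_g}g_is_i : s_0\in\Sigma_{2\lfloor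 e/2\rfloor},\ s_i\in\Sigma_{2\lfloor (e-\deg g_i)/2\rfloor}\Big\}.$$ Let $p_d$ be the infimum of $p(\rho,\rho_0,\rho_T,\sigma)$ over $(\rho,\rho_0,\rho_T,\sigma)\in\mathbb{R}[x]_d^{3+m}$ such that the equation above holds as an identity of polynomials, $-\rho\in Q_d(X)+g_i\mathbb{R}[x]_{d-\deg g_i}+\bar g\,\mathbb{R}[x]_{d-\deg\bar g}$ for $i=1,\dots,n_g$, $\rho_0-1\in Q_d(X)$, $\rho_T\in Q_d(X)$, and $\bar u\rho-\sigma_i$ and $\sigma_i$ belong to $Q_d(X)+\bar g\,Q_{d-\deg\bar g}(X)$ for $i=1,\dots,m$. Then $V$ is integrable on $X$ and $$\int_X V(x)\,dx\ \le\ p^\star\ \le\ p_d\qquad\text{for every } d\in\mathbb{N}.$$ So the density LP, and hence every SOS level, is a tightening of the original optimal control problem. -/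

import Mathlib

open MeasureTheory
open scoped ENNReal

noncomputable section

namespace DensityLP

/-- Data of the discounted optimal control problem: state dimension `n`, input dimension `m`,
`ng` polynomial inequalities describing the state constraint set. -/
structure Data (n m ng : ℕ) where
  /-- drift -/
  f : Fin n → MvPolynomial (Fin n) ℝ
  /-- input vector fields, `fu i` multiplies the `i`-th input -/
  fu : Fin m → Fin n → MvPolynomial (Fin n) ℝ
  /-- polynomials describing the state constraint set -/
  g : Fin ng → MvPolynomial (Fin n) ℝ
  /-- input bound -/
  ubar : ℝ
  /-- state stage cost -/
  lx : MvPolynomial (Fin n) ℝ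
  /-- input stage costs -/
  lu : Fin m → MvPolynomial (Fin n) ℝ
  /-- discount factor -/
  β : ℝ
  /-- terminal cost -/
  M : ℝ

variable {n m ng : ℕ}

/-- The state constraint set `X = {x | g_i(x) ≥ 0 for all i}`. -/
def Data.X (D : Data n m ng) : Set (Fin n → ℝ) :=
  {x | ∀ i, 0 ≤ MvPolynomial.eval x (D.g i)}

/-- The input constraint set `U = [0, ubar]^m`. -/
def Data.U (D : Data n m ng) : Set (Fin m → ℝ) :=
  {u | ∀ i, 0 ≤ u i ∧ u i ≤ D.ubar}

/-- The joint stage cost `l(x,u) = l_x(x) + ∑ l_{u_i}(x) u_i`. -/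
def Data.l (D : Data n m ng) (x : Fin n → ℝ) (u : Fin m → ℝ) : ℝ :=
  MvPolynomial.eval x D.lx + ∑ i, MvPolynomial.eval x (D.lu i) * u i

/-- The controlled vector field `f(x) + ∑ f_{u_i}(x) u_i`. -/
def Data.field (D : Data n m ng) (x : Fin n → ℝ) (u : Fin m → ℝ) : Fin n → ℝ :=
  fun j => MvPolynomial.eval x (D.f j) + ∑ i, MvPolynomial.eval x (D.fu i j) * u i

/-! ### The optimal control problem -/

/-- The time interval `[0,T]` for `T < ∞`, and `[0,∞)` for `T = ∞`. -/
def horizon (T : ℝ≥0∞) : Set ℝ := {t | 0 ≤ t ∧ ENNReal.ofReal t ≤ T}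

/-- `e^{-β T}`, equal to `0` for `T = ∞`. -/
def stopDiscount (β : ℝ) (T : ℝ≥0∞) : ℝ :=
  if T = ∞ then 0 else Real.exp (-β * T.toReal)

/-- The triple (trajectory, control, stopping time) is admissible for the initial state `x₀`. -/
structure Data.Admissible (D : Data n m ng) (x₀ : Fin n → ℝ)
    (x : ℝ → Fin n → ℝ) (u : ℝ → Fin m → ℝ) (T : ℝ≥0∞) : Prop where
  aemeasurable_control : AEMeasurable u (volume.restrict (horizon T))
  continuousOn_state : ContinuousOn x (horizon T)
  dynamics : ∀ t ∈ horizon T, x t = x₀ + ∫ s in (0 : ℝ)..t, D.field (x s) (u s)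
  state_mem : ∀ t ∈ horizon T, x t ∈ D.X
  control_mem : ∀ t ∈ horizon T, u t ∈ D.U

/-- The cost of a triple (trajectory, control, stopping time). -/
def Data.ocpCost (D : Data n m ng)
    (x : ℝ → Fin n → ℝ) (u : ℝ → Fin m → ℝ) (T : ℝ≥0∞) : ℝ :=
  (∫ t in horizon T, Real.exp (-D.β * t) * D.l (x t) (u t)) + stopDiscount D.β T * D.M

/-- The value function. Only the value `T = τ(x₀)` of a stopping function `τ` enters at `x₀`, and
every `T ∈ [0,∞]` is the value of a (constant) measurable stopping function. For `x₀ ∈ X` the set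
of attained costs is nonempty (stop at time `0`), and it is bounded below by `0` when `l` is
nonnegative on `X × U` and `M ≥ 0`. -/
def Data.V (D : Data n m ng) (x₀ : Fin n → ℝ) : ℝ :=
  sInf {c | ∃ x u T, D.Admissible x₀ x u T ∧ D.ocpCost x u T = c}

/-! ### The density linear program -/

/-- `C¹(X)` for a closed set `X`: continuous on `X`, differentiable in the interior, with a
derivative that extends continuously to `X`. -/
def IsC1On (X : Set (Fin n → ℝ)) (ρ : (Fin n → ℝ) → ℝ) : Prop :=
  ContinuousOn ρ X ∧ ∃ G : (Fin n → ℝ) → ((Fin n → ℝ) →L[ℝ] ℝ),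
    ContinuousOn G X ∧ ∀ x ∈ interior X, HasFDerivAt ρ (G x) x

/-- The divergence `∑ ∂F_j/∂x_j`. -/
def divergence (F : (Fin n → ℝ) → Fin n → ℝ) (x : Fin n → ℝ) : ℝ :=
  ∑ j, fderiv ℝ (fun y => F y j) x (Pi.single j 1)

/-- Feasibility of `(ρ, ρ₀, ρ_T, σ)` in the density linear program. The Liouville equation is
imposed in the interior of `X`, where the derivatives are the classical ones (by continuity it
then holds on the closure of the interior for the extended derivatives). -/
structure Data.LPFeasible (D : Data n m ng) (ρ ρ₀ ρT : (Fin n → ℝ) → ℝ)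
    (σ : Fin m → (Fin n → ℝ) → ℝ) : Prop where
  c1_rho : IsC1On D.X ρ
  continuousOn_rho0 : ContinuousOn ρ₀ D.X
  continuousOn_rhoT : ContinuousOn ρT D.X
  c1_sigma : ∀ i, IsC1On D.X (σ i)
  liouville : ∀ x ∈ interior D.X,
    ρT x - ρ₀ x + D.β * ρ x
      + divergence (fun y j => ρ y * MvPolynomial.eval y (D.f j)) x
      + ∑ i, divergence (fun y j => σ i y * MvPolynomial.eval y (D.fu i j)) x = 0
  rho_nonpos : ∀ x ∈ frontier D.X, ρ x ≤ 0
  one_le_rho0 : ∀ x ∈ D.X, 1 ≤ ρ₀ x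
  sigma_le : ∀ x ∈ D.X, ∀ i, σ i x ≤ D.ubar * ρ x
  rhoT_nonneg : ∀ x ∈ D.X, 0 ≤ ρT x
  sigma_nonneg : ∀ x ∈ D.X, ∀ i, 0 ≤ σ i x

/-- The objective of the density linear program. -/
def Data.lpCost (D : Data n m ng) (ρ ρT : (Fin n → ℝ) → ℝ)
    (σ : Fin m → (Fin n → ℝ) → ℝ) : ℝ :=
  (∫ x in D.X, MvPolynomial.eval x D.lx * ρ x)
    + (∑ i, ∫ x in D.X, MvPolynomial.eval x (D.lu i) * σ i x)
    + D.M * ∫ x in D.X, ρT x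

/-- The optimal value of the density linear program, in the extended reals. -/
def Data.pStar (D : Data n m ng) : EReal :=
  sInf {c | ∃ ρ ρ₀ ρT σ, D.LPFeasible ρ ρ₀ ρT σ ∧ c = ((D.lpCost ρ ρT σ : ℝ) : EReal)}

/-! ### The sum-of-squares levels

Degree bounds are integers: a negative degree bound leaves only the zero polynomial. -/

/-- Polynomials of degree at most `e`. -/
def polyLE (e : ℤ) : Set (MvPolynomial (Fin n) ℝ) :=
  {p | p = 0 ∨ (p.totalDegree : ℤ) ≤ e}

/-- Sums of squares of degree at most `2⌊e/2⌋`. -/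
def sosLE (e : ℤ) : Set (MvPolynomial (Fin n) ℝ) :=
  {p | IsSumSq p ∧ p ∈ polyLE (2 * (e / 2))}

/-- The truncated quadratic module of degree `d`. -/
def Data.Q (D : Data n m ng) (d : ℤ) : Set (MvPolynomial (Fin n) ℝ) :=
  {p | ∃ (s₀ : MvPolynomial (Fin n) ℝ) (s : Fin ng → MvPolynomial (Fin n) ℝ),
    s₀ ∈ sosLE d ∧ (∀ i, s i ∈ sosLE (d - ((D.g i).totalDegree : ℤ))) ∧
      p = s₀ + ∑ i, D.g i * s i}

/-- The product of the polynomials describing `X`. -/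
def Data.gbar (D : Data n m ng) : MvPolynomial (Fin n) ℝ := ∏ i, D.g i

/-- The set `Q_d(X) + gbar Q_{d - deg gbar}(X)`. -/
def Data.QQ (D : Data n m ng) (d : ℤ) : Set (MvPolynomial (Fin n) ℝ) :=
  {p | ∃ q ∈ D.Q d, ∃ r ∈ D.Q (d - (D.gbar.totalDegree : ℤ)), p = q + D.gbar * r}

/-- The divergence of a polynomial vector field. -/
def polyDiv (F : Fin n → MvPolynomial (Fin n) ℝ) : MvPolynomial (Fin n) ℝ :=
  ∑ j, MvPolynomial.pderiv j (F j)

/-- Feasibility in the sum-of-squares problem of degree `d`. -/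
structure Data.SOSFeasible (D : Data n m ng) (d : ℕ) (ρ ρ₀ ρT : MvPolynomial (Fin n) ℝ)
    (σ : Fin m → MvPolynomial (Fin n) ℝ) : Prop where
  deg_rho : ρ ∈ polyLE (d : ℤ)
  deg_rho0 : ρ₀ ∈ polyLE (d : ℤ)
  deg_rhoT : ρT ∈ polyLE (d : ℤ)
  deg_sigma : ∀ i, σ i ∈ polyLE (d : ℤ)
  liouville : ρT - ρ₀ + MvPolynomial.C D.β * ρ + polyDiv (fun j => ρ * D.f j)
      + ∑ i, polyDiv (fun j => σ i * D.fu i j) = 0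
  neg_rho_mem : ∀ i, ∃ q ∈ D.Q d,
    ∃ r ∈ polyLE ((d : ℤ) - ((D.g i).totalDegree : ℤ)),
    ∃ r' ∈ polyLE ((d : ℤ) - (D.gbar.totalDegree : ℤ)),
      -ρ = q + D.g i * r + D.gbar * r'
  rho0_mem : ρ₀ - 1 ∈ D.Q d
  sigma_le_mem : ∀ i, MvPolynomial.C D.ubar * ρ - σ i ∈ D.QQ d
  rhoT_mem : ρT ∈ D.Q d
  sigma_mem : ∀ i, σ i ∈ D.QQ d

/-- The optimal value of the sum-of-squares problem of degree `d`, in the extended reals. -/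
def Data.pSOS (D : Data n m ng) (d : ℕ) : EReal :=
  sInf {c | ∃ ρ ρ₀ ρT σ, D.SOSFeasible d ρ ρ₀ ρT σ ∧
    c = ((D.lpCost (fun x => MvPolynomial.eval x ρ) (fun x => MvPolynomial.eval x ρT)
      (fun i x => MvPolynomial.eval x (σ i)) : ℝ) : EReal)}

end DensityLP

end

/-! A feasible density defines the feedback `σ / ρ` on the set where `ρ > 0`, and `0 ≤ σ ≤ ubar ρ`
says that this feedback takes values in `U`. Since `ρ ≥ 0` on `X` (because `m ≥ 1`) and `ρ ≤ 0` on
the boundary, the flux `ρ f + ∑ σ_i f_{u_i}` vanishes on the boundary and no boundary term appears.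
If `V` were smooth, dynamic programming along the closed loop would give `β V - ∇V · F ≤ l`.
Multiplying by `ρ`, integrating by parts and inserting the Liouville equation would give `∫_{ρ>0}
(ρ₀ - ρT) V ≤ ∫ (l_x ρ + ∑ l_{u_i} σ_i)`. Pointwise, `0 ≤ V ≤ M`, `ρ₀ ≥ 1` and `ρT ≥ 0` give `V ≤ M
ρT + (ρ₀ - ρT) V` where `ρ > 0`. At an interior zero of `ρ` all the gradients vanish, so `ρT = ρ₀ ≥
1` and `V ≤ M ≤ M ρT`. Adding up yields the bound by the objective.

Two points need work. The function `V` is only lower semicontinuous, so the derivative is placed on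
the density instead: `integral_comp_flow` transports bounded lower semicontinuous functions along a
Lipschitz flow, and `integral_mul_add_weakDiv_le` turns the dynamic programming inequality
`V_le_of_admissible` into a weak differential inequality. Lower semicontinuity itself
(`lowerSemicontinuous_Vext`) comes from compactness of trajectories (`exists_extAdmissible_limit`):
dynamics and cost are affine in the control, so weak limits of controls suffice.

The feedback is also singular as `ρ` tends to `0`. In `localized_inequality` everything is cut off
by a function of `ρ / ε`. The resulting error contains `cutoff'(ρ/ε) (ρ/ε)`, which is bounded
uniformly in `ε` and tends to zero pointwise, so `ε → 0` is dominated convergence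
(`setIntegral_posSet_le`).

The comparison with the sum-of-squares levels is an inclusion of feasible sets: the algebraic
certificates imply the sign conditions on `X` and on its boundary. -/

namespace DensityLP

/-! ### Polynomials -/

section Polynomials

variable {n : ℕ}

/-- The zero set of a nonzero real polynomial is a null set. -/
theorem volume_zeroSet_eq_zero : ∀ {n : ℕ} {p : MvPolynomial (Fin n) ℝ}, p ≠ 0 →
    volume {x : Fin n → ℝ | MvPolynomial.eval x p = 0} = 0
  | 0, p, hp => by
    have : {x : Fin 0 → ℝ | MvPolynomial.eval x p = 0} = ∅ := by
      ext x
      simp only [Set.mem_ofPred_eq, Set.mem_empty_iff_false, iff_false]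
      intro h
      apply hp
      rw [MvPolynomial.eq_C_of_isEmpty p] at h ⊢
      rw [MvPolynomial.eval_C] at h
      rw [h, MvPolynomial.C_0]
    rw [this, measure_empty]
  | n + 1, p, hp => by
    have hp' : MvPolynomial.finSuccEquiv ℝ n p ≠ 0 := by
      simpa using hp
    obtain ⟨k, hk⟩ : ∃ k, (MvPolynomial.finSuccEquiv ℝ n p).coeff k ≠ 0 := by
      by_contra! h
      exact hp' (Polynomial.ext (by simpa using h))
    have hmeas : MeasurableSet {x : Fin (n + 1) → ℝ | MvPolynomial.eval x p = 0} :=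
      (isClosed_eq (MvPolynomial.continuous_eval p) continuous_const).measurableSet
    have hmp := (volume_preserving_piFinSuccAbove (fun _ : Fin (n + 1) => ℝ) 0).symm
    rw [← hmp.measure_preimage hmeas.nullMeasurableSet, Measure.volume_eq_prod,
      ← Measure.prod_swap, Measure.map_apply measurable_swap (hmp.measurable hmeas),
      Measure.measure_prod_null (measurable_swap (hmp.measurable hmeas))]
    -- Fubini, with the polynomial read in its first variable: off a null set of the other variables
    -- some coefficient is nonzero, and the slice is then a finite set of roots.
    have hae : ∀ᵐ y : Fin n → ℝ,
        MvPolynomial.eval y ((MvPolynomial.finSuccEquiv ℝ n p).coeff k) ≠ 0 := by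
      simpa [ae_iff] using volume_zeroSet_eq_zero hk
    filter_upwards [hae] with y hy
    have hfin : ((Polynomial.map (MvPolynomial.eval y)
        (MvPolynomial.finSuccEquiv ℝ n p)).rootSet ℝ).Finite :=
      Polynomial.rootSet_finite _ _
    refine measure_mono_null (fun t ht => ?_) (hfin.measure_zero volume)
    have hq : Polynomial.map (MvPolynomial.eval y) (MvPolynomial.finSuccEquiv ℝ n p) ≠ 0 := by
      intro h
      apply hy
      rw [← Polynomial.coeff_map, h, Polynomial.coeff_zero]
    rw [Polynomial.mem_rootSet_of_ne hq]
    simp only [Set.mem_preimage, Prod.swap_prod_mk, Set.mem_ofPred_eq] at ht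
    rw [← ht, Polynomial.coe_aeval_eq_eval, ← MvPolynomial.eval_eq_eval_mv_eval']
    simp [MeasurableEquiv.piFinSuccAbove, Fin.insertNthEquiv]

/-- The derivative of the evaluation of a polynomial. -/
theorem hasFDerivAt_eval (p : MvPolynomial (Fin n) ℝ) (x : Fin n → ℝ) :
    HasFDerivAt (fun y : Fin n → ℝ => MvPolynomial.eval y p)
      (∑ j, MvPolynomial.eval x (MvPolynomial.pderiv j p) •
        (ContinuousLinearMap.proj j : (Fin n → ℝ) →L[ℝ] ℝ)) x := by
  induction p using MvPolynomial.induction_on with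
  | C a =>
    simpa using hasFDerivAt_const a x
  | add p q hp hq =>
    simp only [map_add, add_smul, Finset.sum_add_distrib]
    exact hp.add hq
  | mul_X p i hp =>
    have h := hp.mul (hasFDerivAt_apply i x)
    simp only [map_mul, MvPolynomial.eval_X]
    refine h.congr_fderiv (ContinuousLinearMap.ext fun v => ?_)
    simp only [Derivation.leibniz, smul_eq_mul, MvPolynomial.pderiv_X, map_add, map_mul,
      MvPolynomial.eval_X, add_smul, Finset.sum_add_distrib, Pi.single_apply]
    simp [apply_ite, mul_assoc, Finset.mul_sum]

theorem contDiff_eval (p : MvPolynomial (Fin n) ℝ) {k : WithTop ℕ∞} :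
    ContDiff ℝ k (fun y : Fin n → ℝ => MvPolynomial.eval y p) := by
  induction p using MvPolynomial.induction_on with
  | C a => simpa using contDiff_const
  | add p q hp hq => simpa using hp.add hq
  | mul_X p i hp => simpa using hp.mul (contDiff_apply ℝ ℝ i)

theorem fderiv_eval_single (p : MvPolynomial (Fin n) ℝ) (x : Fin n → ℝ) (j : Fin n) :
    fderiv ℝ (fun y : Fin n → ℝ => MvPolynomial.eval y p) x (Pi.single j 1) =
      MvPolynomial.eval x (MvPolynomial.pderiv j p) := by
  rw [(hasFDerivAt_eval p x).fderiv]
  simp [Pi.single_apply]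

theorem divergence_eval (F : Fin n → MvPolynomial (Fin n) ℝ) (x : Fin n → ℝ) :
    divergence (fun y j => MvPolynomial.eval y (F j)) x = MvPolynomial.eval x (polyDiv F) := by
  simp only [divergence, polyDiv, map_sum, fderiv_eval_single]

theorem isC1On_eval (X : Set (Fin n → ℝ)) (p : MvPolynomial (Fin n) ℝ) :
    IsC1On X (fun x => MvPolynomial.eval x p) :=
  ⟨(MvPolynomial.continuous_eval p).continuousOn, _,
    (contDiff_eval p (k := 1)).continuous_fderiv one_ne_zero |>.continuousOn,
    fun x _ => ((contDiff_eval p (k := 1)).differentiable one_ne_zero x).hasFDerivAt⟩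

theorem eval_nonneg_of_isSumSq {p : MvPolynomial (Fin n) ℝ} (hp : IsSumSq p) (x : Fin n → ℝ) :
    0 ≤ MvPolynomial.eval x p := by
  induction hp with
  | zero => simp
  | sq_add a _ ih => simpa using add_nonneg (mul_self_nonneg _) ih

end Polynomials

/-! ### The state constraint set and sum-of-squares certificates. -/

variable {n m ng : ℕ}

namespace Data

variable (D : Data n m ng)

theorem isClosed_X : IsClosed D.X := by
  simp only [X, Set.ofPred_forall]
  exact isClosed_iInter fun i =>
    isClosed_le continuous_const (MvPolynomial.continuous_eval (D.g i))

/-- If every nonzero `g_i` were positive at a point of `X`, continuity would put a neighbourhood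
into `X`; constraints with `g_i = 0` impose nothing. Nonvanishing of `g_i` is what makes the
boundary a null set. -/
theorem exists_g_eq_zero_of_mem_frontier {x : Fin n → ℝ} (hx : x ∈ frontier D.X) :
    ∃ i, D.g i ≠ 0 ∧ MvPolynomial.eval x (D.g i) = 0 := by
  by_contra! h
  have hxX : x ∈ D.X := D.isClosed_X.frontier_subset hx
  refine hx.2 (mem_interior_iff_mem_nhds.2 ?_)
  have : ∀ᶠ y in nhds x, ∀ i, 0 ≤ MvPolynomial.eval y (D.g i) := by
    rw [Filter.eventually_all]
    intro i
    by_cases hi : D.g i = 0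
    · simp [hi]
    · have hpos : 0 < MvPolynomial.eval x (D.g i) := lt_of_le_of_ne (hxX i) (Ne.symm (h i hi))
      exact ((MvPolynomial.continuous_eval (D.g i)).continuousAt.eventually
        (lt_mem_nhds hpos)).mono fun _ hy => le_of_lt hy
  exact this

/-- The boundary of the state constraint set is a null set. -/
theorem volume_frontier_X : volume (frontier D.X) = 0 := by
  have hsub : frontier D.X ⊆ ⋃ i : {i // D.g i ≠ 0},
      {x : Fin n → ℝ | MvPolynomial.eval x (D.g i) = 0} := fun x hx => by
    obtain ⟨i, hi, hxi⟩ := D.exists_g_eq_zero_of_mem_frontier hx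
    exact Set.mem_iUnion.2 ⟨⟨i, hi⟩, hxi⟩
  exact measure_mono_null hsub (measure_iUnion_null fun i => volume_zeroSet_eq_zero i.2)

variable {D}

theorem eval_nonneg_of_mem_Q {d : ℤ} {p : MvPolynomial (Fin n) ℝ} (hp : p ∈ D.Q d)
    {x : Fin n → ℝ} (hx : x ∈ D.X) : 0 ≤ MvPolynomial.eval x p := by
  obtain ⟨s₀, s, hs₀, hs, rfl⟩ := hp
  simp only [map_add, map_sum, map_mul]
  exact add_nonneg (eval_nonneg_of_isSumSq hs₀.1 x)
    (Finset.sum_nonneg fun i _ => mul_nonneg (hx i) (eval_nonneg_of_isSumSq (hs i).1 x))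

theorem eval_nonneg_of_mem_QQ {d : ℤ} {p : MvPolynomial (Fin n) ℝ} (hp : p ∈ D.QQ d)
    {x : Fin n → ℝ} (hx : x ∈ D.X) : 0 ≤ MvPolynomial.eval x p := by
  obtain ⟨q, hq, r, hr, rfl⟩ := hp
  simp only [map_add, map_mul]
  refine add_nonneg (eval_nonneg_of_mem_Q hq hx)
    (mul_nonneg ?_ (eval_nonneg_of_mem_Q hr hx))
  rw [gbar, map_prod]
  exact Finset.prod_nonneg fun i _ => hx i

/-- A feasible point of the sum-of-squares problem is feasible in the density linear program. -/
theorem SOSFeasible.lpFeasible {d : ℕ} {ρ ρ₀ ρT : MvPolynomial (Fin n) ℝ}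
    {σ : Fin m → MvPolynomial (Fin n) ℝ} (h : D.SOSFeasible d ρ ρ₀ ρT σ) :
    D.LPFeasible (fun x => MvPolynomial.eval x ρ) (fun x => MvPolynomial.eval x ρ₀)
      (fun x => MvPolynomial.eval x ρT) (fun i x => MvPolynomial.eval x (σ i)) where
  c1_rho := isC1On_eval _ _
  continuousOn_rho0 := (MvPolynomial.continuous_eval _).continuousOn
  continuousOn_rhoT := (MvPolynomial.continuous_eval _).continuousOn
  c1_sigma _ := isC1On_eval _ _
  liouville x _ := by
    have := congrArg (MvPolynomial.eval x) h.liouville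
    simp only [map_add, map_sub, map_mul, map_sum, map_zero, MvPolynomial.eval_C,
      ← divergence_eval] at this
    simpa only [map_mul] using this
  rho_nonpos x hx := by
    obtain ⟨i, -, hi⟩ := D.exists_g_eq_zero_of_mem_frontier hx
    -- With the certificate of an index active at `x`, both free multipliers are annihilated (`gbar`
    -- contains the factor `g_i`), which leaves `-ρ = q ≥ 0`.
    obtain ⟨q, hq, r, -, r', -, hr⟩ := h.neg_rho_mem i
    have hg : MvPolynomial.eval x D.gbar = 0 := by
      rw [gbar, map_prod]
      exact Finset.prod_eq_zero (Finset.mem_univ i) hi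
    have := congrArg (MvPolynomial.eval x) hr
    simp only [map_neg, map_add, map_mul, hi, hg, zero_mul, add_zero] at this
    linarith [eval_nonneg_of_mem_Q hq (D.isClosed_X.frontier_subset hx)]
  one_le_rho0 x hx := by
    have := eval_nonneg_of_mem_Q h.rho0_mem hx
    simp only [map_sub, map_one] at this
    linarith
  sigma_le x hx i := by
    have := eval_nonneg_of_mem_QQ (h.sigma_le_mem i) hx
    simp only [map_sub, map_mul, MvPolynomial.eval_C] at this
    linarith
  rhoT_nonneg x hx := eval_nonneg_of_mem_Q h.rhoT_mem hx
  sigma_nonneg x hx i := eval_nonneg_of_mem_QQ (h.sigma_mem i) hx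

/-- The sum-of-squares levels are tightenings of the density linear program. -/
theorem pStar_le_pSOS (D : Data n m ng) (d : ℕ) : D.pStar ≤ D.pSOS d := by
  refine le_sInf ?_
  rintro c ⟨ρ, ρ₀, ρT, σ, h, rfl⟩
  exact sInf_le ⟨_, _, _, _, h.lpFeasible, rfl⟩

end Data

end DensityLP

namespace DensityLP

open Filter Set
open scoped Topology NNReal

/-! ### The flow of a bounded Lipschitz vector field on the unit time interval -/

section Flow

variable {E : Type*} [NormedAddCommGroup E] [NormedSpace ℝ E]

/-- `Φ` is the flow of the vector field `F` for times in `[0,1]`. -/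
structure IsUnitFlow (F : E → E) (Φ : ℝ → E → E) : Prop where
  zero : ∀ x, Φ 0 x = x
  hasDerivWithinAt : ∀ x, ∀ t ∈ Icc (0 : ℝ) 1,
    HasDerivWithinAt (fun s => Φ s x) (F (Φ t x)) (Icc 0 1) t

/-- The bound `B` on the speed confines a curve to a ball of radius `B` during unit time, so one
application of Picard–Lindelöf on that ball reaches time `1`. -/
theorem exists_isUnitFlow [CompleteSpace E] {F : E → E} {K B : ℝ≥0} (hF : LipschitzWith K F)
    (hB : ∀ x, ‖F x‖ ≤ B) : ∃ Φ, IsUnitFlow F Φ := by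
  have h : ∀ x : E, ∃ α : ℝ → E, α 0 = x ∧
      ∀ t ∈ Icc (0 : ℝ) 1, HasDerivWithinAt α (F (α t)) (Icc 0 1) t := fun x => by
    have hPL : IsPicardLindelof (fun _ => F) (tmin := 0) (tmax := 1)
        ⟨0, left_mem_Icc.2 zero_le_one⟩ x B 0 B K :=
      IsPicardLindelof.of_time_independent (fun y _ => hB y) hF.lipschitzOnWith (by simp)
    exact hPL.exists_eq_forall_mem_Icc_hasDerivWithinAt₀
  choose α hα using h
  exact ⟨fun t x => α x t, fun x => (hα x).1, fun x => (hα x).2⟩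

namespace IsUnitFlow

variable {F : E → E} {Φ : ℝ → E → E} (hΦ : IsUnitFlow F Φ)

include hΦ

theorem continuousOn (x : E) : ContinuousOn (fun s => Φ s x) (Icc 0 1) :=
  fun t ht => (hΦ.hasDerivWithinAt x t ht).continuousWithinAt

theorem hasDerivWithinAt_Ici (x : E) {t : ℝ} (ht : t ∈ Ico (0 : ℝ) 1) :
    HasDerivWithinAt (fun s => Φ s x) (F (Φ t x)) (Ici t) t :=
  (hΦ.hasDerivWithinAt x t (Ico_subset_Icc_self ht)).mono_of_mem_nhdsWithin
    (Icc_mem_nhdsGE_of_mem ht)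

/-- Grönwall's estimate, with `K t ≤ K` for `t ≤ 1`. -/
theorem lipschitzWith {K : ℝ≥0} (hF : LipschitzWith K F) {t : ℝ} (ht : t ∈ Icc (0 : ℝ) 1) :
    LipschitzWith (Real.exp K).toNNReal (Φ t) := by
  refine LipschitzWith.of_dist_le_mul fun x y => ?_
  have h := dist_le_of_trajectories_ODE (v := fun _ => F) (fun _ => hF) (hΦ.continuousOn x)
    (fun s hs => hΦ.hasDerivWithinAt_Ici x hs) (hΦ.continuousOn y)
    (fun s hs => hΦ.hasDerivWithinAt_Ici y hs) le_rfl t ht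
  rw [hΦ.zero, hΦ.zero, sub_zero] at h
  rw [Real.coe_toNNReal _ (Real.exp_pos _).le, mul_comm]
  refine h.trans (mul_le_mul_of_nonneg_left (Real.exp_le_exp.2 ?_) dist_nonneg)
  exact mul_le_of_le_one_right K.2 ht.2

theorem norm_sub_le {B : ℝ} (hB : ∀ x, ‖F x‖ ≤ B) (x : E) {t : ℝ} (ht : t ∈ Icc (0 : ℝ) 1) :
    ‖Φ t x - x‖ ≤ B * t := by
  have h := norm_image_sub_le_of_norm_deriv_le_segment' (hΦ.hasDerivWithinAt x)
    (fun s _ => hB _) t ht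
  simpa [hΦ.zero] using h

/-- Both sides, as functions of `s`, solve the same equation from `Φ r x`, so uniqueness applies. -/
theorem add {K : ℝ≥0} (hF : LipschitzWith K F) (x : E) {s r : ℝ} (hs : 0 ≤ s) (hr : 0 ≤ r)
    (hsr : s + r ≤ 1) : Φ (s + r) x = Φ s (Φ r x) := by
  have hmaps : MapsTo (fun τ : ℝ => τ + r) (Icc 0 s) (Icc 0 1) := fun τ hτ =>
    ⟨add_nonneg hτ.1 hr, by linarith [hτ.2]⟩
  have hsub : Icc 0 s ⊆ Icc (0 : ℝ) 1 := Icc_subset_Icc le_rfl (by linarith)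
  have key := ODE_solution_unique (v := fun _ => F) (a := 0) (b := s)
    (f := fun τ => Φ (τ + r) x) (g := fun τ => Φ τ (Φ r x)) (fun _ => hF)
    ((hΦ.continuousOn x).comp (by fun_prop) hmaps) ?_
    ((hΦ.continuousOn (Φ r x)).mono hsub)
    (fun t ht => hΦ.hasDerivWithinAt_Ici _ ⟨ht.1, by linarith [ht.2]⟩)
    (by simp [hΦ.zero])
  · exact key (right_mem_Icc.2 hs)
  · intro t ht
    have h1 := hΦ.hasDerivWithinAt_Ici x (t := t + r) ⟨add_nonneg ht.1 hr, by linarith [ht.2]⟩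
    have h2 : HasDerivWithinAt (fun τ : ℝ => τ + r) 1 (Ici t) t :=
      ((hasDerivAt_id t).add_const r).hasDerivWithinAt
    have h3 := h1.scomp t h2 (fun τ hτ => mem_Ici.2 (add_le_add_left (mem_Ici.1 hτ) r))
    rw [one_smul] at h3
    exact h3

end IsUnitFlow

end Flow

/-! ### Lipschitz approximation of lower semicontinuous functions -/

/-- The approximants are the inf-convolutions `x ↦ inf_y (V y + k d(x,y))`. They inherit both
bounds, which makes dominated convergence available later. -/
theorem exists_lipschitz_tendsto_of_lowerSemicontinuous {E : Type*} [PseudoMetricSpace E]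
    {V : E → ℝ} {M : ℝ} (hV : LowerSemicontinuous V) (h0 : ∀ x, 0 ≤ V x) (hM : ∀ x, V x ≤ M) :
    ∃ W : ℕ → E → ℝ, (∀ k : ℕ, LipschitzWith k (W k)) ∧ (∀ k x, 0 ≤ W k x) ∧ (∀ k x, W k x ≤ M) ∧
      ∀ x, Tendsto (fun k => W k x) atTop (𝓝 (V x)) := by
  have hbdd : ∀ (k : ℕ) (x : E), BddBelow (range fun y => V y + k * dist x y) := fun k x =>
    ⟨0, by rintro _ ⟨y, rfl⟩; exact add_nonneg (h0 y) (by positivity)⟩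
  have hle : ∀ (k : ℕ) (x : E), ⨅ y, (V y + k * dist x y) ≤ V x := fun k x =>
    (ciInf_le (hbdd k x) x).trans (by simp)
  refine ⟨fun k x => ⨅ y, (V y + k * dist x y), fun k => ?_, fun k x => ?_, fun k x => ?_,
    fun x => ?_⟩
  · refine LipschitzWith.of_le_add_mul _ fun x y => ?_
    have : Nonempty E := ⟨x⟩
    rw [← sub_le_iff_le_add]
    refine le_ciInf fun z => ?_
    rw [sub_le_iff_le_add]
    refine (ciInf_le (hbdd k x) z).trans ?_
    have := dist_triangle x y z
    have hk : (0 : ℝ) ≤ k := by positivity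
    push_cast
    nlinarith
  · exact Real.iInf_nonneg fun y => add_nonneg (h0 y) (by positivity)
  · exact (hle k x).trans (hM x)
  · refine tendsto_order.2 ⟨fun a ha => ?_, fun a ha =>
      Eventually.of_forall fun k => (hle k x).trans_lt ha⟩
    obtain ⟨b, hab, hb⟩ := exists_between ha
    obtain ⟨δ, hδ, hball⟩ := Metric.eventually_nhds_iff.1 (hV x b hb)
    -- Within distance `δ` lower semicontinuity keeps `V y > b`; beyond it the penalty alone is at
    -- least `N δ ≥ M ≥ V x > b`.
    obtain ⟨N, hN⟩ := exists_nat_ge (M / δ)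
    filter_upwards [eventually_ge_atTop N] with k hk
    have : Nonempty E := ⟨x⟩
    refine hab.trans_le (le_ciInf fun y => ?_)
    by_cases hy : dist y x < δ
    · have := hball hy
      have h2 : (0 : ℝ) ≤ k * dist x y := by positivity
      linarith
    · have h3 : M ≤ k * dist x y := by
        rw [div_le_iff₀ hδ] at hN
        have h4 : (N : ℝ) ≤ k := by exact_mod_cast hk
        rw [dist_comm] at hy
        push Not at hy
        calc M ≤ N * δ := hN
          _ ≤ k * dist x y := by gcongr
      linarith [h0 y, hM x]

/-! ### Transport along the flow -/

section Transport

variable {n : ℕ}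

theorem lipschitzWith_mul_of_bounded {E : Type*} [PseudoMetricSpace E] {f g : E → ℝ}
    {Kf Kg A B : ℝ≥0} (hf : LipschitzWith Kf f) (hg : LipschitzWith Kg g) (hA : ∀ x, |f x| ≤ A)
    (hB : ∀ x, |g x| ≤ B) : LipschitzWith (A * Kg + B * Kf) (fun x => f x * g x) := by
  refine LipschitzWith.of_dist_le_mul fun x y => ?_
  have h1 := hf.dist_le_mul x y
  have h2 := hg.dist_le_mul x y
  rw [Real.dist_eq] at h1 h2 ⊢
  have : f x * g x - f y * g y = f x * (g x - g y) + g y * (f x - f y) := by ring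
  rw [this]
  refine (abs_add_le _ _).trans ?_
  rw [abs_mul, abs_mul]
  push_cast
  rw [add_mul, mul_assoc, mul_assoc]
  exact add_le_add (mul_le_mul (hA x) h2 (abs_nonneg _) A.2)
    (mul_le_mul (hB y) h1 (abs_nonneg _) B.2)

/-- The almost everywhere defined divergence of `ψ F`. -/
noncomputable def weakDiv (ψ : (Fin n → ℝ) → ℝ) (F : (Fin n → ℝ) → Fin n → ℝ) (x : Fin n → ℝ) : ℝ :=
  ∑ j, lineDeriv ℝ (fun y => ψ y * F y j) x (Pi.single j 1)

variable {F : (Fin n → ℝ) → Fin n → ℝ} {K B : ℝ≥0} {ψ : (Fin n → ℝ) → ℝ} {Kψ : ℝ≥0}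
  {Φ : ℝ → (Fin n → ℝ) → Fin n → ℝ}

theorem exists_lipschitzWith_mul_apply (hF : LipschitzWith K F) (hB : ∀ x, ‖F x‖ ≤ B)
    (hψ : LipschitzWith Kψ ψ) (hc : HasCompactSupport ψ) (j : Fin n) :
    ∃ C, LipschitzWith C (fun y => ψ y * F y j) := by
  obtain ⟨A, hA⟩ := hc.exists_bound_of_continuous hψ.continuous
  refine ⟨_, lipschitzWith_mul_of_bounded (A := A.toNNReal) (B := B) hψ
    ((LipschitzWith.eval j).comp hF) (fun x => (hA x).trans (Real.le_coe_toNNReal A))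
    fun x => (norm_le_pi_norm (F x) j).trans (hB x)⟩

theorem lineDeriv_eq_zero_of_notMem_tsupport {f : (Fin n → ℝ) → ℝ} {x v : Fin n → ℝ}
    (hx : x ∉ tsupport f) : lineDeriv ℝ f x v = 0 := by
  have h0 : f =ᶠ[𝓝 x] fun _ => 0 := notMem_tsupport_iff_eventuallyEq.1 hx
  rw [h0.lineDeriv_eq]
  simp [lineDeriv]

theorem integrable_lineDeriv {f : (Fin n → ℝ) → ℝ} {C : ℝ≥0} (hf : LipschitzWith C f)
    (hc : HasCompactSupport f) (v : Fin n → ℝ) : Integrable (fun x => lineDeriv ℝ f x v) := by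
  have h1 : IntegrableOn (fun x => lineDeriv ℝ f x v) (tsupport f) :=
    Measure.integrableOn_of_bounded hc.isCompact.measure_lt_top.ne
      (aestronglyMeasurable_lineDeriv hf.continuous _)
      (M := C * ‖v‖) (Eventually.of_forall fun x => norm_lineDeriv_le_of_lipschitz ℝ hf)
  exact (integrableOn_iff_integrable_of_support_subset fun x hx => by
    by_contra h
    exact hx (lineDeriv_eq_zero_of_notMem_tsupport h)).1 h1

theorem integrable_weakDiv (hF : LipschitzWith K F) (hB : ∀ x, ‖F x‖ ≤ B)
    (hψ : LipschitzWith Kψ ψ) (hc : HasCompactSupport ψ) : Integrable (weakDiv ψ F) := by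
  refine integrable_finsetSum _ fun j _ => ?_
  obtain ⟨C, hC⟩ := exists_lipschitzWith_mul_apply hF hB hψ hc j
  exact integrable_lineDeriv hC hc.mul_right _

/-- Derivative at time zero of the transport of a Lipschitz function. -/
theorem tendsto_integral_comp_flow (hF : LipschitzWith K F) (hB : ∀ x, ‖F x‖ ≤ B)
    (hΦ : IsUnitFlow F Φ) (hψ : LipschitzWith Kψ ψ) (hc : HasCompactSupport ψ)
    {q : (Fin n → ℝ) → ℝ} {Kq : ℝ≥0} (hq : LipschitzWith Kq q) :
    Tendsto (fun r : ℝ => ∫ x, ψ x * (r⁻¹ * (q (Φ r x) - q x))) (𝓝[>] 0)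
      (𝓝 (-∫ x, weakDiv ψ F x * q x)) := by
  -- Integration by parts for Lipschitz functions, coordinate by coordinate; derivatives exist
  -- almost everywhere by Rademacher's theorem, and compact support of `ψ` removes boundary terms.
  have hlim : ∫ x, ψ x * fderiv ℝ q x (F x) = -∫ x, weakDiv ψ F x * q x := by
    have hae : (fun x => ψ x * fderiv ℝ q x (F x)) =ᵐ[volume]
        fun x => ∑ j, lineDeriv ℝ q x (Pi.single j 1) * (ψ x * F x j) := by
      filter_upwards [hq.ae_differentiableAt (μ := volume)] with x hx
      have hFx : F x = ∑ j, F x j • (Pi.single j 1 : Fin n → ℝ) := by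
        simpa using (pi_eq_sum_univ' (F x))
      conv_lhs => rw [hFx]
      rw [map_sum, Finset.mul_sum]
      refine Finset.sum_congr rfl fun j _ => ?_
      rw [hx.lineDeriv_eq_fderiv, map_smul, smul_eq_mul]
      ring
    have hint : ∀ j, Integrable (fun x => lineDeriv ℝ q x (Pi.single j 1) * (ψ x * F x j)) := by
      intro j
      obtain ⟨C, hC⟩ := exists_lipschitzWith_mul_apply hF hB hψ hc j
      exact (hC.continuous.integrable_of_hasCompactSupport hc.mul_right).bdd_mul
        (c := Kq * ‖(Pi.single j 1 : Fin n → ℝ)‖)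
        (aestronglyMeasurable_lineDeriv hq.continuous _)
        (Eventually.of_forall fun x => norm_lineDeriv_le_of_lipschitz ℝ hq)
    have hint' : ∀ j, Integrable
        (fun x => lineDeriv ℝ (fun y => ψ y * F y j) x (Pi.single j 1) * q x) := by
      intro j
      obtain ⟨C, hC⟩ := exists_lipschitzWith_mul_apply hF hB hψ hc j
      have hcs : HasCompactSupport (fun y => ψ y * F y j) := hc.mul_right
      have h0 : ∀ x ∉ tsupport (fun y => ψ y * F y j),
          lineDeriv ℝ (fun y => ψ y * F y j) x (Pi.single j 1) * q x = 0 := fun x hx => by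
        rw [lineDeriv_eq_zero_of_notMem_tsupport hx, zero_mul]
      obtain ⟨A, hA⟩ := hcs.isCompact.exists_bound_of_continuousOn hq.continuous.continuousOn
      refine (integrableOn_iff_integrable_of_support_subset (s := tsupport fun y => ψ y * F y j)
        fun x hx => by
          by_contra h
          exact hx (h0 x h)).1 ?_
      refine (integrable_lineDeriv hC hcs _).integrableOn.mul_bdd (c := A)
        hq.continuous.aestronglyMeasurable ?_
      filter_upwards [ae_restrict_mem hcs.isCompact.measurableSet] with x hx using hA x hx
    rw [integral_congr_ae hae, integral_finsetSum _ fun j _ => hint j]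
    simp only [weakDiv, Finset.sum_mul]
    rw [integral_finsetSum _ fun j _ => hint' j, ← Finset.sum_neg_distrib]
    refine Finset.sum_congr rfl fun j _ => ?_
    obtain ⟨C, hC⟩ := exists_lipschitzWith_mul_apply hF hB hψ hc j
    rw [hq.integral_lineDeriv_mul_eq hC hc.mul_right, ← integral_neg]
    refine integral_congr_ae (Eventually.of_forall fun x => ?_)
    simp only [lineDeriv_neg]
    ring
  rw [← hlim]
  have hmem : Ioc (0 : ℝ) 1 ∈ 𝓝[>] (0 : ℝ) := Ioc_mem_nhdsGT zero_lt_one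
  -- Since `‖Φ r x - x‖ ≤ B r`, the difference quotient of `q` along the flow is at most `Kq B`,
  -- uniformly in `r`.
  refine tendsto_integral_filter_of_dominated_convergence (fun x => ‖ψ x‖ * (Kq * B)) ?_ ?_
    ((hψ.continuous.integrable_of_hasCompactSupport hc).norm.mul_const _) ?_
  · filter_upwards [hmem] with r hr
    have := (hΦ.lipschitzWith hF (Ioc_subset_Icc_self hr)).continuous
    have h1 := hψ.continuous
    have h2 := hq.continuous
    exact (by fun_prop : Continuous _).aestronglyMeasurable
  · filter_upwards [hmem] with r hr
    refine Eventually.of_forall fun x => ?_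
    rw [norm_mul]
    refine mul_le_mul_of_nonneg_left ?_ (norm_nonneg _)
    have h1 := hq.norm_sub_le (Φ r x) x
    have h2 := hΦ.norm_sub_le hB x (Ioc_subset_Icc_self hr)
    rw [norm_mul, norm_inv, Real.norm_of_nonneg hr.1.le, inv_mul_le_iff₀ hr.1]
    calc ‖q (Φ r x) - q x‖ ≤ Kq * ‖Φ r x - x‖ := h1
      _ ≤ Kq * (B * r) := by gcongr
      _ = r * (Kq * B) := by ring
  · filter_upwards [hq.ae_differentiableAt (μ := volume)] with x hx
    refine Tendsto.const_mul _ ?_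
    have h1 : HasDerivWithinAt (fun s => Φ s x) (F x) (Ici 0) 0 := by
      simpa [hΦ.zero] using hΦ.hasDerivWithinAt_Ici x (left_mem_Ico.2 zero_lt_one)
    have h2 : HasFDerivAt q (fderiv ℝ q x) (Φ 0 x) := by
      rw [hΦ.zero]
      exact hx.hasFDerivAt
    have h3 := (h2.comp_hasDerivWithinAt (0 : ℝ) h1).Ioi_of_Ici
    rw [hasDerivWithinAt_iff_tendsto_slope' self_notMem_Ioi] at h3
    refine h3.congr fun r => ?_
    simp only [slope_def_field, Function.comp_apply, hΦ.zero, sub_zero]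
    rw [div_eq_inv_mul]

theorem continuousOn_integral_comp_flow (hF : LipschitzWith K F) (hΦ : IsUnitFlow F Φ)
    {w q : (Fin n → ℝ) → ℝ} (hw : Integrable w) (hq : Continuous q) {M : ℝ}
    (hM : ∀ x, ‖q x‖ ≤ M) : ContinuousOn (fun s => ∫ x, w x * q (Φ s x)) (Icc 0 1) := by
  refine continuousOn_of_dominated (bound := fun x => ‖w x‖ * M) (fun s hs => ?_)
    (fun s _ => Eventually.of_forall fun x => ?_) (hw.norm.mul_const M)
    (Eventually.of_forall fun x => ?_)
  · exact hw.aestronglyMeasurable.mul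
      (hq.comp (hΦ.lipschitzWith hF hs).continuous).aestronglyMeasurable
  · rw [norm_mul]
    exact mul_le_mul_of_nonneg_left (hM _) (norm_nonneg _)
  · exact (hq.comp_continuousOn (hΦ.continuousOn x)).const_mul _

/-- Transport of a bounded Lipschitz function along the flow, in integrated form. -/
theorem integral_comp_flow_of_lipschitz (hF : LipschitzWith K F) (hB : ∀ x, ‖F x‖ ≤ B)
    (hΦ : IsUnitFlow F Φ) (hψ : LipschitzWith Kψ ψ) (hc : HasCompactSupport ψ)
    {q : (Fin n → ℝ) → ℝ} {Kq : ℝ≥0} (hq : LipschitzWith Kq q) {M : ℝ} (hM : ∀ x, ‖q x‖ ≤ M)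
    {h : ℝ} (hh : h ∈ Icc (0 : ℝ) 1) :
    ∫ x, ψ x * q (Φ h x) =
      (∫ x, ψ x * q x) - ∫ s in (0 : ℝ)..h, ∫ x, weakDiv ψ F x * q (Φ s x) := by
  have hψi := hψ.continuous.integrable_of_hasCompactSupport (μ := volume) hc
  have hw := integrable_weakDiv hF hB hψ hc
  have hcont := continuousOn_integral_comp_flow hF hΦ hψi hq.continuous hM
  have hcontw := continuousOn_integral_comp_flow hF hΦ hw hq.continuous hM
  have hsub : Icc 0 h ⊆ Icc (0 : ℝ) 1 := Icc_subset_Icc le_rfl hh.2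
  have hderiv : ∀ s ∈ Ioo (0 : ℝ) h, HasDerivWithinAt (fun s => ∫ x, ψ x * q (Φ s x))
      (-∫ x, weakDiv ψ F x * q (Φ s x)) (Ioi s) s := by
    intro s hs
    have hs1 : s < 1 := hs.2.trans_le hh.2
    have hsI : s ∈ Icc (0 : ℝ) 1 := ⟨hs.1.le, hs1.le⟩
    -- The right derivative at time `s` is the one at time zero for the Lipschitz function `q ∘ Φ
    -- s`, because `Φ t = Φ s ∘ Φ (t - s)`.
    have hqs := hq.comp (hΦ.lipschitzWith hF hsI)
    have key := tendsto_integral_comp_flow hF hB hΦ hψ hc hqs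
    rw [hasDerivWithinAt_iff_tendsto_slope' self_notMem_Ioi]
    have hmap : Tendsto (fun t : ℝ => t - s) (𝓝[>] s) (𝓝[>] 0) := by
      refine tendsto_nhdsWithin_iff.2 ⟨?_, ?_⟩
      · have : Tendsto (fun t : ℝ => t - s) (𝓝 s) (𝓝 (s - s)) :=
          (continuous_id.sub continuous_const).tendsto s
        rw [sub_self] at this
        exact this.mono_left nhdsWithin_le_nhds
      · filter_upwards [self_mem_nhdsWithin] with t ht
        exact sub_pos.2 (mem_Ioi.1 ht)
    refine (key.comp hmap).congr' ?_
    filter_upwards [Ioc_mem_nhdsGT hs1] with t ht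
    have hint : ∀ τ ∈ Icc (0 : ℝ) 1, Integrable (fun x => ψ x * q (Φ τ x)) := fun τ hτ =>
      hψi.mul_bdd (c := M)
        (hq.continuous.comp (hΦ.lipschitzWith hF hτ).continuous).aestronglyMeasurable
        (Eventually.of_forall fun x => hM _)
    rw [slope_def_field, ← integral_sub (hint t ⟨hs.1.le.trans ht.1.le, ht.2⟩) (hint s hsI),
      div_eq_inv_mul, ← integral_const_mul]
    refine integral_congr_ae (Eventually.of_forall fun x => ?_)
    have hadd := hΦ.add hF x hs.1.le (sub_nonneg.2 ht.1.le) (by linarith [ht.2])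
    rw [add_sub_cancel] at hadd
    simp only [Function.comp_apply]
    rw [hadd]
    ring
  have := intervalIntegral.integral_eq_sub_of_hasDeriv_right_of_le hh.1 (hcont.mono hsub) hderiv
    ((hcontw.mono hsub).neg.intervalIntegrable_of_Icc hh.1)
  rw [intervalIntegral.integral_neg] at this
  simp only [hΦ.zero] at this
  linarith

variable {V : (Fin n → ℝ) → ℝ} {M : ℝ}

theorem norm_integral_mul_comp_le {w : (Fin n → ℝ) → ℝ} (hw : Integrable w)
    (h0 : ∀ x, 0 ≤ V x) (hM : ∀ x, V x ≤ M) (S : (Fin n → ℝ) → Fin n → ℝ) :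
    ‖∫ x, w x * V (S x)‖ ≤ (∫ x, ‖w x‖) * M := by
  rw [← integral_mul_const]
  refine norm_integral_le_of_norm_le (hw.norm.mul_const M) (Eventually.of_forall fun x => ?_)
  rw [norm_mul, Real.norm_of_nonneg (h0 _)]
  exact mul_le_mul_of_nonneg_left (hM _) (norm_nonneg _)

theorem tendsto_integral_mul_comp {w : (Fin n → ℝ) → ℝ} (hw : Integrable w)
    {W : ℕ → (Fin n → ℝ) → ℝ} (hW : ∀ k, Continuous (W k)) (hM : ∀ k x, ‖W k x‖ ≤ M)
    (hWV : ∀ x, Tendsto (fun k => W k x) atTop (𝓝 (V x)))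
    {S : (Fin n → ℝ) → Fin n → ℝ} (hS : Continuous S) :
    Tendsto (fun k => ∫ x, w x * W k (S x)) atTop (𝓝 (∫ x, w x * V (S x))) := by
  refine tendsto_integral_of_dominated_convergence (fun x => ‖w x‖ * M) (fun k => ?_)
    (hw.norm.mul_const M) (fun k => Eventually.of_forall fun x => ?_)
    (Eventually.of_forall fun x => (hWV _).const_mul _)
  · exact hw.aestronglyMeasurable.mul ((hW k).comp hS).aestronglyMeasurable
  · rw [norm_mul]
    exact mul_le_mul_of_nonneg_left (hM k _) (norm_nonneg _)

/-- A pointwise limit in `s` of the continuous functions obtained from inf-convolutions of `V`.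
Measurability is needed to average over short times. -/
theorem aestronglyMeasurable_integral_comp_flow (hF : LipschitzWith K F) (hΦ : IsUnitFlow F Φ)
    (hV : LowerSemicontinuous V) (h0 : ∀ x, 0 ≤ V x) (hM : ∀ x, V x ≤ M)
    {w : (Fin n → ℝ) → ℝ} (hw : Integrable w) :
    AEStronglyMeasurable (fun s => ∫ x, w x * V (Φ s x)) (volume.restrict (Icc 0 1)) := by
  obtain ⟨W, hWL, hW0, hWM, hWV⟩ := exists_lipschitz_tendsto_of_lowerSemicontinuous hV h0 hM
  have hWn : ∀ k x, ‖W k x‖ ≤ M := fun k x => by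
    rw [Real.norm_of_nonneg (hW0 k x)]
    exact hWM k x
  refine aestronglyMeasurable_of_tendsto_ae atTop (f := fun k s => ∫ x, w x * W k (Φ s x))
    (fun k => (continuousOn_integral_comp_flow hF hΦ hw (hWL k).continuous
      (hWn k)).aestronglyMeasurable measurableSet_Icc) ?_
  filter_upwards [ae_restrict_mem measurableSet_Icc] with s hs
  exact tendsto_integral_mul_comp hw (fun k => (hWL k).continuous) hWn hWV
    (hΦ.lipschitzWith hF hs).continuous

/-- Transport of a bounded lower semicontinuous function along the flow, in integrated form. -/
theorem integral_comp_flow (hF : LipschitzWith K F) (hB : ∀ x, ‖F x‖ ≤ B)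
    (hΦ : IsUnitFlow F Φ) (hψ : LipschitzWith Kψ ψ) (hc : HasCompactSupport ψ)
    (hV : LowerSemicontinuous V) (h0 : ∀ x, 0 ≤ V x) (hM : ∀ x, V x ≤ M)
    {h : ℝ} (hh : h ∈ Icc (0 : ℝ) 1) :
    ∫ x, ψ x * V (Φ h x) =
      (∫ x, ψ x * V x) - ∫ s in (0 : ℝ)..h, ∫ x, weakDiv ψ F x * V (Φ s x) := by
  -- The identity is stable under bounded pointwise limits of the transported function, so the
  -- Lipschitz case for the inf-convolutions of `V` implies it.
  obtain ⟨W, hWL, hW0, hWM, hWV⟩ := exists_lipschitz_tendsto_of_lowerSemicontinuous hV h0 hM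
  have hψi := hψ.continuous.integrable_of_hasCompactSupport (μ := volume) hc
  have hw := integrable_weakDiv hF hB hψ hc
  have hWn : ∀ k x, ‖W k x‖ ≤ M := fun k x => by
    rw [Real.norm_of_nonneg (hW0 k x)]
    exact hWM k x
  have hlim {w : (Fin n → ℝ) → ℝ} (hw : Integrable w) (s : ℝ) (hs : s ∈ Icc (0 : ℝ) 1) :=
    tendsto_integral_mul_comp hw (fun k => (hWL k).continuous) hWn hWV
      (hΦ.lipschitzWith hF hs).continuous
  have hsub : Icc 0 h ⊆ Icc (0 : ℝ) 1 := Icc_subset_Icc le_rfl hh.2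
  have h1 : Tendsto (fun k => ∫ s in (0 : ℝ)..h, ∫ x, weakDiv ψ F x * W k (Φ s x)) atTop
      (𝓝 (∫ s in (0 : ℝ)..h, ∫ x, weakDiv ψ F x * V (Φ s x))) := by
    refine intervalIntegral.tendsto_integral_filter_of_dominated_convergence
      (fun _ => (∫ x, ‖weakDiv ψ F x‖) * M) (Eventually.of_forall fun k => ?_)
      (Eventually.of_forall fun k => Eventually.of_forall fun s _ =>
        norm_integral_mul_comp_le hw (hW0 k) (hWM k) _)
      intervalIntegrable_const (Eventually.of_forall fun s hs => hlim hw s ?_)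
    · rw [uIoc_of_le hh.1]
      exact ((continuousOn_integral_comp_flow hF hΦ hw (hWL k).continuous (hWn k)).mono
        (Ioc_subset_Icc_self.trans hsub)).aestronglyMeasurable measurableSet_Ioc
    · rw [uIoc_of_le hh.1] at hs
      exact hsub (Ioc_subset_Icc_self hs)
  have h2 := hlim hψi 0 (left_mem_Icc.2 zero_le_one)
  simp only [hΦ.zero] at h2
  refine tendsto_nhds_unique (hlim hψi h hh) ((h2.sub h1).congr fun k => ?_)
  exact (integral_comp_flow_of_lipschitz hF hB hΦ hψ hc (hWL k) (hWn k) hh).symm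

/-- Pointwise `V (Φ s x)` need not converge to `V x`. For a smooth compactly supported weight,
however, the transport identity bounds the change of the integral by a multiple of `s`; density of
such weights in `L¹` and boundedness of `V` cover every integrable `w`. -/
theorem tendsto_integral_mul_comp_flow (hF : LipschitzWith K F) (hB : ∀ x, ‖F x‖ ≤ B)
    (hΦ : IsUnitFlow F Φ) (hV : LowerSemicontinuous V) (h0 : ∀ x, 0 ≤ V x)
    (hM : ∀ x, V x ≤ M) {w : (Fin n → ℝ) → ℝ} (hw : Integrable w) :
    Tendsto (fun s => ∫ x, w x * V (Φ s x)) (𝓝[>] 0) (𝓝 (∫ x, w x * V x)) := by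
  have hVn : ∀ x, ‖V x‖ ≤ M := fun x => by
    rw [Real.norm_of_nonneg (h0 x)]
    exact hM x
  have hM0 : 0 ≤ M := (h0 0).trans (hM 0)
  have hint : ∀ {w : (Fin n → ℝ) → ℝ}, Integrable w → ∀ s ∈ Icc (0 : ℝ) 1,
      Integrable (fun x => w x * V (Φ s x)) := fun hw s hs =>
    hw.mul_bdd (c := M)
      (hV.measurable.comp (hΦ.lipschitzWith hF hs).continuous.measurable).aestronglyMeasurable
      (Eventually.of_forall fun x => hVn _)
  rw [Metric.tendsto_nhds]
  intro ε hε
  -- The approximation error `δ M < ε / 4` enters twice, at times `s` and `0`; the motion of the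
  -- smooth part takes the remaining `ε / 2`.
  set δ := ε / (4 * (M + 1)) with hδ
  have hδ0 : 0 < δ := by positivity
  obtain ⟨g, hgc, hgs, hg⟩ := (memLp_one_iff_integrable.2 hw).exist_eLpNorm_sub_le
    (by simp) le_rfl hδ0
  have hgi : Integrable g := hgs.continuous.integrable_of_hasCompactSupport hgc
  have hwg : ∫ x, ‖w x - g x‖ ≤ δ := by
    change ∫ x, ‖(w - g) x‖ ≤ δ
    rw [integral_norm_eq_lintegral_enorm (hw.sub hgi).aestronglyMeasurable]
    refine ENNReal.toReal_le_of_le_ofReal hδ0.le ?_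
    rw [← eLpNorm_one_eq_lintegral_enorm]
    exact hg
  obtain ⟨Kg, hKg⟩ := ContDiff.lipschitzWith_of_hasCompactSupport hgc hgs (by simp)
  set A := (∫ x, ‖weakDiv g F x‖) * M with hA
  have hA0 : 0 ≤ A := mul_nonneg (integral_nonneg fun x => norm_nonneg _) hM0
  have hsmall : Ioo (0 : ℝ) (min 1 (ε / (2 * (A + 1)))) ∈ 𝓝[>] (0 : ℝ) :=
    Ioo_mem_nhdsGT (lt_min zero_lt_one (by positivity))
  filter_upwards [hsmall] with s hs
  have hs1 : s ∈ Icc (0 : ℝ) 1 := ⟨hs.1.le, hs.2.le.trans (min_le_left _ _)⟩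
  have hs2 : A * s ≤ ε / 2 := by
    have h1 : s ≤ ε / (2 * (A + 1)) := hs.2.le.trans (min_le_right _ _)
    rw [le_div_iff₀ (by positivity)] at h1
    nlinarith [hs.1]
  have hg1 : ‖(∫ x, g x * V (Φ s x)) - ∫ x, g x * V x‖ ≤ A * s := by
    rw [integral_comp_flow hF hB hΦ hKg hgc hV h0 hM hs1, sub_sub_cancel_left, norm_neg]
    have := intervalIntegral.norm_integral_le_of_norm_le_const (a := 0) (b := s) (C := A)
      (f := fun s => ∫ x, weakDiv g F x * V (Φ s x)) fun τ _ =>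
        norm_integral_mul_comp_le (integrable_weakDiv hF hB hKg hgc) h0 hM _
    simpa [abs_of_nonneg hs.1.le] using this
  have hd : ∀ τ ∈ Icc (0 : ℝ) 1,
      ‖(∫ x, w x * V (Φ τ x)) - ∫ x, g x * V (Φ τ x)‖ ≤ δ * M := by
    intro τ hτ
    rw [← integral_sub (hint hw τ hτ) (hint hgi τ hτ)]
    simp only [← sub_mul]
    exact (norm_integral_mul_comp_le (hw.sub hgi) h0 hM _).trans
      (mul_le_mul_of_nonneg_right hwg hM0)
  have hds := hd s hs1
  have hd0 := hd 0 (left_mem_Icc.2 zero_le_one)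
  simp only [hΦ.zero] at hd0
  have hδM : δ * M < ε / 4 := by
    rw [hδ, div_mul_eq_mul_div, div_lt_div_iff₀ (by positivity) (by positivity)]
    nlinarith
  rw [Real.dist_eq]
  rw [Real.norm_eq_abs, abs_le] at hds hd0 hg1
  rw [abs_lt]
  constructor <;> linarith [hds.1, hds.2, hd0.1, hd0.2, hg1.1, hg1.2]

/-- A bounded lower semicontinuous function satisfying a dynamic programming inequality along the
flow satisfies the integrated differential inequality. -/
theorem integral_mul_add_weakDiv_le (hF : LipschitzWith K F) (hB : ∀ x, ‖F x‖ ≤ B)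
    (hΦ : IsUnitFlow F Φ) (hψ : LipschitzWith Kψ ψ) (hc : HasCompactSupport ψ)
    (hψ0 : ∀ x, 0 ≤ ψ x) (hV : LowerSemicontinuous V) (h0 : ∀ x, 0 ≤ V x)
    (hM : ∀ x, V x ≤ M) {L : (Fin n → ℝ) → ℝ} (hL : Integrable fun x => ψ x * L x)
    {β C h₀ : ℝ} (hh₀ : 0 < h₀)
    (hdpp : ∀ h ∈ Ioo (0 : ℝ) h₀, ∀ x, ψ x ≠ 0 →
      V x ≤ h * L x + C * h ^ 2 + Real.exp (-β * h) * V (Φ h x)) :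
    β * (∫ x, ψ x * V x) + ∫ x, weakDiv ψ F x * V x ≤ ∫ x, ψ x * L x := by
  have hψi := hψ.continuous.integrable_of_hasCompactSupport (μ := volume) hc
  have hVn : ∀ x, ‖V x‖ ≤ M := fun x => by
    rw [Real.norm_of_nonneg (h0 x)]
    exact hM x
  set g : ℝ → ℝ := fun s => ∫ x, weakDiv ψ F x * V (Φ s x) with hg
  have hw := integrable_weakDiv hF hB hψ hc
  have hgt : Tendsto g (𝓝[>] 0) (𝓝 (∫ x, weakDiv ψ F x * V x)) :=
    tendsto_integral_mul_comp_flow hF hB hΦ hV h0 hM hw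
  set g₀ := ∫ x, weakDiv ψ F x * V x
  set I := ∫ x, ψ x * V x
  -- The existence of the right limit of `g` at `0` suffices for the right derivative of its
  -- integral; continuity of `g` elsewhere plays no role.
  have havg : Tendsto (fun h : ℝ => h⁻¹ * ∫ s in (0 : ℝ)..h, g s) (𝓝[>] 0) (𝓝 g₀) := by
    have hmeas : StronglyMeasurableAtFilter g (𝓝[>] 0) :=
      ⟨Icc 0 1, Icc_mem_nhdsGT zero_lt_one,
        aestronglyMeasurable_integral_comp_flow hF hΦ hV h0 hM hw⟩
    have h1 := intervalIntegral.integral_hasDerivWithinAt_of_tendsto_ae_right (s := Ici 0)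
      (t := Ioi 0) (a := 0) (IntervalIntegrable.refl (f := g) (μ := volume)) hmeas
      (hgt.mono_left inf_le_left)
    have h2 := h1.Ioi_of_Ici
    rw [hasDerivWithinAt_iff_tendsto_slope' self_notMem_Ioi] at h2
    refine h2.congr fun r => ?_
    simp only [slope_def_field, intervalIntegral.integral_same, sub_zero]
    rw [div_eq_inv_mul]
  have hexp : Tendsto (fun h : ℝ => h⁻¹ * (1 - Real.exp (-β * h))) (𝓝[>] 0) (𝓝 β) := by
    have h1 : HasDerivAt (fun h : ℝ => Real.exp (-β * h)) (-β) 0 := by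
      simpa using ((hasDerivAt_id (0 : ℝ)).const_mul (-β)).exp
    have h2 := h1.tendsto_slope_zero_right.neg
    rw [neg_neg] at h2
    refine h2.congr fun h => ?_
    simp only [zero_add, mul_zero, Real.exp_zero, smul_eq_mul]
    ring
  have hexp1 : Tendsto (fun h : ℝ => Real.exp (-β * h)) (𝓝[>] 0) (𝓝 1) := by
    have : Continuous fun h : ℝ => Real.exp (-β * h) := by fun_prop
    simpa using (this.tendsto 0).mono_left nhdsWithin_le_nhds
  have hid : Tendsto (fun h : ℝ => h) (𝓝[>] (0 : ℝ)) (𝓝 0) :=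
    tendsto_id.mono_left nhdsWithin_le_nhds
  have hlhs := (hexp.mul_const I).add (hexp1.mul havg)
  have hrhs : Tendsto (fun h : ℝ => (∫ x, ψ x * L x) + C * h * ∫ x, ψ x) (𝓝[>] 0)
      (𝓝 ((∫ x, ψ x * L x) + C * 0 * ∫ x, ψ x)) :=
    ((hid.const_mul C).mul_const _).const_add _
  rw [one_mul] at hlhs
  simp only [mul_zero, zero_mul, add_zero] at hrhs
  refine le_of_tendsto_of_tendsto hlhs hrhs ?_
  filter_upwards [Ioo_mem_nhdsGT (lt_min hh₀ zero_lt_one)] with h hh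
  have hh1 : h ∈ Icc (0 : ℝ) 1 := ⟨hh.1.le, hh.2.le.trans (min_le_right _ _)⟩
  have hVi : Integrable fun x => ψ x * V x :=
    hψi.mul_bdd (c := M) hV.measurable.aestronglyMeasurable (Eventually.of_forall hVn)
  have hVΦi : Integrable fun x => ψ x * V (Φ h x) :=
    hψi.mul_bdd (c := M)
      (hV.measurable.comp (hΦ.lipschitzWith hF hh1).continuous.measurable).aestronglyMeasurable
      (Eventually.of_forall fun x => hVn _)
  -- The dynamic programming inequality integrated against `ψ ≥ 0`. After the transport identity and
  -- division by `h`, the left side contains `(1 - e^{-βh}) / h` times `I` and the average of `g`,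
  -- and the quadratic error becomes `C h ∫ ψ`.
  have hle : I ≤ ∫ x, (h * (ψ x * L x) + C * h ^ 2 * ψ x
      + Real.exp (-β * h) * (ψ x * V (Φ h x))) := by
    refine integral_mono hVi (((hL.const_mul _).add (hψi.const_mul _)).add
      (hVΦi.const_mul _)) fun x => ?_
    by_cases hx : ψ x = 0
    · simp [hx]
    · have := mul_le_mul_of_nonneg_left
        (hdpp h ⟨hh.1, hh.2.trans_le (min_le_left _ _)⟩ x hx) (hψ0 x)
      simp only
      linarith
  have hadd : Integrable fun x => h * (ψ x * L x) + C * h ^ 2 * ψ x :=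
    (hL.const_mul _).add (hψi.const_mul _)
  rw [integral_add hadd (hVΦi.const_mul _), integral_add (hL.const_mul _) (hψi.const_mul _), integral_const_mul, integral_const_mul,
    integral_const_mul, integral_comp_flow hF hB hΦ hψ hc hV h0 hM hh1] at hle
  have hpos := hh.1
  have := mul_le_mul_of_nonneg_left hle (inv_nonneg.2 hpos.le)
  have hexpand : h⁻¹ * (h * (∫ x, ψ x * L x) + C * h ^ 2 * (∫ x, ψ x)
      + Real.exp (-β * h) * (I - ∫ s in (0 : ℝ)..h, g s))
      = (∫ x, ψ x * L x) + C * h * (∫ x, ψ x)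
        + h⁻¹ * Real.exp (-β * h) * I
        - Real.exp (-β * h) * (h⁻¹ * ∫ s in (0 : ℝ)..h, g s) := by
    field_simp
    ring
  have := hexpand ▸ this
  linarith

end Transport

end DensityLP

namespace DensityLP

open Filter Set
open scoped Topology NNReal

/-! ### Weak limits of bounded controls -/

section WeakLimit

/-- The function `1 / (1 + t²)` is square integrable. -/
theorem memLp_two_inv_one_add_sq : MemLp (fun t : ℝ => (1 + t ^ 2)⁻¹) 2 := by
  have hc : Continuous fun t : ℝ => (1 + t ^ 2)⁻¹ :=
    Continuous.inv₀ (by fun_prop) fun t => by positivity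
  rw [memLp_two_iff_integrable_sq hc.aestronglyMeasurable]
  refine integrable_inv_one_add_sq.mono' (hc.pow 2).aestronglyMeasurable
    (Eventually.of_forall fun t => ?_)
  have h1 : (1 + t ^ 2)⁻¹ ≤ 1 := inv_le_one_of_one_le₀ (by nlinarith [sq_nonneg t])
  have h2 : 0 ≤ (1 + t ^ 2)⁻¹ := by positivity
  rw [Real.norm_of_nonneg (by positivity)]
  nlinarith

/-- Banach–Alaoglu in the self-dual Hilbert space `L²`. Along an ultrafilter a single limit serves
all test functions, with no extraction of subsequences. -/
theorem exists_weakLimit_L2 {ι : Type*} (𝒰 : Ultrafilter ι) {w : ι → Lp ℝ 2 (volume : Measure ℝ)}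
    {R : ℝ} (hw : ∀ k, ‖w k‖ ≤ R) :
    ∃ v : Lp ℝ 2 (volume : Measure ℝ), ∀ φ : ℝ → ℝ, MemLp φ 2 →
      Tendsto (fun k => ∫ t, φ t * w k t) 𝒰 (𝓝 (∫ t, φ t * v t)) := by
  let ℓ : ι → WeakDual ℝ (Lp ℝ 2 (volume : Measure ℝ)) := fun k =>
    StrongDual.toWeakDual (InnerProductSpace.toDual ℝ _ (w k))
  have hmem : ∀ k, ℓ k ∈ WeakDual.toStrongDual ⁻¹'
      Metric.closedBall (0 : StrongDual ℝ (Lp ℝ 2 (volume : Measure ℝ))) R := fun k => by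
    rw [mem_preimage, mem_closedBall_zero_iff]
    change ‖InnerProductSpace.toDual ℝ _ (w k)‖ ≤ R
    rw [LinearIsometryEquiv.norm_map]
    exact hw k
  obtain ⟨L, -, hL⟩ := (WeakDual.isCompact_closedBall
    (0 : StrongDual ℝ (Lp ℝ 2 (volume : Measure ℝ))) R).ultrafilter_le_nhds (𝒰.map ℓ)
    (le_principal_iff.2 (Ultrafilter.mem_map.2 (univ_mem' hmem)))
  refine ⟨(InnerProductSpace.toDual ℝ _).symm (WeakDual.toStrongDual L), fun φ hφ => ?_⟩
  have h1 : Tendsto (fun k => ℓ k hφ.toLp) 𝒰 (𝓝 (L hφ.toLp)) :=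
    ((WeakDual.eval_continuous hφ.toLp).tendsto L).comp hL
  have h2 : ∀ v : Lp ℝ 2 (volume : Measure ℝ), inner ℝ v hφ.toLp = ∫ t, φ t * v t := fun v => by
    rw [L2.inner_def]
    refine integral_congr_ae ?_
    filter_upwards [hφ.coeFn_toLp] with t ht
    rw [ht]
    simp
  rw [← h2, InnerProductSpace.toDual_symm_apply]
  refine h1.congr fun k => ?_
  rw [← h2]
  exact InnerProductSpace.toDual_apply_apply

/-- Compactly supported continuous functions are dense in `L¹`, and the uniform bound `b` makes the
replacement error independent of `k`. -/
theorem tendsto_integral_mul_of_approx {ι : Type*} {l : Filter ι} {w : ι → ℝ → ℝ} {v : ℝ → ℝ}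
    {b : ℝ} (hwm : ∀ k, Measurable (w k)) (hvm : Measurable v) (hwb : ∀ k t, ‖w k t‖ ≤ b)
    (hvb : ∀ t, ‖v t‖ ≤ b)
    (h : ∀ g : ℝ → ℝ, Continuous g → HasCompactSupport g →
      Tendsto (fun k => ∫ t, g t * w k t) l (𝓝 (∫ t, g t * v t)))
    {φ : ℝ → ℝ} (hφ : Integrable φ) :
    Tendsto (fun k => ∫ t, φ t * w k t) l (𝓝 (∫ t, φ t * v t)) := by
  have hb : 0 ≤ b := (norm_nonneg _).trans (hvb 0)
  rw [Metric.tendsto_nhds]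
  intro ε hε
  obtain ⟨g, hgc, hg, hgcont, hgi⟩ := hφ.exists_hasCompactSupport_integral_sub_le
    (ε := ε / (4 * (b + 1))) (by positivity)
  have hest : ∀ u : ℝ → ℝ, Measurable u → (∀ t, ‖u t‖ ≤ b) →
      |(∫ t, φ t * u t) - ∫ t, g t * u t| ≤ ε / 4 := by
    intro u hu hub
    rw [← integral_sub (hφ.mul_bdd hu.aestronglyMeasurable (Eventually.of_forall hub))
      (hgi.mul_bdd hu.aestronglyMeasurable (Eventually.of_forall hub))]
    calc |∫ t, (φ t * u t - g t * u t)| ≤ ∫ t, ‖φ t - g t‖ * b := by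
          rw [← Real.norm_eq_abs]
          refine norm_integral_le_of_norm_le ((hφ.sub hgi).norm.mul_const b)
            (Eventually.of_forall fun t => ?_)
          rw [← sub_mul, norm_mul]
          exact mul_le_mul_of_nonneg_left (hub t) (norm_nonneg _)
      _ = (∫ t, ‖φ t - g t‖) * b := integral_mul_const _ _
      _ ≤ ε / (4 * (b + 1)) * b := mul_le_mul_of_nonneg_right hg hb
      _ ≤ ε / 4 := by
          rw [div_mul_eq_mul_div, div_le_div_iff₀ (by positivity) (by positivity)]
          nlinarith
  filter_upwards [Metric.tendsto_nhds.1 (h g hgcont hgc) (ε / 4) (by positivity)] with k hk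
  have h1 := abs_le.1 (hest (w k) (hwm k) (hwb k))
  have h2 := abs_le.1 (hest v hvm hvb)
  rw [Real.dist_eq] at hk ⊢
  have h3 := abs_lt.1 hk
  rw [abs_lt]
  constructor <;> linarith [h1.1, h1.2, h2.1, h2.2, h3.1, h3.2]

/-- Weak-* compactness of the measurable functions with values in `[0,b]`. -/
theorem exists_weakLimit {ι : Type*} (𝒰 : Ultrafilter ι) {w : ι → ℝ → ℝ} {b : ℝ} (hb : 0 ≤ b)
    (hwm : ∀ k, Measurable (w k)) (hw : ∀ k t, 0 ≤ w k t ∧ w k t ≤ b) :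
    ∃ v : ℝ → ℝ, Measurable v ∧ (∀ t, 0 ≤ v t ∧ v t ≤ b) ∧ ∀ φ : ℝ → ℝ, Integrable φ →
      Tendsto (fun k => ∫ t, φ t * w k t) 𝒰 (𝓝 (∫ t, φ t * v t)) := by
  -- Controls are bounded but not square integrable on the line; multiplying by the positive weight
  -- `p` places them in a ball of `L²`, and the weight is divided out of the limit.
  set p : ℝ → ℝ := fun t => (1 + t ^ 2)⁻¹ with hp
  have hp0 : ∀ t, 0 < p t := fun t => by positivity
  have hpc : Continuous p := Continuous.inv₀ (by fun_prop) fun t => by positivity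
  have hp2 : MemLp p 2 := memLp_two_inv_one_add_sq
  have hbound : ∀ k t, ‖p t * w k t‖ ≤ b * ‖p t‖ := fun k t => by
    rw [norm_mul, mul_comm, Real.norm_of_nonneg (hw k t).1]
    exact mul_le_mul_of_nonneg_right (hw k t).2 (norm_nonneg _)
  have hmem : ∀ k, MemLp (fun t => p t * w k t) 2 := fun k =>
    hp2.of_le_mul (hpc.measurable.mul (hwm k)).aestronglyMeasurable
      (Eventually.of_forall (hbound k))
  obtain ⟨v, hv⟩ := exists_weakLimit_L2 𝒰 (w := fun k => (hmem k).toLp)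
    (R := b * ‖hp2.toLp‖) fun k => by
      refine Lp.norm_le_mul_norm_of_ae_le_mul ?_
      filter_upwards [(hmem k).coeFn_toLp, hp2.coeFn_toLp] with t h1 h2
      rw [h1, h2]
      exact hbound k t
  have hv' : ∀ φ : ℝ → ℝ, MemLp φ 2 →
      Tendsto (fun k => ∫ t, φ t * (p t * w k t)) 𝒰 (𝓝 (∫ t, φ t * v t)) := fun φ hφ => by
    refine (hv φ hφ).congr fun k => integral_congr_ae ?_
    filter_upwards [(hmem k).coeFn_toLp] with t h1
    rw [h1]
  have hset : ∀ s, MeasurableSet s → volume s < ∞ →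
      Tendsto (fun k => ∫ t in s, p t * w k t) 𝒰 (𝓝 (∫ t in s, v t)) := fun s hs hs' => by
    have h1 : MemLp (s.indicator fun _ => (1 : ℝ)) 2 volume :=
      memLp_indicator_const 2 hs 1 (Or.inr hs'.ne)
    have h2 := hv' _ h1
    have h3 : ∀ f : ℝ → ℝ, ∫ t, s.indicator (fun _ => (1 : ℝ)) t * f t = ∫ t in s, f t := fun f => by
      rw [← integral_indicator hs]
      refine integral_congr_ae (Eventually.of_forall fun t => ?_)
      by_cases ht : t ∈ s <;> simp [ht]
    simpa only [h3] using h2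
  have hvint : ∀ s, MeasurableSet s → volume s < ∞ → IntegrableOn v s := fun s hs hs' =>
    integrableOn_Lp_of_measure_ne_top v (by norm_num) hs'.ne
  have hpint : ∀ s, MeasurableSet s → volume s < ∞ → IntegrableOn p s := fun s _ _ =>
    integrable_inv_one_add_sq.integrableOn
  have hwint : ∀ k s, MeasurableSet s → volume s < ∞ → IntegrableOn (fun t => p t * w k t) s :=
    fun k s hs hs' => by
      have := integrableOn_Lp_of_measure_ne_top (hmem k).toLp (s := s) (by norm_num) hs'.ne
      exact this.congr (ae_restrict_of_ae (hmem k).coeFn_toLp)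
  -- The bounds `0 ≤ v ≤ b p` pass to the limit by testing on sets of finite measure.
  have hv0 : 0 ≤ᵐ[volume] v := by
    refine ae_nonneg_of_forall_setIntegral_nonneg_of_sigmaFinite hvint fun s hs hs' => ?_
    refine ge_of_tendsto (hset s hs hs') (Eventually.of_forall fun k => ?_)
    exact setIntegral_nonneg hs fun t _ => mul_nonneg (hp0 t).le (hw k t).1
  have hvb : 0 ≤ᵐ[volume] fun t => b * p t - v t := by
    refine ae_nonneg_of_forall_setIntegral_nonneg_of_sigmaFinite
      (fun s hs hs' => ((hpint s hs hs').const_mul b).sub (hvint s hs hs')) fun s hs hs' => ?_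
    rw [integral_sub ((hpint s hs hs').const_mul b) (hvint s hs hs'), sub_nonneg]
    refine le_of_tendsto (hset s hs hs') (Eventually.of_forall fun k => ?_)
    refine setIntegral_mono (hwint k s hs hs') ((hpint s hs hs').const_mul b) fun t => ?_
    simp only
    nlinarith [(hw k t).2, hp0 t]
  have hvm : Measurable v := (Lp.stronglyMeasurable v).measurable
  -- Truncation changes `v / p` only on a null set and makes the bounds hold at every time.
  set u : ℝ → ℝ := fun t => max 0 (min b ((p t)⁻¹ * v t)) with hu
  have hum : Measurable u :=
    measurable_const.max (measurable_const.min (hpc.measurable.inv.mul hvm))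
  have hub : ∀ t, 0 ≤ u t ∧ u t ≤ b := fun t => ⟨le_max_left _ _, max_le hb (min_le_left _ _)⟩
  have huv : ∀ᵐ t, p t * u t = v t := by
    filter_upwards [hv0, hvb] with t h0 h1
    have h0' : 0 ≤ v t := h0
    have h1' : 0 ≤ b * p t - v t := h1
    have h2 : (p t)⁻¹ * v t ≤ b := by
      rw [inv_mul_le_iff₀ (hp0 t)]
      linarith
    have h3 : 0 ≤ (p t)⁻¹ * v t := mul_nonneg (inv_nonneg.2 (hp0 t).le) h0'
    rw [hu]
    simp only
    rw [min_eq_right h2, max_eq_right h3, mul_inv_cancel_left₀ (hp0 t).ne']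
  refine ⟨u, hum, hub, fun φ hφ => tendsto_integral_mul_of_approx hwm hum (b := b)
    (fun k t => ?_) (fun t => ?_) (fun g hg hgc => ?_) hφ⟩
  · rw [Real.norm_of_nonneg (hw k t).1]
    exact (hw k t).2
  · rw [Real.norm_of_nonneg (hub t).1]
    exact (hub t).2
  · have hgp : Continuous fun t => g t * (p t)⁻¹ := hg.mul (hpc.inv₀ fun t => (hp0 t).ne')
    have h1 := hv' (fun t => g t * (p t)⁻¹) (hgp.memLp_of_hasCompactSupport hgc.mul_right)
    have h2 : ∫ t, g t * (p t)⁻¹ * v t = ∫ t, g t * u t := by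
      refine integral_congr_ae ?_
      filter_upwards [huv] with t ht
      rw [← ht, mul_assoc, inv_mul_cancel_left₀ (hp0 t).ne']
    rw [h2] at h1
    refine h1.congr fun k => integral_congr_ae (Eventually.of_forall fun t => ?_)
    simp only
    rw [mul_assoc, inv_mul_cancel_left₀ (hp0 t).ne']

/-- Products of strongly convergent functions and weakly convergent controls converge. -/
theorem tendsto_integral_mul_of_tendsto {ι : Type*} {l : Filter ι} {w : ι → ℝ → ℝ} {v : ℝ → ℝ}
    {b : ℝ} (hwm : ∀ k, Measurable (w k)) (hwb : ∀ k t, ‖w k t‖ ≤ b)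
    {φ : ι → ℝ → ℝ} {ψ : ℝ → ℝ} (hφ : ∀ k, Integrable (φ k)) (hψ : Integrable ψ)
    (hconv : Tendsto (fun k => ∫ t, ‖φ k t - ψ t‖) l (𝓝 0))
    (h : Tendsto (fun k => ∫ t, ψ t * w k t) l (𝓝 (∫ t, ψ t * v t))) :
    Tendsto (fun k => ∫ t, φ k t * w k t) l (𝓝 (∫ t, ψ t * v t)) := by
  have hdiff : Tendsto (fun k => ∫ t, (φ k t - ψ t) * w k t) l (𝓝 0) := by
    refine squeeze_zero_norm (a := fun k => (∫ t, ‖φ k t - ψ t‖) * b) (fun k => ?_) ?_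
    · rw [← integral_mul_const]
      refine norm_integral_le_of_norm_le (((hφ k).sub hψ).norm.mul_const b)
        (Eventually.of_forall fun t => ?_)
      rw [norm_mul]
      exact mul_le_mul_of_nonneg_left (hwb k t) (norm_nonneg _)
    · simpa using hconv.mul_const b
  have := h.add hdiff
  rw [add_zero] at this
  refine this.congr fun k => ?_
  have hint : Integrable fun t => (φ k t - ψ t) * w k t :=
    ((hφ k).sub hψ).mul_bdd (hwm k).aestronglyMeasurable (Eventually.of_forall (hwb k))
  rw [← integral_add (hψ.mul_bdd (hwm k).aestronglyMeasurable (Eventually.of_forall (hwb k))) hint]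
  refine integral_congr_ae (Eventually.of_forall fun t => ?_)
  simp only
  ring

end WeakLimit

end DensityLP

namespace DensityLP

open Filter Set
open scoped Topology NNReal

variable {n m ng : ℕ}

/-! ### The time horizon -/

section Horizon

theorem mem_horizon {T : ℝ≥0∞} {t : ℝ} : t ∈ horizon T ↔ 0 ≤ t ∧ ENNReal.ofReal t ≤ T := Iff.rfl

theorem horizon_subset_Ici (T : ℝ≥0∞) : horizon T ⊆ Ici 0 := fun _ ht => ht.1

theorem measurableSet_horizon (T : ℝ≥0∞) : MeasurableSet (horizon T) :=
  measurableSet_Ici.inter (measurableSet_le ENNReal.measurable_ofReal measurable_const)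

theorem zero_mem_horizon (T : ℝ≥0∞) : (0 : ℝ) ∈ horizon T := ⟨le_rfl, by simp⟩

theorem Icc_subset_horizon {T : ℝ≥0∞} {t : ℝ} (ht : t ∈ horizon T) : Icc 0 t ⊆ horizon T :=
  fun _ hs => ⟨hs.1, (ENNReal.ofReal_le_ofReal hs.2).trans ht.2⟩

theorem horizon_top : horizon ∞ = Ici 0 := by
  ext t
  simp [mem_horizon]

theorem horizon_of_ne_top {T : ℝ≥0∞} (hT : T ≠ ∞) : horizon T = Icc 0 T.toReal := by
  ext t
  rw [mem_horizon, mem_Icc, ENNReal.ofReal_le_iff_le_toReal hT]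

/-- The projection of the real line onto the horizon. -/
noncomputable def clamp (T : ℝ≥0∞) (t : ℝ) : ℝ :=
  if T = ∞ then max 0 t else max 0 (min t T.toReal)

theorem clamp_mem (T : ℝ≥0∞) (t : ℝ) : clamp T t ∈ horizon T := by
  unfold clamp
  split_ifs with h
  · rw [h, horizon_top]
    exact mem_Ici.2 (le_max_left _ _)
  · rw [horizon_of_ne_top h]
    exact ⟨le_max_left _ _, max_le ENNReal.toReal_nonneg (min_le_right _ _)⟩

theorem clamp_of_mem {T : ℝ≥0∞} {t : ℝ} (ht : t ∈ horizon T) : clamp T t = t := by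
  unfold clamp
  split_ifs with h
  · exact max_eq_right ht.1
  · rw [horizon_of_ne_top h] at ht
    rw [min_eq_left ht.2, max_eq_right ht.1]

theorem lipschitzWith_clamp (T : ℝ≥0∞) : LipschitzWith 1 (clamp T) := by
  unfold clamp
  split_ifs with h
  · exact LipschitzWith.id.const_max 0
  · exact (LipschitzWith.id.min_const _).const_max 0

theorem Icc_inter_horizon (T : ℝ≥0∞) {t : ℝ} (ht : 0 ≤ t) :
    Icc 0 t ∩ horizon T = Icc 0 (clamp T t) := by
  unfold clamp
  split_ifs with h
  · rw [h, horizon_top, max_eq_right ht]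
    exact inter_eq_left.2 fun s hs => hs.1
  · rw [horizon_of_ne_top h, Icc_inter_Icc, max_self,
      max_eq_right (le_min ht ENNReal.toReal_nonneg)]

theorem integrableOn_exp_horizon {β : ℝ} (hβ : 0 < β) (T : ℝ≥0∞) :
    IntegrableOn (fun t => Real.exp (-β * t)) (horizon T) :=
  ((integrableOn_Ici_iff_integrableOn_Ioi (by finiteness)).2
    (integrableOn_exp_mul_Ioi (neg_neg_of_pos hβ) 0)).mono_set (horizon_subset_Ici T)

theorem integral_exp_horizon {β : ℝ} (hβ : 0 < β) (T : ℝ≥0∞) :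
    ∫ t in horizon T, Real.exp (-β * t) = (1 - stopDiscount β T) / β := by
  unfold stopDiscount
  split_ifs with h
  · rw [h, horizon_top, integral_Ici_eq_integral_Ioi,
      integral_exp_mul_Ioi (neg_neg_of_pos hβ)]
    simp
  · rw [horizon_of_ne_top h, integral_Icc_eq_integral_Ioc,
      ← intervalIntegral.integral_of_le ENNReal.toReal_nonneg]
    have hd : ∀ t ∈ uIcc 0 T.toReal,
        HasDerivAt (fun t => -(β⁻¹) * Real.exp (-β * t)) (Real.exp (-β * t)) t := fun t _ => by
      have h1 := (((hasDerivAt_id t).const_mul (-β)).exp).const_mul (-(β⁻¹))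
      refine h1.congr_deriv ?_
      simp only [id]
      field_simp
    rw [intervalIntegral.integral_eq_sub_of_hasDerivAt hd
      (Continuous.intervalIntegrable (by fun_prop) _ _)]
    simp only [mul_zero, Real.exp_zero]
    field_simp
    ring

/-- The horizons depend continuously on the stopping time, up to null sets. -/
theorem ae_tendsto_indicator_horizon {ι : Type*} {l : Filter ι} {T : ι → ℝ≥0∞} {T₀ : ℝ≥0∞}
    (hT : Tendsto T l (𝓝 T₀)) : ∀ᵐ t : ℝ, (t ∈ horizon T₀ ∧ ∀ᶠ k in l, t ∈ horizon (T k)) ∨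
      (t ∉ horizon T₀ ∧ ∀ᶠ k in l, t ∉ horizon (T k)) := by
  -- Only membership of the endpoint `T₀` can fail to stabilize. For `T₀ = ∞` the point removed is
  -- `0`, by the default value of `toReal`, which is harmless.
  have hne : ∀ᵐ t : ℝ, t ≠ T₀.toReal := by
    rw [ae_iff]
    simp
  filter_upwards [hne] with t ht
  by_cases h0 : 0 ≤ t
  · rcases lt_trichotomy (ENNReal.ofReal t) T₀ with h | h | h
    · exact Or.inl ⟨⟨h0, h.le⟩, (hT.eventually (lt_mem_nhds h)).mono fun k hk => ⟨h0, hk.le⟩⟩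
    · exact absurd (by rw [← h, ENNReal.toReal_ofReal h0]) ht
    · exact Or.inr ⟨fun h' => absurd h'.2 (not_le.2 h),
        (hT.eventually (gt_mem_nhds h)).mono fun k hk h' => absurd h'.2 (not_le.2 hk)⟩
  · exact Or.inr ⟨fun h => h0 h.1, Eventually.of_forall fun k h => h0 h.1⟩

end Horizon

/-! ### Bounds on the data -/

namespace Data

variable (D : Data n m ng)

theorem isCompact_U : IsCompact D.U := by
  have : D.U = Set.pi univ fun _ => Icc 0 D.ubar := by
    ext u
    simp only [U, mem_ofPred_eq, mem_univ_pi, mem_Icc]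
  rw [this]
  exact isCompact_univ_pi fun _ => isCompact_Icc

theorem continuous_l : Continuous fun p : (Fin n → ℝ) × (Fin m → ℝ) => D.l p.1 p.2 := by
  have h : ∀ q : MvPolynomial (Fin n) ℝ,
      Continuous fun p : (Fin n → ℝ) × (Fin m → ℝ) => MvPolynomial.eval p.1 q := fun q =>
    (MvPolynomial.continuous_eval q).comp continuous_fst
  unfold l
  exact (h _).add (continuous_finsetSum _ fun i _ => (h _).mul (by fun_prop))

theorem continuous_field : Continuous fun p : (Fin n → ℝ) × (Fin m → ℝ) => D.field p.1 p.2 := by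
  have h : ∀ q : MvPolynomial (Fin n) ℝ,
      Continuous fun p : (Fin n → ℝ) × (Fin m → ℝ) => MvPolynomial.eval p.1 q := fun q =>
    (MvPolynomial.continuous_eval q).comp continuous_fst
  unfold field
  exact continuous_pi fun j =>
    (h _).add (continuous_finsetSum _ fun i _ => (h _).mul (by fun_prop))

variable {D}

theorem exists_norm_field_le (hX : IsCompact D.X) :
    ∃ C : ℝ≥0, ∀ x ∈ D.X, ∀ u ∈ D.U, ‖D.field x u‖ ≤ C := by
  obtain ⟨C, hC⟩ := (hX.prod D.isCompact_U).exists_bound_of_continuousOn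
    D.continuous_field.continuousOn
  exact ⟨C.toNNReal, fun x hx u hu => (hC (x, u) ⟨hx, hu⟩).trans (Real.le_coe_toNNReal C)⟩

/-- The supremum of a set of nonnegative reals is nonnegative, including the default value `0` for
empty `X`. -/
theorem M_nonneg (hβ : 0 < D.β) (hl : ∀ x ∈ D.X, ∀ u ∈ D.U, 0 ≤ D.l x u)
    (hM : D.β⁻¹ * sSup {c | ∃ x ∈ D.X, ∃ u ∈ D.U, D.l x u = c} < D.M) : 0 ≤ D.M := by
  refine le_trans (mul_nonneg (inv_nonneg.2 hβ.le) (Real.sSup_nonneg ?_)) hM.le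
  rintro _ ⟨x, hx, u, hu, rfl⟩
  exact hl x hx u hu

end Data

/-! ### Controlled trajectories extended to the whole time axis -/

section Gate

/-- The function `θ(t) p(y(t))` cut off outside the horizon. -/
noncomputable def gate (T : ℝ≥0∞) (y : ℝ → Fin n → ℝ) (θ : ℝ → ℝ) (p : MvPolynomial (Fin n) ℝ) :
    ℝ → ℝ :=
  (horizon T).indicator fun t => θ t * MvPolynomial.eval (y t) p

/-- The integral of `θ(t) (p(y(t)) + ∑ q_i(y(t)) w_i(t))` over the horizon. -/
noncomputable def gateIntegral (T : ℝ≥0∞) (y : ℝ → Fin n → ℝ) (w : Fin m → ℝ → ℝ) (θ : ℝ → ℝ)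
    (p : MvPolynomial (Fin n) ℝ) (q : Fin m → MvPolynomial (Fin n) ℝ) : ℝ :=
  (∫ t, gate T y θ p t) + ∑ i, ∫ t, gate T y θ (q i) t * w i t

variable {X : Set (Fin n → ℝ)} {T : ℝ≥0∞} {y : ℝ → Fin n → ℝ} {w : Fin m → ℝ → ℝ}
  {θ : ℝ → ℝ} {b : ℝ}

theorem integrable_gate (hX : IsCompact X) (hy : Continuous y) (hyX : ∀ t, y t ∈ X)
    (hθ : Integrable θ) (p : MvPolynomial (Fin n) ℝ) : Integrable (gate T y θ p) := by
  obtain ⟨P, hP⟩ := hX.exists_bound_of_continuousOn (MvPolynomial.continuous_eval p).continuousOn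
  exact (hθ.mul_bdd (c := P) ((MvPolynomial.continuous_eval p).comp hy).aestronglyMeasurable
    (Eventually.of_forall fun t => hP _ (hyX t))).indicator (measurableSet_horizon T)

/-- The integrand is affine in the control. The split into separate integrals, each with a state
factor times at most one control component, is the form to which weak convergence applies. -/
theorem gateIntegral_eq (hX : IsCompact X) (hy : Continuous y) (hyX : ∀ t, y t ∈ X)
    (hwm : ∀ i, Measurable (w i)) (hwb : ∀ i t, 0 ≤ w i t ∧ w i t ≤ b)
    (hθ : Integrable θ) (p : MvPolynomial (Fin n) ℝ) (q : Fin m → MvPolynomial (Fin n) ℝ) :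
    gateIntegral T y w θ p q = ∫ t in horizon T,
      θ t * (MvPolynomial.eval (y t) p + ∑ i, MvPolynomial.eval (y t) (q i) * w i t) := by
  have hint : ∀ i, Integrable fun t => gate T y θ (q i) t * w i t := fun i =>
    (integrable_gate hX hy hyX hθ (q i)).mul_bdd (c := b) (hwm i).aestronglyMeasurable
      (Eventually.of_forall fun t => by
        rw [Real.norm_of_nonneg (hwb i t).1]
        exact (hwb i t).2)
  rw [gateIntegral, ← integral_finsetSum _ fun i _ => hint i,
    ← integral_add (integrable_gate hX hy hyX hθ p) (integrable_finsetSum _ fun i _ => hint i),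
    ← integral_indicator (measurableSet_horizon T)]
  refine integral_congr_ae (Eventually.of_forall fun t => ?_)
  by_cases ht : t ∈ horizon T
  · simp only [gate, indicator_of_mem ht, mul_add, Finset.mul_sum, mul_assoc]
  · simp [gate, indicator_of_notMem ht]

/-- The weight of the time interval `[0,t]`. -/
noncomputable def stepWeight (t : ℝ) : ℝ → ℝ := (Icc 0 t).indicator fun _ => 1

/-- The discount weight. -/
noncomputable def discWeight (β : ℝ) : ℝ → ℝ := (Ici 0).indicator fun s => Real.exp (-β * s)

theorem integrable_stepWeight (t : ℝ) : Integrable (stepWeight t) :=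
  (integrable_indicator_iff measurableSet_Icc).2 (integrableOn_const (by simp))

theorem integrable_discWeight {β : ℝ} (hβ : 0 < β) : Integrable (discWeight β) :=
  (integrable_indicator_iff measurableSet_Ici).2 (horizon_top ▸ integrableOn_exp_horizon hβ ∞)

theorem setIntegral_stepWeight_mul (T : ℝ≥0∞) {t : ℝ} (ht : 0 ≤ t) (G : ℝ → ℝ) :
    ∫ s in horizon T, stepWeight t s * G s = ∫ s in (0 : ℝ)..clamp T t, G s := by
  have h : ∀ s, stepWeight t s * G s = (Icc 0 t).indicator G s := fun s => by
    by_cases hs : s ∈ Icc 0 t <;> simp [stepWeight, hs]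
  simp only [h]
  rw [setIntegral_indicator measurableSet_Icc, inter_comm, Icc_inter_horizon T ht,
    integral_Icc_eq_integral_Ioc, intervalIntegral.integral_of_le (clamp_mem T t).1]

theorem intervalIntegral_apply {v : ℝ → Fin n → ℝ} {a b : ℝ} (hv : IntervalIntegrable v volume a b)
    (j : Fin n) : (∫ s in a..b, v s) j = ∫ s in a..b, v s j :=
  ((ContinuousLinearMap.proj (R := ℝ) (φ := fun _ : Fin n => ℝ) j).intervalIntegral_comp_comm
    hv).symm

end Gate

namespace Data

variable {D : Data n m ng}

/-- A controlled trajectory extended to the whole time axis, stationary after the stopping time. -/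
structure ExtAdmissible (D : Data n m ng) (C : ℝ≥0) (x₀ : Fin n → ℝ) (y : ℝ → Fin n → ℝ)
    (w : Fin m → ℝ → ℝ) (T : ℝ≥0∞) : Prop where
  measurable_control : ∀ i, Measurable (w i)
  control_mem : ∀ i t, 0 ≤ w i t ∧ w i t ≤ D.ubar
  lipschitzWith : LipschitzWith C y
  state_mem : ∀ t, y t ∈ D.X
  dynamics : ∀ t, 0 ≤ t → ∀ j,
    y t j = x₀ j + gateIntegral T y w (stepWeight t) (D.f j) (fun i => D.fu i j)

/-- The cost of an extended trajectory. -/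
noncomputable def extCost (D : Data n m ng) (y : ℝ → Fin n → ℝ) (w : Fin m → ℝ → ℝ) (T : ℝ≥0∞) :
    ℝ :=
  D.M + gateIntegral T y w (discWeight D.β) (D.lx - MvPolynomial.C (D.β * D.M)) D.lu

theorem Admissible.aestronglyMeasurable {x₀ : Fin n → ℝ} {x : ℝ → Fin n → ℝ} {u : ℝ → Fin m → ℝ}
    {T : ℝ≥0∞} (h : D.Admissible x₀ x u T) :
    AEStronglyMeasurable (fun s => (x s, u s)) (volume.restrict (horizon T)) :=
  (h.continuousOn_state.aestronglyMeasurable (measurableSet_horizon T)).prodMk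
    h.aemeasurable_control.aestronglyMeasurable

theorem Admissible.intervalIntegrable {x₀ : Fin n → ℝ} {x : ℝ → Fin n → ℝ} {u : ℝ → Fin m → ℝ}
    {T : ℝ≥0∞} (h : D.Admissible x₀ x u T) (hX : IsCompact D.X) {t : ℝ} (ht : t ∈ horizon T) :
    IntervalIntegrable (fun s => D.field (x s) (u s)) volume 0 t := by
  obtain ⟨C, hC⟩ := exists_norm_field_le hX
  rw [intervalIntegrable_iff_integrableOn_Icc_of_le ht.1]
  refine Integrable.of_bound ?_ C ?_
  · exact (D.continuous_field.comp_aestronglyMeasurable h.aestronglyMeasurable).mono_measure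
      (Measure.restrict_mono (Icc_subset_horizon ht) le_rfl)
  · filter_upwards [ae_restrict_mem measurableSet_Icc] with s hs
    have hs' := Icc_subset_horizon ht hs
    exact hC _ (h.state_mem s hs') _ (h.control_mem s hs')

theorem Admissible.norm_sub_le {x₀ : Fin n → ℝ} {x : ℝ → Fin n → ℝ} {u : ℝ → Fin m → ℝ}
    {T : ℝ≥0∞} (h : D.Admissible x₀ x u T) (hX : IsCompact D.X) {C : ℝ≥0}
    (hC : ∀ x ∈ D.X, ∀ u ∈ D.U, ‖D.field x u‖ ≤ C) {s t : ℝ} (hs : s ∈ horizon T)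
    (ht : t ∈ horizon T) : ‖x t - x s‖ ≤ C * |t - s| := by
  rw [h.dynamics t ht, h.dynamics s hs, add_sub_add_left_eq_sub,
    intervalIntegral.integral_interval_sub_left (h.intervalIntegrable hX ht)
      (h.intervalIntegrable hX hs)]
  refine intervalIntegral.norm_integral_le_of_norm_le_const fun r hr => ?_
  have hr' : r ∈ horizon T := by
    rcases le_total s t with hst | hst
    · rw [uIoc_of_le hst] at hr
      exact Icc_subset_horizon ht ⟨hs.1.trans hr.1.le, hr.2⟩
    · rw [uIoc_of_ge hst] at hr
      exact Icc_subset_horizon hs ⟨ht.1.trans hr.1.le, hr.2⟩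
  exact hC _ (h.state_mem r hr') _ (h.control_mem r hr')

/-- The terminal cost becomes a running cost through `e^{-βT} M = M - ∫₀^T β M e^{-βt} dt`, valid
for `T = ∞` too. The whole cost is then `M` plus a gated integral, and the stopping time needs no
separate limit argument. -/
theorem ocpCost_eq_extCost (hβ : 0 < D.β) (hX : IsCompact D.X) {y : ℝ → Fin n → ℝ}
    {w : Fin m → ℝ → ℝ} {T : ℝ≥0∞} (hy : Continuous y) (hyX : ∀ t, y t ∈ D.X)
    (hwm : ∀ i, Measurable (w i)) (hwb : ∀ i t, 0 ≤ w i t ∧ w i t ≤ D.ubar) :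
    D.ocpCost y (fun t i => w i t) T = D.extCost y w T := by
  rw [extCost, gateIntegral_eq hX hy hyX hwm hwb (integrable_discWeight hβ), ocpCost]
  have hexp := integrableOn_exp_horizon hβ T
  obtain ⟨C, hC⟩ := (hX.prod D.isCompact_U).exists_bound_of_continuousOn
    D.continuous_l.continuousOn
  have hpair : Measurable fun t => (y t, fun i => w i t) :=
    hy.measurable.prodMk (measurable_pi_lambda _ hwm)
  have hlm := D.continuous_l.stronglyMeasurable.comp_measurable hpair
  have hl : IntegrableOn (fun t => Real.exp (-D.β * t) * D.l (y t) fun i => w i t) (horizon T) :=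
    hexp.mul_bdd (c := C) hlm.aestronglyMeasurable
      (Eventually.of_forall fun t => hC (y t, fun i => w i t) ⟨hyX t, fun i => hwb i t⟩)
  have h1 : ∫ t in horizon T, discWeight D.β t *
      (MvPolynomial.eval (y t) (D.lx - MvPolynomial.C (D.β * D.M))
        + ∑ i, MvPolynomial.eval (y t) (D.lu i) * w i t)
      = ∫ t in horizon T, ((Real.exp (-D.β * t) * D.l (y t) fun i => w i t)
        - Real.exp (-D.β * t) * (D.β * D.M)) := by
    refine setIntegral_congr_fun (measurableSet_horizon T) fun t ht => ?_
    simp only [discWeight, indicator_of_mem (horizon_subset_Ici T ht), map_sub,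
      MvPolynomial.eval_C, l]
    ring
  rw [h1, integral_sub hl (hexp.mul_const _), integral_mul_const, integral_exp_horizon hβ]
  generalize ∫ t in horizon T, Real.exp (-D.β * t) * D.l (y t) (fun i => w i t) = I
  have h2 : (1 - stopDiscount D.β T) / D.β * (D.β * D.M) = (1 - stopDiscount D.β T) * D.M := by
    rw [← mul_assoc, div_mul_cancel₀ _ hβ.ne']
  rw [h2]
  ring

/-- Every admissible triple extends to the whole time axis. -/
theorem Admissible.exists_extAdmissible (hubar : 0 < D.ubar) (hβ : 0 < D.β) (hX : IsCompact D.X)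
    {C : ℝ≥0} (hC : ∀ x ∈ D.X, ∀ u ∈ D.U, ‖D.field x u‖ ≤ C)
    {x₀ : Fin n → ℝ} {x : ℝ → Fin n → ℝ} {u : ℝ → Fin m → ℝ} {T : ℝ≥0∞}
    (h : D.Admissible x₀ x u T) :
    ∃ y w, D.ExtAdmissible C x₀ y w T ∧ D.extCost y w T = D.ocpCost x u T ∧
      ∀ t ∈ horizon T, y t = x t := by
  -- The extended control is a measurable representative truncated into `[0, ubar]`; on the horizon
  -- it agrees with `u` almost everywhere, so neither dynamics nor cost change. The state is frozen
  -- at its value at the stopping time.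
  set u' := h.aemeasurable_control.mk u
  have hu'm : Measurable u' := h.aemeasurable_control.measurable_mk
  set w : Fin m → ℝ → ℝ := fun i t => max 0 (min D.ubar (u' t i)) with hw
  set y : ℝ → Fin n → ℝ := fun t => x (clamp T t) with hy
  have hwm : ∀ i, Measurable (w i) := fun i =>
    measurable_const.max (measurable_const.min ((measurable_pi_apply i).comp hu'm))
  have hwb : ∀ i t, 0 ≤ w i t ∧ w i t ≤ D.ubar := fun i t =>
    ⟨le_max_left _ _, max_le hubar.le (min_le_left _ _)⟩
  have hwu : ∀ᵐ t ∂volume.restrict (horizon T), (fun i => w i t) = u t := by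
    filter_upwards [h.aemeasurable_control.ae_eq_mk, ae_restrict_mem (measurableSet_horizon T)]
      with t ht htT
    funext i
    have hU := h.control_mem t htT i
    rw [hw]
    simp only
    rw [show u' t = u t from ht.symm, min_eq_right hU.2, max_eq_right hU.1]
  have hyx : ∀ t ∈ horizon T, y t = x t := fun t ht => by rw [hy]; simp only [clamp_of_mem ht]
  have hyL : LipschitzWith C y := by
    refine LipschitzWith.of_dist_le_mul fun s t => ?_
    rw [dist_eq_norm]
    refine (h.norm_sub_le hX hC (clamp_mem T t) (clamp_mem T s)).trans ?_
    refine mul_le_mul_of_nonneg_left ?_ C.2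
    simpa [Real.dist_eq] using (lipschitzWith_clamp T).dist_le_mul s t
  have hyX : ∀ t, y t ∈ D.X := fun t => h.state_mem _ (clamp_mem T t)
  refine ⟨y, w, ⟨hwm, hwb, hyL, hyX, fun t ht j => ?_⟩, ?_, hyx⟩
  · rw [gateIntegral_eq hX hyL.continuous hyX hwm hwb (integrable_stepWeight t),
      setIntegral_stepWeight_mul T ht]
    have h1 := congrFun (h.dynamics _ (clamp_mem T t)) j
    rw [Pi.add_apply, intervalIntegral_apply (h.intervalIntegrable hX (clamp_mem T t))] at h1
    rw [hy]
    simp only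
    rw [h1]
    congr 1
    refine intervalIntegral.integral_congr_ae ?_
    rw [uIoc_of_le (clamp_mem T t).1]
    have hsub := Icc_subset_horizon (clamp_mem T t)
    filter_upwards [(ae_restrict_iff' (measurableSet_horizon T)).1 hwu] with s hs hsI
    have hsT := hsub (Ioc_subset_Icc_self hsI)
    rw [← hs hsT, ← hyx s hsT]
    rfl
  · rw [← ocpCost_eq_extCost hβ hX hyL.continuous hyX hwm hwb, ocpCost, ocpCost]
    congr 1
    refine integral_congr_ae ?_
    filter_upwards [hwu, ae_restrict_mem (measurableSet_horizon T)] with t ht htT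
    rw [ht, hyx t htT]

theorem intervalIntegrable_field (hX : IsCompact D.X) {z : ℝ → Fin n → ℝ} {u : ℝ → Fin m → ℝ}
    (hz : Measurable z) (hu : Measurable u) (hzX : ∀ t, z t ∈ D.X) (huU : ∀ t, u t ∈ D.U)
    (a b : ℝ) : IntervalIntegrable (fun s => D.field (z s) (u s)) volume a b := by
  obtain ⟨B, hB⟩ := exists_norm_field_le hX
  rw [intervalIntegrable_iff, uIoc]
  refine Integrable.of_bound ?_ B (Eventually.of_forall fun s => hB _ (hzX s) _ (huU s))
  exact (D.continuous_field.stronglyMeasurable.comp_measurable (hz.prodMk hu)).aestronglyMeasurable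

theorem ExtAdmissible.admissible (hX : IsCompact D.X) {C : ℝ≥0} {x₀ : Fin n → ℝ}
    {y : ℝ → Fin n → ℝ} {w : Fin m → ℝ → ℝ} {T : ℝ≥0∞} (h : D.ExtAdmissible C x₀ y w T) :
    D.Admissible x₀ y (fun t i => w i t) T where
  aemeasurable_control := (measurable_pi_lambda _ h.measurable_control).aemeasurable
  continuousOn_state := h.lipschitzWith.continuous.continuousOn
  state_mem t _ := h.state_mem t
  control_mem t _ i := h.control_mem i t
  dynamics t ht := by
    have hint := intervalIntegrable_field hX h.lipschitzWith.continuous.measurable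
      (measurable_pi_lambda _ h.measurable_control) h.state_mem
      (fun s i => h.control_mem i s) 0 t
    funext j
    rw [h.dynamics t ht.1 j, Pi.add_apply, intervalIntegral_apply hint,
      gateIntegral_eq hX h.lipschitzWith.continuous h.state_mem h.measurable_control
        h.control_mem (integrable_stepWeight t), setIntegral_stepWeight_mul T ht.1,
      clamp_of_mem ht]
    rfl

end Data

end DensityLP

namespace DensityLP

open Filter Set
open scoped Topology NNReal

variable {n m ng : ℕ}

/-! ### Compactness of the extended trajectories -/

section Limit

variable {X : Set (Fin n → ℝ)}

/-- Equi-Lipschitz curves converge everywhere once they converge on a dense set. Countably many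
conditions thus describe the convergence, which allows a countably generated filter. -/
theorem tendsto_of_tendsto_rat {ι : Type*} {l : Filter ι} {C : ℝ≥0} {y : ι → ℝ → Fin n → ℝ}
    {z : ℝ → Fin n → ℝ} (hy : ∀ k, LipschitzWith C (y k)) (hz : LipschitzWith C z)
    (h : ∀ q : ℚ, Tendsto (fun k => y k q) l (𝓝 (z q))) (t : ℝ) :
    Tendsto (fun k => y k t) l (𝓝 (z t)) := by
  rw [Metric.tendsto_nhds]
  intro ε hε
  have hδ : 0 < ε / (3 * (C + 1)) := by positivity
  obtain ⟨q, hq1, hq2⟩ := exists_rat_btwn (lt_add_of_pos_right t hδ)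
  have hqt : dist t q ≤ ε / (3 * (C + 1)) := by
    rw [dist_comm, Real.dist_eq, abs_of_nonneg (by linarith)]
    linarith
  have hC : (C : ℝ) * dist t q < ε / 3 := by
    have h1 : (C : ℝ) * dist t q ≤ C * (ε / (3 * (C + 1))) := by gcongr
    refine h1.trans_lt ?_
    rw [mul_div_assoc', div_lt_div_iff₀ (by positivity) (by positivity)]
    nlinarith
  filter_upwards [Metric.tendsto_nhds.1 (h q) (ε / 3) (by positivity)] with k hk
  have h1 := (hy k).dist_le_mul t q
  have h2 := hz.dist_le_mul t q
  rw [dist_comm] at h2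
  linarith [dist_triangle4 (y k t) (y k q) (z q) (z t)]

/-- Dominated convergence: horizons stabilize at almost every time, and compactness of `X` bounds
the polynomial. This is the strong factor to be paired with weakly convergent controls. -/
theorem tendsto_integral_norm_gate_sub {ι : Type*} {l : Filter ι} [l.IsCountablyGenerated]
    (hX : IsCompact X) {T : ι → ℝ≥0∞} {T₀ : ℝ≥0∞} (hT : Tendsto T l (𝓝 T₀))
    {y : ι → ℝ → Fin n → ℝ} {z : ℝ → Fin n → ℝ} (hy : ∀ k, Continuous (y k)) (hz : Continuous z)
    (hyX : ∀ k t, y k t ∈ X) (hzX : ∀ t, z t ∈ X)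
    (hyz : ∀ t, Tendsto (fun k => y k t) l (𝓝 (z t))) {θ : ℝ → ℝ} (hθ : Integrable θ)
    (p : MvPolynomial (Fin n) ℝ) :
    Tendsto (fun k => ∫ t, ‖gate (T k) (y k) θ p t - gate T₀ z θ p t‖) l (𝓝 0) := by
  obtain ⟨P, hP⟩ := hX.exists_bound_of_continuousOn (MvPolynomial.continuous_eval p).continuousOn
  have hgb : ∀ (T : ℝ≥0∞) (y : ℝ → Fin n → ℝ), (∀ t, y t ∈ X) → ∀ t,
      ‖gate T y θ p t‖ ≤ ‖θ t‖ * P := fun T y hyX t => by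
    have hb : ‖θ t * MvPolynomial.eval (y t) p‖ ≤ ‖θ t‖ * P := by
      rw [norm_mul]
      exact mul_le_mul_of_nonneg_left (hP _ (hyX t)) (norm_nonneg _)
    exact (norm_indicator_le_norm_self _ _).trans hb
  have key : Tendsto (fun k => ∫ t, ‖gate (T k) (y k) θ p t - gate T₀ z θ p t‖) l
      (𝓝 (∫ _ : ℝ, (0 : ℝ))) := by
    refine tendsto_integral_filter_of_dominated_convergence (fun t => ‖θ t‖ * P + ‖θ t‖ * P)
      (Eventually.of_forall fun k => ?_) (Eventually.of_forall fun k => Eventually.of_forall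
        fun t => ?_) ((hθ.norm.mul_const P).add (hθ.norm.mul_const P)) ?_
    · exact ((integrable_gate hX (hy k) (hyX k) hθ p).sub
        (integrable_gate hX hz hzX hθ p)).norm.aestronglyMeasurable
    · rw [norm_norm]
      exact (norm_sub_le _ _).trans (add_le_add (hgb _ _ (hyX k) t) (hgb _ _ hzX t))
    · filter_upwards [ae_tendsto_indicator_horizon hT] with t ht
      rw [← norm_zero (E := ℝ)]
      refine Tendsto.norm ?_
      rcases ht with ⟨ht, hk⟩ | ⟨ht, hk⟩
      · have h1 : Tendsto (fun k => θ t * MvPolynomial.eval (y k t) p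
            - θ t * MvPolynomial.eval (z t) p) l (𝓝 0) := by
          have h2 := (((MvPolynomial.continuous_eval p).tendsto (z t)).comp (hyz t)).const_mul (θ t)
          simpa using h2.sub_const (θ t * MvPolynomial.eval (z t) p)
        refine h1.congr' ?_
        filter_upwards [hk] with k hk
        rw [gate, gate, indicator_of_mem hk, indicator_of_mem ht]
      · refine tendsto_const_nhds.congr' ?_
        filter_upwards [hk] with k hk
        rw [gate, gate, indicator_of_notMem hk, indicator_of_notMem ht, sub_zero]
  simpa using key

namespace Data

variable {D : Data n m ng}

/-- Extended trajectories with convergent initial states have a limit, and the cost passes to the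
limit. -/
theorem exists_extAdmissible_limit (hubar : 0 < D.ubar) (hβ : 0 < D.β) (hX : IsCompact D.X)
    {C : ℝ≥0} {x : ℕ → Fin n → ℝ} {x₀ : Fin n → ℝ} (hx : Tendsto x atTop (𝓝 x₀))
    {y : ℕ → ℝ → Fin n → ℝ} {w : ℕ → Fin m → ℝ → ℝ} {T : ℕ → ℝ≥0∞}
    (h : ∀ k, D.ExtAdmissible C (x k) (y k) (w k) (T k)) :
    ∃ z v T₀, D.ExtAdmissible C x₀ z v T₀ ∧
      Tendsto (fun k => D.extCost (y k) (w k) (T k)) (hyperfilter ℕ) (𝓝 (D.extCost z v T₀)) := by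
  set 𝒰 : Ultrafilter ℕ := hyperfilter ℕ
  have h𝒰 : (𝒰 : Filter ℕ) ≤ atTop := Nat.hyperfilter_le_atTop
  obtain ⟨T₀, -, hT₀⟩ := isCompact_univ.ultrafilter_le_nhds (𝒰.map T) (by simp)
  have hT : Tendsto T 𝒰 (𝓝 T₀) := hT₀
  -- Compactness of `X` gives the limit at each time separately; the common Lipschitz constant
  -- passes to the limit curve.
  have hz' : ∀ t, ∃ z ∈ D.X, Tendsto (fun k => y k t) 𝒰 (𝓝 z) := fun t =>
    hX.ultrafilter_le_nhds (𝒰.map fun k => y k t)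
      (le_principal_iff.2 (Ultrafilter.mem_map.2 (univ_mem' fun k => (h k).state_mem t)))
  choose z hzX hyz using hz'
  have hv' : ∀ i, ∃ v : ℝ → ℝ, Measurable v ∧ (∀ t, 0 ≤ v t ∧ v t ≤ D.ubar) ∧
      ∀ φ : ℝ → ℝ, Integrable φ →
        Tendsto (fun k => ∫ t, φ t * w k i t) 𝒰 (𝓝 (∫ t, φ t * v t)) := fun i =>
    exists_weakLimit 𝒰 hubar.le (fun k => (h k).measurable_control i)
      fun k t => (h k).control_mem i t
  choose v hvm hvb hwv using hv'
  have hzL : LipschitzWith C z := LipschitzWith.of_dist_le_mul fun s t =>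
    le_of_tendsto ((hyz s).dist (hyz t))
      (Eventually.of_forall fun k => (h k).lipschitzWith.dist_le_mul s t)
  -- Dominated convergence requires a countably generated filter, which the ultrafilter does not
  -- supply. The filter `ℱ`, generated by convergence of the stopping times and of the states at
  -- rational times, is countably generated and coarser, so limits along it pass to `𝒰`.
  let ℱ : Filter ℕ := comap T (𝓝 T₀) ⊓ ⨅ q : ℚ, comap (fun k => y k q) (𝓝 (z q))
  have hℱ : (𝒰 : Filter ℕ) ≤ ℱ :=
    le_inf (tendsto_iff_comap.1 hT) (le_iInf fun q => tendsto_iff_comap.1 (hyz q))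
  have hTℱ : Tendsto T ℱ (𝓝 T₀) := tendsto_iff_comap.2 inf_le_left
  have hyℱ : ∀ t, Tendsto (fun k => y k t) ℱ (𝓝 (z t)) :=
    tendsto_of_tendsto_rat (fun k => (h k).lipschitzWith) hzL fun q =>
      tendsto_iff_comap.2 (inf_le_right.trans (iInf_le _ q))
  have hgate : ∀ {θ : ℝ → ℝ}, Integrable θ → ∀ p : MvPolynomial (Fin n) ℝ,
      Tendsto (fun k => ∫ t, ‖gate (T k) (y k) θ p t - gate T₀ z θ p t‖) 𝒰 (𝓝 0) := fun hθ p =>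
    (tendsto_integral_norm_gate_sub hX hTℱ (fun k => (h k).lipschitzWith.continuous)
      hzL.continuous (fun k => (h k).state_mem) hzX hyℱ hθ p).mono_left hℱ
  have hlim : ∀ {θ : ℝ → ℝ}, Integrable θ → ∀ (p : MvPolynomial (Fin n) ℝ)
      (q : Fin m → MvPolynomial (Fin n) ℝ),
      Tendsto (fun k => gateIntegral (T k) (y k) (w k) θ p q) 𝒰
        (𝓝 (gateIntegral T₀ z v θ p q)) := by
    intro θ hθ p q
    have hi : ∀ k p, Integrable (gate (T k) (y k) θ p) := fun k p =>
      integrable_gate hX (h k).lipschitzWith.continuous (h k).state_mem hθ p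
    have hi₀ : ∀ p, Integrable (gate T₀ z θ p) := fun p =>
      integrable_gate hX hzL.continuous hzX hθ p
    refine Tendsto.add ?_ (tendsto_finsetSum _ fun i _ => ?_)
    -- The control-free term is treated as one with constant control `1`.
    · have := tendsto_integral_mul_of_tendsto (l := 𝒰) (w := fun _ _ => 1) (v := fun _ => 1)
        (b := 1) (fun _ => measurable_const) (fun _ _ => by simp) (fun k => hi k p) (hi₀ p)
        (hgate hθ p) tendsto_const_nhds
      simpa using this
    · exact tendsto_integral_mul_of_tendsto (b := D.ubar) (fun k => (h k).measurable_control i)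
        (fun k t => by
          rw [Real.norm_of_nonneg ((h k).control_mem i t).1]
          exact ((h k).control_mem i t).2)
        (fun k => hi k (q i)) (hi₀ (q i)) (hgate hθ (q i)) (hwv i _ (hi₀ (q i)))
  refine ⟨z, v, T₀, ⟨hvm, hvb, hzL, hzX, fun t ht j => ?_⟩, ?_⟩
  · have h1 : Tendsto (fun k => y k t j) 𝒰 (𝓝 (z t j)) := (tendsto_pi_nhds.1 (hyz t)) j
    have h2 : Tendsto (fun k => x k j) 𝒰 (𝓝 (x₀ j)) := (tendsto_pi_nhds.1 (hx.mono_left h𝒰)) j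
    refine tendsto_nhds_unique h1 ((h2.add (hlim (integrable_stepWeight t) (D.f j)
      fun i => D.fu i j)).congr fun k => ?_)
    exact ((h k).dynamics t ht j).symm
  · exact (hlim (integrable_discWeight hβ) _ _).const_add _

/-! ### The value function -/

theorem admissible_zero (hubar : 0 < D.ubar) {x₀ : Fin n → ℝ} (hx₀ : x₀ ∈ D.X) :
    D.Admissible x₀ (fun _ => x₀) (fun _ _ => 0) 0 where
  aemeasurable_control := aemeasurable_const
  continuousOn_state := continuousOn_const
  dynamics t ht := by
    have : t = 0 := le_antisymm (by simpa using ht.2) ht.1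
    simp [this]
  state_mem _ _ := hx₀
  control_mem _ _ _ := ⟨le_rfl, hubar.le⟩

theorem ocpCost_zero (x : ℝ → Fin n → ℝ) (u : ℝ → Fin m → ℝ) : D.ocpCost x u 0 = D.M := by
  have h : horizon 0 = {0} := by
    rw [horizon_of_ne_top (by simp)]
    simp
  rw [ocpCost, h]
  simp [stopDiscount]

theorem ocpCost_nonneg (hM : 0 ≤ D.M) (hl : ∀ x ∈ D.X, ∀ u ∈ D.U, 0 ≤ D.l x u)
    {x₀ : Fin n → ℝ} {x : ℝ → Fin n → ℝ} {u : ℝ → Fin m → ℝ} {T : ℝ≥0∞}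
    (h : D.Admissible x₀ x u T) : 0 ≤ D.ocpCost x u T := by
  refine add_nonneg (setIntegral_nonneg (measurableSet_horizon T) fun t ht =>
    mul_nonneg (Real.exp_pos _).le (hl _ (h.state_mem t ht) _ (h.control_mem t ht)))
    (mul_nonneg ?_ hM)
  unfold stopDiscount
  split_ifs
  · exact le_rfl
  · exact (Real.exp_pos _).le

variable (hM : 0 ≤ D.M) (hl : ∀ x ∈ D.X, ∀ u ∈ D.U, 0 ≤ D.l x u)

include hM hl

theorem bddBelow_costs (x₀ : Fin n → ℝ) :
    BddBelow {c | ∃ x u T, D.Admissible x₀ x u T ∧ D.ocpCost x u T = c} := by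
  refine ⟨0, ?_⟩
  rintro _ ⟨x, u, T, h, rfl⟩
  exact ocpCost_nonneg hM hl h

theorem V_le_ocpCost {x₀ : Fin n → ℝ} {x : ℝ → Fin n → ℝ} {u : ℝ → Fin m → ℝ} {T : ℝ≥0∞}
    (h : D.Admissible x₀ x u T) : D.V x₀ ≤ D.ocpCost x u T :=
  csInf_le (bddBelow_costs hM hl x₀) ⟨x, u, T, h, rfl⟩

theorem V_nonneg (x₀ : Fin n → ℝ) : 0 ≤ D.V x₀ := by
  refine Real.sInf_nonneg ?_
  rintro _ ⟨x, u, T, h, rfl⟩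
  exact ocpCost_nonneg hM hl h

theorem V_le_M (hubar : 0 < D.ubar) {x₀ : Fin n → ℝ} (hx₀ : x₀ ∈ D.X) : D.V x₀ ≤ D.M :=
  (V_le_ocpCost hM hl (admissible_zero hubar hx₀)).trans_eq (ocpCost_zero _ _)

/-- The sublevel sets of the value function are closed. -/
theorem isClosed_sublevel_V (hubar : 0 < D.ubar) (hβ : 0 < D.β) (hX : IsCompact D.X) (c : ℝ) :
    IsClosed {x | x ∈ D.X ∧ D.V x ≤ c} := by
  refine IsSeqClosed.isClosed fun x x₀ hx hlim => ?_
  have hx₀ : x₀ ∈ D.X := D.isClosed_X.mem_of_tendsto hlim (Eventually.of_forall fun k => (hx k).1)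
  refine ⟨hx₀, ?_⟩
  obtain ⟨C, hC⟩ := exists_norm_field_le hX
  -- Trajectories optimal up to `1 / (k + 1)`; their limit starts at `x₀` and costs at most `c`.
  have hex : ∀ k : ℕ, ∃ y w T, D.ExtAdmissible C (x k) y w T ∧
      D.extCost y w T ≤ c + 1 / (k + 1) := by
    intro k
    have hlt : D.V (x k) < c + 1 / (k + 1) := by
      have : (0 : ℝ) < 1 / (k + 1) := by positivity
      linarith [(hx k).2]
    have hne : {c | ∃ ξ u T, D.Admissible (x k) ξ u T ∧ D.ocpCost ξ u T = c}.Nonempty :=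
      ⟨_, _, _, _, admissible_zero hubar (hx k).1, rfl⟩
    obtain ⟨_, ⟨ξ, u, T, hadm, rfl⟩, hcost⟩ := exists_lt_of_csInf_lt hne hlt
    obtain ⟨y, w, hE, hc, -⟩ := hadm.exists_extAdmissible hubar hβ hX hC
    exact ⟨y, w, T, hE, by rw [hc]; exact hcost.le⟩
  choose y w T hE hcost using hex
  obtain ⟨z, v, T₀, hE₀, hconv⟩ := exists_extAdmissible_limit hubar hβ hX hlim hE
  have hc : Tendsto (fun k : ℕ => c + 1 / ((k : ℝ) + 1)) (hyperfilter ℕ) (𝓝 (c + 0)) :=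
    (tendsto_one_div_add_atTop_nhds_zero_nat.const_add c).mono_left Nat.hyperfilter_le_atTop
  rw [add_zero] at hc
  have hle := le_of_tendsto_of_tendsto hconv hc (Eventually.of_forall hcost)
  rw [← ocpCost_eq_extCost hβ hX hE₀.lipschitzWith.continuous hE₀.state_mem
    hE₀.measurable_control hE₀.control_mem] at hle
  exact (V_le_ocpCost hM hl (hE₀.admissible hX)).trans hle

omit hM hl in
/-- The value function, extended by `M` outside of the state constraint set. -/
noncomputable def Vext (D : Data n m ng) (x : Fin n → ℝ) : ℝ :=
  open Classical in if x ∈ D.X then D.V x else D.M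

omit hM hl in
theorem Vext_of_mem {x : Fin n → ℝ} (hx : x ∈ D.X) : D.Vext x = D.V x := by
  simp [Vext, hx]

theorem Vext_nonneg (x : Fin n → ℝ) : 0 ≤ D.Vext x := by
  unfold Vext
  split_ifs
  exacts [V_nonneg hM hl x, hM]

theorem Vext_le_M (hubar : 0 < D.ubar) (x : Fin n → ℝ) : D.Vext x ≤ D.M := by
  unfold Vext
  split_ifs with h
  exacts [V_le_M hM hl hubar h, le_rfl]

/-- Because `V ≤ M`, extension by `M` is harmless: a sublevel set is the whole space for `c ≥ M` and
lies inside `X`, where it is closed, for `c < M`. -/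
theorem lowerSemicontinuous_Vext (hubar : 0 < D.ubar) (hβ : 0 < D.β) (hX : IsCompact D.X) :
    LowerSemicontinuous D.Vext := by
  rw [lowerSemicontinuous_iff_isClosed_preimage]
  intro c
  by_cases hc : D.M ≤ c
  · convert isClosed_univ
    exact eq_univ_of_forall fun x => (Vext_le_M hM hl hubar x).trans hc
  · convert isClosed_sublevel_V hM hl hubar hβ hX c using 1
    ext x
    by_cases hx : x ∈ D.X <;> simp [Vext, hx, hc]

end Data

end Limit

end DensityLP

namespace DensityLP

open Filter Set
open scoped Topology NNReal

variable {n m ng : ℕ}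

/-! ### The dynamic programming inequality -/

theorem mem_horizon_add {h t : ℝ} (hh : 0 ≤ h) (T : ℝ≥0∞) :
    t ∈ horizon (ENNReal.ofReal h + T) ↔ t ∈ Ico 0 h ∪ (fun s => s - h) ⁻¹' horizon T := by
  rw [mem_union, mem_preimage, mem_horizon, mem_horizon, mem_Ico]
  rcases lt_or_ge t h with ht | ht
  · have h1 : ENNReal.ofReal t ≤ ENNReal.ofReal h + T :=
      (ENNReal.ofReal_le_ofReal ht.le).trans le_self_add
    have h2 : ¬ 0 ≤ t - h := by linarith
    simp [h1, h2, ht]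
  · have h1 : ENNReal.ofReal t = ENNReal.ofReal h + ENNReal.ofReal (t - h) := by
      rw [← ENNReal.ofReal_add hh (sub_nonneg.2 ht), add_sub_cancel]
    rw [h1, ENNReal.add_le_add_iff_left ENNReal.ofReal_ne_top]
    simp [hh.trans ht, ht]

theorem stopDiscount_add {h : ℝ} (hh : 0 ≤ h) (β : ℝ) (T : ℝ≥0∞) :
    stopDiscount β (ENNReal.ofReal h + T) = Real.exp (-β * h) * stopDiscount β T := by
  unfold stopDiscount
  by_cases hT : T = ∞
  · simp [hT]
  · rw [if_neg (by simp [hT]), if_neg hT, ENNReal.toReal_add ENNReal.ofReal_ne_top hT,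
      ENNReal.toReal_ofReal hh, ← Real.exp_add]
    ring_nf

namespace Data

variable {D : Data n m ng}

theorem integrableOn_cost (hβ : 0 < D.β) (hX : IsCompact D.X) {z : ℝ → Fin n → ℝ}
    {u : ℝ → Fin m → ℝ} (hz : Measurable z) (hu : Measurable u) (hzX : ∀ t, z t ∈ D.X)
    (huU : ∀ t, u t ∈ D.U) (T : ℝ≥0∞) :
    IntegrableOn (fun t => Real.exp (-D.β * t) * D.l (z t) (u t)) (horizon T) := by
  obtain ⟨C, hC⟩ := (hX.prod D.isCompact_U).exists_bound_of_continuousOn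
    D.continuous_l.continuousOn
  have hlm := D.continuous_l.stronglyMeasurable.comp_measurable (hz.prodMk hu)
  exact (integrableOn_exp_horizon hβ T).mul_bdd (c := C) hlm.aestronglyMeasurable
    (Eventually.of_forall fun t => hC (z t, u t) ⟨hzX t, huU t⟩)

/-- Concatenation of two controlled trajectories. -/
theorem ExtAdmissible.exists_concat (hβ : 0 < D.β) (hX : IsCompact D.X) {C : ℝ≥0} {h : ℝ}
    (hh : 0 ≤ h) {x₀ : Fin n → ℝ} {y₁ y₂ : ℝ → Fin n → ℝ} {w₁ w₂ : Fin m → ℝ → ℝ} {T : ℝ≥0∞}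
    (h₁ : D.ExtAdmissible C x₀ y₁ w₁ (ENNReal.ofReal h))
    (h₂ : D.ExtAdmissible C (y₁ h) y₂ w₂ T) :
    ∃ z u, D.Admissible x₀ z u (ENNReal.ofReal h + T) ∧
      D.ocpCost z u (ENNReal.ofReal h + T) =
        D.extCost y₁ w₁ (ENNReal.ofReal h) - Real.exp (-D.β * h) * D.M
          + Real.exp (-D.β * h) * D.extCost y₂ w₂ T := by
  set u₁ : ℝ → Fin m → ℝ := fun t i => w₁ i t with hu₁
  set u₂ : ℝ → Fin m → ℝ := fun t i => w₂ i t with hu₂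
  have hu₁m : Measurable u₁ := measurable_pi_lambda _ h₁.measurable_control
  have hu₂m : Measurable u₂ := measurable_pi_lambda _ h₂.measurable_control
  have hu₁U : ∀ t, u₁ t ∈ D.U := fun t i => h₁.control_mem i t
  have hu₂U : ∀ t, u₂ t ∈ D.U := fun t i => h₂.control_mem i t
  have hA₁ : D.Admissible x₀ y₁ u₁ _ := h₁.admissible hX
  have hA₂ : D.Admissible (y₁ h) y₂ u₂ _ := h₂.admissible hX
  have hy₂ : y₂ 0 = y₁ h := by
    simpa using hA₂.dynamics 0 (zero_mem_horizon T)
  set z : ℝ → Fin n → ℝ := fun t => if h ≤ t then y₂ (t - h) else y₁ t with hz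
  set u : ℝ → Fin m → ℝ := fun t => if h ≤ t then u₂ (t - h) else u₁ t with hu
  have hzc : Continuous z := by
    refine Continuous.if_le ?_ h₁.lipschitzWith.continuous continuous_const continuous_id ?_
    · exact h₂.lipschitzWith.continuous.comp (by fun_prop)
    · rintro t rfl
      simpa using hy₂
  have hum : Measurable u :=
    Measurable.ite measurableSet_Ici (hu₂m.comp (measurable_id.sub_const h)) hu₁m
  have hzX : ∀ t, z t ∈ D.X := fun t => by
    simp only [hz]
    split_ifs
    exacts [h₂.state_mem _, h₁.state_mem _]
  have huU : ∀ t, u t ∈ D.U := fun t => by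
    simp only [hu]
    split_ifs
    exacts [hu₂U _, hu₁U _]
  have hz₁ : ∀ t, t < h → z t = y₁ t ∧ u t = u₁ t := fun t ht => by
    simp only [hz, hu, if_neg (not_le.2 ht), and_self]
  have hz₂ : ∀ t, h ≤ t → z t = y₂ (t - h) ∧ u t = u₂ (t - h) := fun t ht => by
    simp only [hz, hu, if_pos ht, and_self]
  have hint := intervalIntegrable_field hX hzc.measurable hum hzX huU
  have hhor : horizon (ENNReal.ofReal h + T) = Ico 0 h ∪ (fun s => s - h) ⁻¹' horizon T :=
    Set.ext fun t => mem_horizon_add hh T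
  have hstart : ∀ t, 0 ≤ t → t ≤ h →
      ∫ s in (0 : ℝ)..t, D.field (z s) (u s) = ∫ s in (0 : ℝ)..t, D.field (y₁ s) (u₁ s) := by
    intro t ht0 ht
    refine intervalIntegral.integral_congr_ae ?_
    -- The concatenated control switches at time `h` itself, a single point that the integral
    -- ignores.
    filter_upwards [Measure.ae_ne volume h] with s hs hsI
    rw [uIoc_of_le ht0] at hsI
    obtain ⟨e1, e2⟩ := hz₁ s (lt_of_le_of_ne (hsI.2.trans ht) hs)
    rw [e1, e2]
  have hmem₁ : ∀ t, 0 ≤ t → t ≤ h → t ∈ horizon (ENNReal.ofReal h) := fun t h0 h1 =>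
    ⟨h0, ENNReal.ofReal_le_ofReal h1⟩
  refine ⟨z, u, ⟨hum.aemeasurable, hzc.continuousOn, fun t ht => ?_, fun t _ => hzX t,
    fun t _ => huU t⟩, ?_⟩
  · rcases lt_or_ge t h with hth | hth
    · rw [hstart t ht.1 hth.le, (hz₁ t hth).1]
      exact hA₁.dynamics t (hmem₁ t ht.1 hth.le)
    · have htT : t - h ∈ horizon T := by
        rw [hhor] at ht
        rcases ht with ht | ht
        · exact absurd ht.2 (not_lt.2 hth)
        · exact ht
      rw [← intervalIntegral.integral_add_adjacent_intervals (hint 0 h) (hint h t),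
        hstart h hh le_rfl, (hz₂ t hth).1, hA₂.dynamics _ htT,
        hA₁.dynamics h (hmem₁ h hh le_rfl), add_assoc]
      congr 2
      have hshift : ∫ s in h..t, D.field (y₂ (s - h)) (u₂ (s - h))
          = ∫ s in (0 : ℝ)..(t - h), D.field (y₂ s) (u₂ s) := by
        rw [intervalIntegral.integral_comp_sub_right (fun s => D.field (y₂ s) (u₂ s)) h, sub_self]
      rw [← hshift]
      refine intervalIntegral.integral_congr fun s hs => ?_
      rw [uIcc_of_le hth] at hs
      obtain ⟨e1, e2⟩ := hz₂ s hs.1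
      simp only [e1, e2]
  · rw [← ocpCost_eq_extCost hβ hX h₁.lipschitzWith.continuous h₁.state_mem
      h₁.measurable_control h₁.control_mem, ← ocpCost_eq_extCost hβ hX
      h₂.lipschitzWith.continuous h₂.state_mem h₂.measurable_control h₂.control_mem,
      ocpCost, ocpCost, ocpCost, stopDiscount_add hh]
    have hcost := integrableOn_cost hβ hX hzc.measurable hum hzX huU (ENNReal.ofReal h + T)
    rw [hhor] at hcost ⊢
    have hpre : MeasurableSet ((fun s : ℝ => s - h) ⁻¹' horizon T) :=
      (measurable_id.sub_const h) (measurableSet_horizon T)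
    have hdisj : Disjoint (Ico 0 h) ((fun s : ℝ => s - h) ⁻¹' horizon T) :=
      Set.disjoint_left.2 fun t ht ht' => by
        have := ht'.1
        linarith [ht.2]
    rw [setIntegral_union hdisj hpre (hcost.mono_set subset_union_left)
      (hcost.mono_set subset_union_right)]
    have e1 : ∫ t in Ico 0 h, Real.exp (-D.β * t) * D.l (z t) (u t)
        = ∫ t in horizon (ENNReal.ofReal h), Real.exp (-D.β * t) * D.l (y₁ t) (u₁ t) := by
      rw [horizon_of_ne_top ENNReal.ofReal_ne_top, ENNReal.toReal_ofReal hh,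
        integral_Icc_eq_integral_Ico]
      refine setIntegral_congr_fun measurableSet_Ico fun t ht => ?_
      obtain ⟨e1, e2⟩ := hz₁ t ht.2
      simp only [e1, e2]
    have e2 : ∫ t in (fun s : ℝ => s - h) ⁻¹' horizon T, Real.exp (-D.β * t) * D.l (z t) (u t)
        = Real.exp (-D.β * h) *
          ∫ t in horizon T, Real.exp (-D.β * t) * D.l (y₂ t) (u₂ t) := by
      have := (measurePreserving_sub_right (volume : Measure ℝ) h).setIntegral_preimage_emb
        (MeasurableEquiv.subRight h).measurableEmbedding
        (fun t => Real.exp (-D.β * h) * (Real.exp (-D.β * t) * D.l (y₂ t) (u₂ t))) (horizon T)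
      rw [← integral_const_mul, ← this]
      refine setIntegral_congr_fun hpre fun t ht => ?_
      obtain ⟨e1, e2⟩ := hz₂ t (sub_nonneg.1 ht.1)
      simp only [e1, e2]
      rw [← mul_assoc, ← Real.exp_add]
      ring_nf
    have e3 : stopDiscount D.β (ENNReal.ofReal h) = Real.exp (-D.β * h) := by
      rw [stopDiscount, if_neg ENNReal.ofReal_ne_top, ENNReal.toReal_ofReal hh]
    rw [e1, e2, e3]
    ring

/-- The dynamic programming inequality. -/
theorem V_le_of_admissible (hubar : 0 < D.ubar) (hβ : 0 < D.β) (hX : IsCompact D.X)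
    (hM : 0 ≤ D.M) (hl : ∀ x ∈ D.X, ∀ u ∈ D.U, 0 ≤ D.l x u) {h : ℝ} (hh : 0 ≤ h)
    {x₀ : Fin n → ℝ} {ξ : ℝ → Fin n → ℝ} {u : ℝ → Fin m → ℝ}
    (hadm : D.Admissible x₀ ξ u (ENNReal.ofReal h)) :
    D.V x₀ ≤ (∫ t in (0 : ℝ)..h, Real.exp (-D.β * t) * D.l (ξ t) (u t))
      + Real.exp (-D.β * h) * D.V (ξ h) := by
  obtain ⟨C, hC⟩ := exists_norm_field_le hX
  obtain ⟨y₁, w₁, h₁, hc₁, hyξ⟩ := hadm.exists_extAdmissible hubar hβ hX hC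
  have hmem : h ∈ horizon (ENNReal.ofReal h) := ⟨hh, le_rfl⟩
  have hcost : D.extCost y₁ w₁ (ENNReal.ofReal h) - Real.exp (-D.β * h) * D.M
      = ∫ t in (0 : ℝ)..h, Real.exp (-D.β * t) * D.l (ξ t) (u t) := by
    rw [hc₁, ocpCost, stopDiscount, if_neg ENNReal.ofReal_ne_top, ENNReal.toReal_ofReal hh,
      horizon_of_ne_top ENNReal.ofReal_ne_top, ENNReal.toReal_ofReal hh,
      integral_Icc_eq_integral_Ioc, intervalIntegral.integral_of_le hh]
    ring
  -- Solved for `V (ξ h)`, the claim is a lower bound on an infimum: each competitor starting at `ξ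
  -- h` is concatenated with the given arc and compared with `V x₀`.
  rw [← hcost, ← sub_le_iff_le_add', ← div_le_iff₀' (Real.exp_pos _)]
  refine le_csInf ⟨_, _, _, _, admissible_zero hubar (hadm.state_mem h hmem), rfl⟩ ?_
  rintro _ ⟨x, v, T, hx, rfl⟩
  rw [div_le_iff₀' (Real.exp_pos _), sub_le_iff_le_add']
  obtain ⟨y₂, w₂, h₂, hc₂, -⟩ := hx.exists_extAdmissible hubar hβ hX hC
  rw [← hyξ h hmem] at h₂
  obtain ⟨z, v', hz, hcz⟩ := h₁.exists_concat hβ hX hh h₂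
  rw [← hc₂, ← hcz]
  exact V_le_ocpCost hM hl hz

end Data

end DensityLP

namespace DensityLP

open Filter Set
open scoped Topology NNReal

variable {n m ng : ℕ}

/-! ### Cutoff functions -/

section Cutoff

/-- A smooth cutoff equal to `0` on `(-∞,1]` and to `1` on `[2,∞)`. -/
noncomputable def cutoff (s : ℝ) : ℝ := Real.smoothTransition (s - 1)

theorem contDiff_cutoff : ContDiff ℝ 1 cutoff :=
  Real.smoothTransition.contDiff.comp (contDiff_id.sub contDiff_const)

theorem cutoff_nonneg (s : ℝ) : 0 ≤ cutoff s := Real.smoothTransition.nonneg _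

theorem cutoff_le_one (s : ℝ) : cutoff s ≤ 1 := Real.smoothTransition.le_one _

theorem cutoff_of_le {s : ℝ} (hs : s ≤ 1) : cutoff s = 0 :=
  Real.smoothTransition.zero_of_nonpos (by linarith)

theorem cutoff_of_ge {s : ℝ} (hs : 2 ≤ s) : cutoff s = 1 :=
  Real.smoothTransition.one_of_one_le (by linarith)

theorem hasDerivAt_cutoff (s : ℝ) : HasDerivAt cutoff (deriv cutoff s) s :=
  (contDiff_cutoff.differentiable one_ne_zero s).hasDerivAt

theorem deriv_cutoff_of_gt {s : ℝ} (hs : 2 < s) : deriv cutoff s = 0 := by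
  have : cutoff =ᶠ[𝓝 s] fun _ => 1 := (lt_mem_nhds hs).mono fun t ht => cutoff_of_ge ht.le
  rw [this.deriv_eq, deriv_const]

theorem deriv_cutoff_of_lt {s : ℝ} (hs : s < 1) : deriv cutoff s = 0 := by
  have : cutoff =ᶠ[𝓝 s] fun _ => 0 := (gt_mem_nhds hs).mono fun t ht => cutoff_of_le ht.le
  rw [this.deriv_eq, deriv_const]

/-- The derivative lives on `[1, 2]`. Taken at `s = ρ / ε`, the bound does not depend on `ε`, which
controls the cutoff error in the limit. -/
theorem exists_mul_deriv_cutoff_le : ∃ A : ℝ, 0 ≤ A ∧ ∀ s, |deriv cutoff s * s| ≤ A := by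
  have hc : Continuous fun s => deriv cutoff s * s :=
    (contDiff_cutoff.continuous_deriv le_rfl).mul continuous_id
  obtain ⟨A, hA⟩ := (isCompact_Icc (a := (1 : ℝ)) (b := 2)).exists_bound_of_continuousOn
    hc.continuousOn
  refine ⟨max A 0, le_max_right _ _, fun s => ?_⟩
  by_cases hs : s ∈ Icc (1 : ℝ) 2
  · exact (hA s hs).trans (le_max_left _ _)
  · have : deriv cutoff s = 0 := by
      rw [mem_Icc, not_and_or, not_le, not_le] at hs
      exact hs.elim deriv_cutoff_of_lt deriv_cutoff_of_gt
    simp [this]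

/-- Extension by zero of a `C¹` function vanishing outside of a compact subset of its domain. -/
theorem contDiff_indicator_of_isCompact {E G : Type*} [NormedAddCommGroup E] [NormedSpace ℝ E]
    [NormedAddCommGroup G] [NormedSpace ℝ G] {Ω K : Set E} {H : E → G} (hΩ : IsOpen Ω)
    (hK : IsCompact K) (hKΩ : K ⊆ Ω) (hH : ContDiffOn ℝ 1 H Ω)
    (h0 : ∀ x ∈ Ω, x ∉ K → H x = 0) :
    ContDiff ℝ 1 (Ω.indicator H) ∧ HasCompactSupport (Ω.indicator H) := by
  have hout : ∀ x ∉ K, Ω.indicator H x = 0 := fun x hx => by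
    by_cases hxΩ : x ∈ Ω
    · rw [indicator_of_mem hxΩ, h0 x hxΩ hx]
    · exact indicator_of_notMem hxΩ _
  refine ⟨contDiff_iff_contDiffAt.2 fun x => ?_, HasCompactSupport.intro hK hout⟩
  by_cases hx : x ∈ Ω
  · refine (hH.contDiffAt (hΩ.mem_nhds hx)).congr_of_eventuallyEq ?_
    filter_upwards [hΩ.mem_nhds hx] with y hy using indicator_of_mem hy _
  · have hxK : x ∉ K := fun h => hx (hKΩ h)
    refine (contDiffAt_const (c := (0 : G))).congr_of_eventuallyEq ?_
    filter_upwards [hK.isClosed.isOpen_compl.mem_nhds hxK] with y hy using hout y hy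

theorem IsC1On.contDiffOn {X : Set (Fin n → ℝ)} {ρ : (Fin n → ℝ) → ℝ} (h : IsC1On X ρ) :
    ContDiffOn ℝ 1 ρ (interior X) := by
  obtain ⟨-, G, hG, hd⟩ := h
  rw [← zero_add 1, contDiffOn_succ_iff_fderiv_of_isOpen isOpen_interior, contDiffOn_zero]
  refine ⟨fun x hx => (hd x hx).differentiableAt.differentiableWithinAt, by simp, ?_⟩
  exact (hG.mono interior_subset).congr fun x hx => (hd x hx).fderiv

theorem IsC1On.differentiableAt {X : Set (Fin n → ℝ)} {ρ : (Fin n → ℝ) → ℝ} (h : IsC1On X ρ)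
    {x : Fin n → ℝ} (hx : x ∈ interior X) : DifferentiableAt ℝ ρ x := by
  obtain ⟨-, G, -, hd⟩ := h
  exact (hd x hx).differentiableAt

theorem IsC1On.exists_norm_fderiv_le {X : Set (Fin n → ℝ)} {ρ : (Fin n → ℝ) → ℝ}
    (h : IsC1On X ρ) (hX : IsCompact X) : ∃ B : ℝ, ∀ x ∈ interior X, ‖fderiv ℝ ρ x‖ ≤ B := by
  obtain ⟨-, G, hG, hd⟩ := h
  obtain ⟨B, hB⟩ := hX.exists_bound_of_continuousOn hG
  exact ⟨B, fun x hx => by rw [(hd x hx).fderiv]; exact hB x (interior_subset hx)⟩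

end Cutoff

/-! ### The feedback defined by a feasible density -/

namespace Data

/-- The feedback control `σ / ρ`. -/
noncomputable def feedback (ρ : (Fin n → ℝ) → ℝ) (σ : Fin m → (Fin n → ℝ) → ℝ) (x : Fin n → ℝ) :
    Fin m → ℝ := fun i => σ i x / ρ x

/-- The flux `ρ f + ∑ σ_i f_{u_i}`. -/
noncomputable def flux (D : Data n m ng) (ρ : (Fin n → ℝ) → ℝ) (σ : Fin m → (Fin n → ℝ) → ℝ)
    (x : Fin n → ℝ) (j : Fin n) : ℝ :=
  ρ x * MvPolynomial.eval x (D.f j) + ∑ i, σ i x * MvPolynomial.eval x (D.fu i j)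

/-- The running cost density `l_x ρ + ∑ l_{u_i} σ_i`. -/
noncomputable def costDensity (D : Data n m ng) (ρ : (Fin n → ℝ) → ℝ)
    (σ : Fin m → (Fin n → ℝ) → ℝ) (x : Fin n → ℝ) : ℝ :=
  MvPolynomial.eval x D.lx * ρ x + ∑ i, MvPolynomial.eval x (D.lu i) * σ i x

/-- The interior points of positive density. -/
def posSet (D : Data n m ng) (ρ : (Fin n → ℝ) → ℝ) : Set (Fin n → ℝ) :=
  interior D.X ∩ ρ ⁻¹' Ioi 0

variable {D : Data n m ng} {ρ ρ₀ ρT : (Fin n → ℝ) → ℝ} {σ : Fin m → (Fin n → ℝ) → ℝ}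

theorem posSet_subset : D.posSet ρ ⊆ D.X := inter_subset_left.trans interior_subset

theorem mul_field_feedback {x : Fin n → ℝ} (hx : ρ x ≠ 0) (j : Fin n) :
    ρ x * D.field x (feedback ρ σ x) j = D.flux ρ σ x j := by
  simp only [field, feedback, flux, mul_add, Finset.mul_sum]
  congr 1
  refine Finset.sum_congr rfl fun i _ => ?_
  field_simp

theorem mul_l_feedback {x : Fin n → ℝ} (hx : ρ x ≠ 0) :
    ρ x * D.l x (feedback ρ σ x) = D.costDensity ρ σ x := by
  simp only [l, feedback, costDensity, mul_add, Finset.mul_sum]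
  congr 1
  · ring
  · refine Finset.sum_congr rfl fun i _ => ?_
    field_simp

namespace LPFeasible

variable (h : D.LPFeasible ρ ρ₀ ρT σ)

include h

/-- One input suffices: `0 ≤ σ ≤ ubar ρ` with `ubar > 0`. -/
theorem rho_nonneg (hm : 0 < m) (hubar : 0 < D.ubar) {x : Fin n → ℝ} (hx : x ∈ D.X) :
    0 ≤ ρ x := by
  have h1 := (h.sigma_nonneg x hx ⟨0, hm⟩).trans (h.sigma_le x hx ⟨0, hm⟩)
  exact nonneg_of_mul_nonneg_right h1 hubar

theorem sigma_eq_zero {x : Fin n → ℝ} (hx : x ∈ D.X) (hρ : ρ x = 0) (i : Fin m) : σ i x = 0 := by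
  have h1 := h.sigma_le x hx i
  rw [hρ, mul_zero] at h1
  exact le_antisymm h1 (h.sigma_nonneg x hx i)

/-- The boundary condition `ρ ≤ 0` keeps positive density away from the boundary, so superlevel sets
of `ρ` are compact subsets of the open set where the feedback is `C¹`. -/
theorem mem_posSet {x : Fin n → ℝ} (hx : x ∈ D.X) (hρ : 0 < ρ x) : x ∈ D.posSet ρ := by
  refine ⟨?_, hρ⟩
  by_contra hint
  have hf : x ∈ frontier D.X := by
    rw [D.isClosed_X.frontier_eq]
    exact ⟨hx, hint⟩
  exact absurd (h.rho_nonpos x hf) (not_le.2 hρ)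

theorem isOpen_posSet : IsOpen (D.posSet ρ) :=
  (h.c1_rho.1.mono interior_subset).isOpen_inter_preimage isOpen_interior isOpen_Ioi

theorem isCompact_superlevel (hX : IsCompact D.X) (ε : ℝ) :
    IsCompact (D.X ∩ ρ ⁻¹' Ici ε) :=
  hX.of_isClosed_subset (h.c1_rho.1.preimage_isClosed_of_isClosed D.isClosed_X isClosed_Ici)
    inter_subset_left

theorem superlevel_subset_posSet {ε : ℝ} (hε : 0 < ε) : D.X ∩ ρ ⁻¹' Ici ε ⊆ D.posSet ρ :=
  fun _ hx => h.mem_posSet hx.1 (hε.trans_le hx.2)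

theorem feedback_mem {x : Fin n → ℝ} (hx : x ∈ D.posSet ρ) : feedback ρ σ x ∈ D.U := fun i => by
  have hxX := interior_subset hx.1
  have hρ : 0 < ρ x := hx.2
  refine ⟨div_nonneg (h.sigma_nonneg x hxX i) hρ.le, ?_⟩
  rw [feedback, div_le_iff₀ hρ]
  exact h.sigma_le x hxX i

theorem contDiffOn_feedback : ContDiffOn ℝ 1 (feedback ρ σ) (D.posSet ρ) :=
  contDiffOn_pi.2 fun i =>
    ((h.c1_sigma i).contDiffOn.mono inter_subset_left).div
      (h.c1_rho.contDiffOn.mono inter_subset_left) fun _ hx => ne_of_gt hx.2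

theorem contDiffOn_field : ContDiffOn ℝ 1 (fun x => D.field x (feedback ρ σ x)) (D.posSet ρ) :=
  contDiffOn_pi.2 fun j => (contDiff_eval (D.f j)).contDiffOn.add
    (ContDiffOn.sum fun i _ => (contDiff_eval (D.fu i j)).contDiffOn.mul
      (contDiffOn_pi.1 h.contDiffOn_feedback i))

theorem contDiffOn_l : ContDiffOn ℝ 1 (fun x => D.l x (feedback ρ σ x)) (D.posSet ρ) :=
  (contDiff_eval D.lx).contDiffOn.add
    (ContDiffOn.sum fun i _ => (contDiff_eval (D.lu i)).contDiffOn.mul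
      (contDiffOn_pi.1 h.contDiffOn_feedback i))

theorem contDiffOn_cutoff (ε : ℝ) : ContDiffOn ℝ 1 (fun x => cutoff (ρ x / ε)) (D.posSet ρ) :=
  contDiff_cutoff.comp_contDiffOn
    ((h.c1_rho.contDiffOn.mono inter_subset_left).div_const ε)

/-- Localization of a function on the set of positive density. -/
theorem contDiff_localized {G : Type*} [NormedAddCommGroup G] [NormedSpace ℝ G]
    (hX : IsCompact D.X) {ε : ℝ} (hε : 0 < ε) {H : (Fin n → ℝ) → G}
    (hH : ContDiffOn ℝ 1 H (D.posSet ρ)) :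
    ContDiff ℝ 1 ((D.posSet ρ).indicator fun x => cutoff (ρ x / ε) • H x) ∧
      HasCompactSupport ((D.posSet ρ).indicator fun x => cutoff (ρ x / ε) • H x) := by
  refine contDiff_indicator_of_isCompact h.isOpen_posSet (h.isCompact_superlevel hX ε)
    (h.superlevel_subset_posSet hε) ((h.contDiffOn_cutoff ε).smul hH) fun x hx hxK => ?_
  have : ρ x < ε := by
    by_contra hge
    exact hxK ⟨interior_subset hx.1, not_lt.1 hge⟩
  rw [cutoff_of_le ((div_le_one hε).2 this.le), zero_smul]

theorem hasFDerivAt_flux {x : Fin n → ℝ} (hx : x ∈ interior D.X) (j : Fin n) :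
    HasFDerivAt (fun y => D.flux ρ σ y j)
      (fderiv ℝ (fun y => ρ y * MvPolynomial.eval y (D.f j)) x
        + ∑ i, fderiv ℝ (fun y => σ i y * MvPolynomial.eval y (D.fu i j)) x) x := by
  have hp : ∀ p : MvPolynomial (Fin n) ℝ,
      DifferentiableAt ℝ (fun y : Fin n → ℝ => MvPolynomial.eval y p) x := fun p =>
    (hasFDerivAt_eval p x).differentiableAt
  refine ((h.c1_rho.differentiableAt hx).mul (hp _)).hasFDerivAt.add ?_
  exact HasFDerivAt.fun_sum fun i _ =>
    (((h.c1_sigma i).differentiableAt hx).mul (hp _)).hasFDerivAt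

theorem divergence_flux {x : Fin n → ℝ} (hx : x ∈ interior D.X) :
    ∑ j, (fderiv ℝ (fun y => ρ y * MvPolynomial.eval y (D.f j)) x
        + ∑ i, fderiv ℝ (fun y => σ i y * MvPolynomial.eval y (D.fu i j)) x) (Pi.single j 1)
      = ρ₀ x - ρT x - D.β * ρ x := by
  have h1 := h.liouville x hx
  simp only [divergence] at h1
  simp only [add_apply, sum_apply,
    Finset.sum_add_distrib]
  rw [Finset.sum_comm (s := Finset.univ (α := Fin n))]
  linarith

/-- The flux is divergence free where the density vanishes. -/
theorem source_eq_zero (hm : 0 < m) (hubar : 0 < D.ubar) {x : Fin n → ℝ} (hx : x ∈ interior D.X)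
    (hρ : ρ x = 0) : ρ₀ x - ρT x - D.β * ρ x = 0 := by
  have hnhds : D.X ∈ 𝓝 x := mem_interior_iff_mem_nhds.1 hx
  have hxX := interior_subset hx
  -- A nonnegative function has a minimum at an interior zero, so its gradient vanishes there. This
  -- applies to `ρ` and to every `σ i`, and kills each term of the divergence.
  have hmin : ∀ {τ : (Fin n → ℝ) → ℝ}, (∀ y ∈ D.X, 0 ≤ τ y) → τ x = 0 → fderiv ℝ τ x = 0 := by
    intro τ hτ h0
    refine IsLocalMin.fderiv_eq_zero ?_
    filter_upwards [hnhds] with y hy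
    rw [h0]
    exact hτ y hy
  have hzero : ∀ {τ : (Fin n → ℝ) → ℝ}, (∀ y ∈ D.X, 0 ≤ τ y) → τ x = 0 → DifferentiableAt ℝ τ x →
      ∀ p : MvPolynomial (Fin n) ℝ,
        fderiv ℝ (fun y => τ y * MvPolynomial.eval y p) x = 0 := by
    intro τ hτ h0 hd p
    rw [fderiv_fun_mul hd (hasFDerivAt_eval p x).differentiableAt, h0, hmin hτ h0]
    simp
  rw [← h.divergence_flux hx]
  refine Finset.sum_eq_zero fun j _ => ?_
  rw [hzero (fun y hy => h.rho_nonneg hm hubar hy) hρ (h.c1_rho.differentiableAt hx),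
    Finset.sum_eq_zero fun i _ => hzero (fun y hy => h.sigma_nonneg y hy i)
      (h.sigma_eq_zero hxX hρ i) ((h.c1_sigma i).differentiableAt hx) _]
  simp

end LPFeasible

end Data

end DensityLP

/-! ### Dynamic programming along the closed loop, localized away from zero density. -/

namespace DensityLP

open Filter Set
open scoped Topology NNReal

variable {n m ng : ℕ}

namespace Data.LPFeasible

variable {D : Data n m ng} {ρ ρ₀ ρT : (Fin n → ℝ) → ℝ} {σ : Fin m → (Fin n → ℝ) → ℝ}

/-- A trajectory remaining in the set of positive density and driven by the feedback is
admissible. -/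
theorem admissible_of_feedback (h : D.LPFeasible ρ ρ₀ ρT σ) {ξ : ℝ → Fin n → ℝ} {t : ℝ}
    (ht : 0 ≤ t) (hcont : ContinuousOn ξ (Icc 0 t)) (hmem : ∀ s ∈ Icc 0 t, ξ s ∈ D.posSet ρ)
    (hderiv : ∀ s ∈ Ico 0 t,
      HasDerivWithinAt ξ (D.field (ξ s) (feedback ρ σ (ξ s))) (Ici s) s) :
    D.Admissible (ξ 0) ξ (fun s => feedback ρ σ (ξ s)) (ENNReal.ofReal t) := by
  have hH : horizon (ENNReal.ofReal t) = Icc 0 t := by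
    rw [horizon_of_ne_top ENNReal.ofReal_ne_top, ENNReal.toReal_ofReal ht]
  have hu : ContinuousOn (fun s => feedback ρ σ (ξ s)) (Icc 0 t) :=
    h.contDiffOn_feedback.continuousOn.comp hcont hmem
  have hfield : ContinuousOn (fun s => D.field (ξ s) (feedback ρ σ (ξ s))) (Icc 0 t) :=
    h.contDiffOn_field.continuousOn.comp hcont hmem
  constructor
  · rw [hH]
    exact hu.aemeasurable measurableSet_Icc
  · rwa [hH]
  · intro r hr
    rw [hH] at hr
    have hsub : Icc 0 r ⊆ Icc 0 t := Icc_subset_Icc_right hr.2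
    rw [intervalIntegral.integral_eq_sub_of_hasDeriv_right_of_le hr.1 (hcont.mono hsub)
      (fun s hs => (hderiv s ⟨hs.1.le, hs.2.trans_le hr.2⟩).mono Ioi_subset_Ici_self)
      ((hfield.mono hsub).intervalIntegrable_of_Icc hr.1)]
    abel
  · intro r hr
    rw [hH] at hr
    exact interior_subset (hmem r hr).1
  · intro r hr
    rw [hH] at hr
    exact h.feedback_mem (hmem r hr)

variable (h : D.LPFeasible ρ ρ₀ ρT σ) (hubar : 0 < D.ubar) (hβ : 0 < D.β) (hX : IsCompact D.X)
  (hM : 0 ≤ D.M) (hl : ∀ x ∈ D.X, ∀ u ∈ D.U, 0 ≤ D.l x u)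

include h hubar hβ hX hM hl

/-- Short time dynamic programming along a flow that agrees with the closed loop near `x`. -/
theorem Vext_le_of_flow {F : (Fin n → ℝ) → Fin n → ℝ} {L : (Fin n → ℝ) → ℝ}
    {Φ : ℝ → (Fin n → ℝ) → Fin n → ℝ} {B K : ℝ≥0} (hB : ∀ x, ‖F x‖ ≤ B) (hΦ : IsUnitFlow F Φ)
    (hK : LipschitzWith K L) {O : Set (Fin n → ℝ)} (hO : O ⊆ D.posSet ρ)
    (hF : ∀ y ∈ O, F y = D.field y (feedback ρ σ y))
    (hL : ∀ y ∈ O, L y = D.l y (feedback ρ σ y))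
    {t : ℝ} (ht : t ∈ Ioo (0 : ℝ) 1) {x : Fin n → ℝ} (hmem : ∀ s ∈ Icc 0 t, Φ s x ∈ O) :
    D.Vext x ≤ t * L x + K * B * t ^ 2 + Real.exp (-D.β * t) * D.Vext (Φ t x) := by
  have h0 : Φ 0 x = x := hΦ.zero x
  have hsub : Icc 0 t ⊆ Icc (0 : ℝ) 1 := Icc_subset_Icc_right ht.2.le
  have hcont : ContinuousOn (fun s => Φ s x) (Icc 0 t) := (hΦ.continuousOn x).mono hsub
  have hadm := h.admissible_of_feedback (ξ := fun s => Φ s x) ht.1.le hcont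
    (fun s hs => hO (hmem s hs)) fun s hs => by
      rw [← hF _ (hmem s (Ico_subset_Icc_self hs))]
      exact hΦ.hasDerivWithinAt_Ici x ⟨hs.1, hs.2.trans ht.2⟩
  simp only [h0] at hadm
  have hdpp := V_le_of_admissible hubar hβ hX hM hl ht.1.le hadm
  have hxX : ∀ s ∈ Icc 0 t, Φ s x ∈ D.X := fun s hs => interior_subset (hO (hmem s hs)).1
  have hx : x ∈ D.X := by simpa [h0] using hxX 0 (left_mem_Icc.2 ht.1.le)
  rw [Vext_of_mem hx, Vext_of_mem (hxX t (right_mem_Icc.2 ht.1.le))]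
  refine hdpp.trans ?_
  gcongr
  have hlc : ContinuousOn (fun s => D.l (Φ s x) (feedback ρ σ (Φ s x))) (Icc 0 t) :=
    h.contDiffOn_l.continuousOn.comp hcont fun s hs => hO (hmem s hs)
  have hint : IntervalIntegrable
      (fun s => Real.exp (-D.β * s) * D.l (Φ s x) (feedback ρ σ (Φ s x))) volume 0 t :=
    (ContinuousOn.mul (by fun_prop) hlc).intervalIntegrable_of_Icc ht.1.le
  -- The discount is at most `1` and `l ≥ 0`, while the Lipschitz function `L` moves by at most `K B
  -- t` along the flow; integration over length `t` gives the quadratic error.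
  calc ∫ s in (0 : ℝ)..t, Real.exp (-D.β * s) * D.l (Φ s x) (feedback ρ σ (Φ s x))
      ≤ ∫ _ in (0 : ℝ)..t, (L x + K * (B * t)) := by
        refine intervalIntegral.integral_mono_on ht.1.le hint intervalIntegrable_const
          fun s hs => ?_
        have hl0 : 0 ≤ D.l (Φ s x) (feedback ρ σ (Φ s x)) :=
          hl _ (hxX s hs) _ (h.feedback_mem (hO (hmem s hs)))
        have he : Real.exp (-D.β * s) ≤ 1 := Real.exp_le_one_iff.2 (by nlinarith [hs.1])
        refine (mul_le_of_le_one_left hl0 he).trans ?_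
        rw [← hL _ (hmem s hs)]
        have h1 : |L (Φ s x) - L x| ≤ K * ‖Φ s x - x‖ := by
          simpa [dist_eq_norm, Real.norm_eq_abs] using hK.dist_le_mul (Φ s x) x
        have h2 : ‖Φ s x - x‖ ≤ B * t :=
          (hΦ.norm_sub_le hB x (hsub hs)).trans (by gcongr; exact hs.2)
        have h3 : (K : ℝ) * ‖Φ s x - x‖ ≤ K * (B * t) := by gcongr
        linarith [le_abs_self (L (Φ s x) - L x)]
    _ = t * L x + K * B * t ^ 2 := by
        rw [intervalIntegral.integral_const, smul_eq_mul]
        ring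

/-- The weak form of the dynamic programming inequality, localized where `ρ > ε`. -/
theorem localized_inequality {ε : ℝ} (hε : 0 < ε) :
    D.β * (∫ x, (D.posSet ρ).indicator (fun x => cutoff (ρ x / ε) * ρ x) x * D.Vext x)
      + ∫ x, (D.posSet ρ).indicator (fun x => cutoff (ρ x / ε) * (ρ₀ x - ρT x - D.β * ρ x)
          + deriv cutoff (ρ x / ε) * (ρ x / ε)
            * fderiv ℝ ρ x (D.field x (feedback ρ σ x))) x * D.Vext x
      ≤ ∫ x, (D.posSet ρ).indicator (fun x => cutoff (ρ x / ε) * D.costDensity ρ σ x) x := by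
  -- The weight `ψ` lives where `ρ ≥ ε`, while the field and cost, cut off at scale `ε / 4`, are
  -- exact where `ρ > ε / 2`. The gap leaves room for the flow to follow the true closed loop for a
  -- short time.
  have hε4 : 0 < ε / 4 := by positivity
  obtain ⟨hψd, hψc⟩ := h.contDiff_localized hX hε (h.c1_rho.contDiffOn.mono inter_subset_left)
  obtain ⟨hFd, hFc⟩ := h.contDiff_localized hX hε4 h.contDiffOn_field
  obtain ⟨hLd, hLc⟩ := h.contDiff_localized hX hε4 h.contDiffOn_l
  set Ω := D.posSet ρ with hΩdef
  set ψ := Ω.indicator fun x => cutoff (ρ x / ε) • ρ x with hψ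
  set F := Ω.indicator fun x => cutoff (ρ x / (ε / 4)) • D.field x (feedback ρ σ x) with hF
  set L := Ω.indicator fun x => cutoff (ρ x / (ε / 4)) • D.l x (feedback ρ σ x) with hL
  obtain ⟨Kψ, hKψ⟩ := hψd.lipschitzWith_of_hasCompactSupport hψc one_ne_zero
  obtain ⟨KF, hKF⟩ := hFd.lipschitzWith_of_hasCompactSupport hFc one_ne_zero
  obtain ⟨KL, hKL⟩ := hLd.lipschitzWith_of_hasCompactSupport hLc one_ne_zero
  obtain ⟨B', hB'⟩ := hFc.exists_bound_of_continuous hFd.continuous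
  obtain ⟨B, hB⟩ : ∃ B : ℝ≥0, ∀ x, ‖F x‖ ≤ B :=
    ⟨B'.toNNReal, fun x => (hB' x).trans (Real.le_coe_toNNReal _)⟩
  obtain ⟨Φ, hΦ⟩ := exists_isUnitFlow hKF hB
  have hcut : ∀ {y}, ε / 2 < ρ y → cutoff (ρ y / (ε / 4)) = 1 := fun {y} hy =>
    cutoff_of_ge (by rw [le_div_iff₀ hε4]; linarith)
  have hcut0 : ∀ {y}, ρ y ≤ ε → cutoff (ρ y / ε) = 0 := fun {y} hy =>
    cutoff_of_le ((div_le_one hε).2 hy)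
  have hO : IsOpen (interior D.X ∩ ρ ⁻¹' Ioi (ε / 2)) :=
    (h.c1_rho.1.mono interior_subset).isOpen_inter_preimage isOpen_interior isOpen_Ioi
  have hOΩ : interior D.X ∩ ρ ⁻¹' Ioi (ε / 2) ⊆ Ω := fun y hy =>
    ⟨hy.1, lt_trans (by positivity : 0 < ε / 2) hy.2⟩
  have hKO : D.X ∩ ρ ⁻¹' Ici ε ⊆ interior D.X ∩ ρ ⁻¹' Ioi (ε / 2) := fun y hy =>
    ⟨(h.superlevel_subset_posSet hε hy).1, lt_of_lt_of_le (by linarith : ε / 2 < ε) hy.2⟩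
  -- By compactness the gap has positive width `δ`, and the speed bound `B` turns it into a time
  -- independent of the starting point.
  obtain ⟨δ, hδ, hδO⟩ := (h.isCompact_superlevel hX ε).exists_thickening_subset_open hO hKO
  have hψsupp : ∀ x, ψ x ≠ 0 → x ∈ D.X ∩ ρ ⁻¹' Ici ε := by
    intro x hx
    have hxΩ : x ∈ Ω := by
      by_contra hn
      exact hx (indicator_of_notMem hn _)
    refine ⟨interior_subset hxΩ.1, ?_⟩
    by_contra hn
    refine hx ?_
    rw [hψ, indicator_of_mem hxΩ, hcut0 (not_le.1 hn).le, zero_smul]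
  have hψ0 : ∀ x, 0 ≤ ψ x := fun x =>
    indicator_nonneg (fun y hy => mul_nonneg (cutoff_nonneg _) (le_of_lt hy.2)) x
  have hBpos : (0 : ℝ) < B + 1 := by positivity
  have hineq := integral_mul_add_weakDiv_le (V := D.Vext) (M := D.M) (L := L) (β := D.β)
    (C := KL * B) (h₀ := min 1 (δ / (B + 1))) hKF hB hΦ hKψ hψc hψ0
    (lowerSemicontinuous_Vext hM hl hubar hβ hX) (Vext_nonneg hM hl) (Vext_le_M hM hl hubar)
    ((hψd.continuous.mul hLd.continuous).integrable_of_hasCompactSupport hψc.mul_right)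
    (lt_min one_pos (by positivity)) (by
      intro t ht x hx
      have ht1 : t < 1 := ht.2.trans_le (min_le_left _ _)
      have htδ : t * (B + 1) < δ := (lt_div_iff₀ hBpos).1 (ht.2.trans_le (min_le_right _ _))
      refine h.Vext_le_of_flow hubar hβ hX hM hl hB hΦ hKL hOΩ
        (fun y hy => ?_) (fun y hy => ?_) ⟨ht.1, ht1⟩ fun s hs => hδO ?_
      · rw [hF, indicator_of_mem (hOΩ hy), hcut hy.2, one_smul]
      · rw [hL, indicator_of_mem (hOΩ hy), hcut hy.2, one_smul]
      · refine Metric.mem_thickening_iff.2 ⟨x, hψsupp x hx, ?_⟩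
        rw [dist_eq_norm]
        refine (hΦ.norm_sub_le hB x ⟨hs.1, hs.2.trans ht1.le⟩).trans_lt ?_
        have : (B : ℝ) * s ≤ B * t := by gcongr; exact hs.2
        nlinarith [ht.1])
  have hψval : ψ = Ω.indicator fun x => cutoff (ρ x / ε) * ρ x := rfl
  -- Where the outer cutoff is nonzero, `ρ > ε` and the inner one equals `1`; the auxiliary cutoff
  -- disappears from all products with `ψ`.
  have hprod : ∀ x (c : ℝ), cutoff (ρ x / ε) * (cutoff (ρ x / (ε / 4)) * c)
      = cutoff (ρ x / ε) * c := by
    intro x c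
    rcases le_or_gt (ρ x) ε with hle | hgt
    · simp [hcut0 hle]
    · rw [hcut (by linarith), one_mul]
  have hψL : ∀ x, ψ x * L x = Ω.indicator (fun x => cutoff (ρ x / ε) * D.costDensity ρ σ x) x := by
    intro x
    by_cases hx : x ∈ Ω
    · rw [hψ, hL, indicator_of_mem hx, indicator_of_mem hx, indicator_of_mem hx,
        ← mul_l_feedback (ne_of_gt hx.2), smul_eq_mul, smul_eq_mul, mul_assoc, mul_left_comm (ρ x),
        hprod]
    · simp [hψ, hx]
  have hψF : ∀ j x, x ∈ Ω → ψ x * F x j = cutoff (ρ x / ε) * D.flux ρ σ x j := by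
    intro j x hx
    rw [hψ, hF, indicator_of_mem hx, indicator_of_mem hx,
      ← mul_field_feedback (ne_of_gt hx.2), smul_eq_mul, Pi.smul_apply, smul_eq_mul, mul_assoc,
      mul_left_comm (ρ x), hprod]
  -- Here `ψ F` is the cutoff times the flux. The product rule yields the cutoff times the
  -- divergence prescribed by the Liouville equation, plus the derivative of the cutoff along the
  -- flux; writing the flux as `ρ` times the closed-loop field produces the factor `ρ / ε`.
  have hweak : ∀ x, weakDiv ψ F x = Ω.indicator
      (fun x => cutoff (ρ x / ε) * (ρ₀ x - ρT x - D.β * ρ x)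
          + deriv cutoff (ρ x / ε) * (ρ x / ε)
            * fderiv ℝ ρ x (D.field x (feedback ρ σ x))) x := by
    intro x
    by_cases hx : x ∈ Ω
    · rw [indicator_of_mem hx]
      have hcd : HasFDerivAt (fun y => cutoff (ρ y / ε))
          (deriv cutoff (ρ x / ε) • (ε⁻¹ • fderiv ℝ ρ x)) x := by
        have h1 : HasFDerivAt (fun y => ρ y / ε) (ε⁻¹ • fderiv ℝ ρ x) x := by
          simpa only [div_eq_mul_inv] using
            (h.c1_rho.differentiableAt hx.1).hasFDerivAt.mul_const ε⁻¹
        exact HasDerivAt.comp_hasFDerivAt (h₂ := cutoff) x (hasDerivAt_cutoff (ρ x / ε)) h1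
      have hterm : ∀ j, lineDeriv ℝ (fun y => ψ y * F y j) x (Pi.single j 1)
          = cutoff (ρ x / ε) * (fderiv ℝ (fun y => ρ y * MvPolynomial.eval y (D.f j)) x
            + ∑ i, fderiv ℝ (fun y => σ i y * MvPolynomial.eval y (D.fu i j)) x) (Pi.single j 1)
            + deriv cutoff (ρ x / ε) * (ρ x / ε)
              * (fderiv ℝ ρ x (Pi.single j 1) * D.field x (feedback ρ σ x) j) := by
        intro j
        have hev : (fun y => ψ y * F y j) =ᶠ[𝓝 x] fun y => cutoff (ρ y / ε) * D.flux ρ σ y j := by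
          filter_upwards [h.isOpen_posSet.mem_nhds hx] with y hy using hψF j y hy
        have hd := (hcd.mul (h.hasFDerivAt_flux hx.1 j)).congr_of_eventuallyEq hev
        rw [(hd.hasLineDerivAt _).lineDeriv, ← mul_field_feedback (ne_of_gt hx.2)]
        simp only [add_apply, smul_apply, smul_eq_mul]
        ring
      simp only [weakDiv, hterm]
      rw [Finset.sum_add_distrib, ← Finset.mul_sum, h.divergence_flux hx.1, ← Finset.mul_sum]
      congr 2
      conv_rhs => rw [pi_eq_sum_univ' (D.field x (feedback ρ σ x)), map_sum]
      refine Finset.sum_congr rfl fun j _ => ?_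
      rw [map_smul, smul_eq_mul, mul_comm]
    · rw [indicator_of_notMem hx]
      refine Finset.sum_eq_zero fun j _ => lineDeriv_eq_zero_of_notMem_tsupport fun hmem => hx ?_
      have : tsupport (fun y => ψ y * F y j) ⊆ D.X ∩ ρ ⁻¹' Ici ε :=
        closure_minimal (fun y hy => hψsupp y fun h0 => hy (by simp [h0]))
          (h.isCompact_superlevel hX ε).isClosed
      exact h.superlevel_subset_posSet hε (this hmem)
  simp only [hψL, hweak] at hineq
  exact hineq

end Data.LPFeasible

end DensityLP

/-! ### Removal of the cutoff and comparison with the objective. -/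

namespace DensityLP

open Filter Set
open scoped Topology NNReal

variable {n m ng : ℕ}

theorem tendsto_setIntegral_mul_of_eventually_eq {Ω : Set (Fin n → ℝ)} (hΩ : MeasurableSet Ω)
    (hfin : volume Ω ≠ ∞) {G : ℕ → (Fin n → ℝ) → ℝ} {G' W : (Fin n → ℝ) → ℝ} {C M : ℝ}
    (hG : ∀ k, ContinuousOn (G k) Ω) (hC : ∀ k, ∀ x ∈ Ω, |G k x| ≤ C)
    (hlim : ∀ x ∈ Ω, ∀ᶠ k in atTop, G k x = G' x) (hW : Measurable W) (hM : ∀ x, |W x| ≤ M) :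
    Tendsto (fun k => ∫ x in Ω, G k x * W x) atTop (𝓝 (∫ x in Ω, G' x * W x)) := by
  refine tendsto_integral_of_dominated_convergence (fun _ => C * M)
    (fun k => ((hG k).aestronglyMeasurable hΩ).mul hW.aestronglyMeasurable)
    (integrableOn_const hfin) (fun k => ?_) ?_
  · filter_upwards [ae_restrict_mem hΩ] with x hx
    rw [Real.norm_eq_abs, abs_mul]
    exact mul_le_mul (hC k x hx) (hM x) (abs_nonneg _) ((abs_nonneg _).trans (hC k x hx))
  · filter_upwards [ae_restrict_mem hΩ] with x hx
    exact tendsto_const_nhds.congr' ((hlim x hx).mono fun k hk => by simp only [hk])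

namespace Data.LPFeasible

variable {D : Data n m ng} {ρ ρ₀ ρT : (Fin n → ℝ) → ℝ} {σ : Fin m → (Fin n → ℝ) → ℝ}

variable (h : D.LPFeasible ρ ρ₀ ρT σ)

include h

theorem continuousOn_costDensity : ContinuousOn (D.costDensity ρ σ) D.X :=
  ((contDiff_eval (k := 1) D.lx).continuous.continuousOn.mul h.c1_rho.1).add
    (continuousOn_finsetSum _ fun i _ =>
      (contDiff_eval (k := 1) (D.lu i)).continuous.continuousOn.mul (h.c1_sigma i).1)

variable (hubar : 0 < D.ubar) (hβ : 0 < D.β) (hX : IsCompact D.X)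
  (hM : 0 ≤ D.M) (hl : ∀ x ∈ D.X, ∀ u ∈ D.U, 0 ≤ D.l x u)

include hubar hβ hX hM hl

/-- Let `ε → 0` in the localized inequality. At a point with `ρ > 0` the cutoff is eventually `1`
and its derivative `0`, and all terms are bounded uniformly in `ε` on a set of finite measure. -/
theorem setIntegral_posSet_le :
    ∫ x in D.posSet ρ, (ρ₀ x - ρT x) * D.Vext x ≤ ∫ x in D.posSet ρ, D.costDensity ρ σ x := by
  have hΩ : MeasurableSet (D.posSet ρ) := h.isOpen_posSet.measurableSet
  have hΩX : D.posSet ρ ⊆ D.X := posSet_subset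
  have hfin : volume (D.posSet ρ) ≠ ∞ :=
    ((measure_mono hΩX).trans_lt hX.measure_lt_top).ne
  have hVm : Measurable D.Vext := (lowerSemicontinuous_Vext hM hl hubar hβ hX).measurable
  have hVb : ∀ x, |D.Vext x| ≤ D.M := fun x => by
    rw [abs_of_nonneg (Vext_nonneg hM hl x)]
    exact Vext_le_M hM hl hubar x
  have hScont : ContinuousOn (fun x => ρ₀ x - ρT x - D.β * ρ x) D.X :=
    (h.continuousOn_rho0.sub h.continuousOn_rhoT).sub (continuousOn_const.mul h.c1_rho.1)
  obtain ⟨Cρ, hCρ⟩ := hX.exists_bound_of_continuousOn h.c1_rho.1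
  obtain ⟨CS, hCS⟩ := hX.exists_bound_of_continuousOn hScont
  obtain ⟨Cc, hCc⟩ := hX.exists_bound_of_continuousOn h.continuousOn_costDensity
  obtain ⟨Cd, hCd⟩ := h.c1_rho.exists_norm_fderiv_le hX
  obtain ⟨CF, hCF⟩ := exists_norm_field_le hX
  obtain ⟨A, hA0, hA⟩ := exists_mul_deriv_cutoff_le
  let ε : ℕ → ℝ := fun k => 1 / ((k : ℝ) + 1)
  have hε : ∀ k, 0 < ε k := fun k => Nat.one_div_pos_of_nat
  have hεlim : Tendsto ε atTop (𝓝 0) := tendsto_one_div_add_atTop_nhds_zero_nat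
  have hlarge : ∀ x ∈ D.posSet ρ, ∀ᶠ k in atTop, 2 < ρ x / ε k := by
    intro x hx
    have hρx : 0 < ρ x / 2 := half_pos hx.2
    filter_upwards [hεlim.eventually (gt_mem_nhds hρx)] with k hk
    rw [lt_div_iff₀ (hε k)]
    linarith
  have hcut : ∀ k, ContinuousOn (fun x => cutoff (ρ x / ε k)) (D.posSet ρ) := fun k =>
    (h.contDiffOn_cutoff (ε k)).continuousOn
  have hcut1 : ∀ s c C : ℝ, |c| ≤ C → |cutoff s * c| ≤ C := fun s c C hc => by
    rw [abs_mul, abs_of_nonneg (cutoff_nonneg s)]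
    exact (mul_le_of_le_one_left (abs_nonneg c) (cutoff_le_one s)).trans hc
  have hdρ : ContinuousOn (fun x => fderiv ℝ ρ x (D.field x (feedback ρ σ x))) (D.posSet ρ) :=
    ((h.c1_rho.contDiffOn.continuousOn_fderiv_of_isOpen isOpen_interior le_rfl).mono
      inter_subset_left).clm_apply h.contDiffOn_field.continuousOn
  have lim1 := tendsto_setIntegral_mul_of_eventually_eq hΩ hfin (G' := ρ) (C := Cρ)
    (G := fun k x => cutoff (ρ x / ε k) * ρ x)
    (fun k => (hcut k).mul (h.c1_rho.1.mono hΩX))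
    (fun k x hx => hcut1 _ _ _ (hCρ x (hΩX hx)))
    (fun x hx => (hlarge x hx).mono fun k hk => by rw [cutoff_of_ge hk.le, one_mul]) hVm hVb
  have lim2 := tendsto_setIntegral_mul_of_eventually_eq hΩ hfin
    (G' := fun x => ρ₀ x - ρT x - D.β * ρ x) (C := CS + A * (Cd * CF))
    (G := fun k x => cutoff (ρ x / ε k) * (ρ₀ x - ρT x - D.β * ρ x)
      + deriv cutoff (ρ x / ε k) * (ρ x / ε k) * fderiv ℝ ρ x (D.field x (feedback ρ σ x)))
    (fun k => by
      have hdiv : ContinuousOn (fun x => ρ x / ε k) (D.posSet ρ) :=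
        (h.c1_rho.1.mono hΩX).div_const _
      exact ((hcut k).mul (hScont.mono hΩX)).add
        ((((contDiff_cutoff.continuous_deriv le_rfl).comp_continuousOn hdiv).mul hdiv).mul hdρ))
    (fun k x hx => by
      refine (abs_add_le _ _).trans (add_le_add (hcut1 _ _ _ (hCS x (hΩX hx))) ?_)
      rw [abs_mul]
      refine mul_le_mul (hA _) ?_ (abs_nonneg _) hA0
      have hd0 := hCd x hx.1
      exact (ContinuousLinearMap.le_opNorm _ _).trans (mul_le_mul hd0
        (hCF x (hΩX hx) _ (h.feedback_mem hx)) (norm_nonneg _) ((norm_nonneg _).trans hd0)))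
    (fun x hx => (hlarge x hx).mono fun k hk => by
      rw [cutoff_of_ge hk.le, deriv_cutoff_of_gt hk]
      ring) hVm hVb
  have lim3 := tendsto_setIntegral_mul_of_eventually_eq hΩ hfin (G' := D.costDensity ρ σ)
    (G := fun k x => cutoff (ρ x / ε k) * D.costDensity ρ σ x) (W := fun _ => 1) (M := 1)
    (C := Cc) (fun k => (hcut k).mul (h.continuousOn_costDensity.mono hΩX))
    (fun k x hx => hcut1 _ _ _ (hCc x (hΩX hx)))
    (fun x hx => (hlarge x hx).mono fun k hk => by rw [cutoff_of_ge hk.le, one_mul])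
    measurable_const (by simp)
  simp only [mul_one] at lim3
  have hle := le_of_tendsto_of_tendsto' ((lim1.const_mul D.β).add lim2) lim3 fun k => by
    have hk := h.localized_inequality hubar hβ hX hM hl (hε k)
    simp only [← indicator_mul_left, integral_indicator hΩ] at hk
    exact hk
  have hint : ∀ {G : (Fin n → ℝ) → ℝ}, ContinuousOn G D.X →
      Integrable (fun x => G x * D.Vext x) (volume.restrict (D.posSet ρ)) := fun {G} hG =>
    ((hG.integrableOn_compact hX).mono_set hΩX).mul_bdd hVm.aestronglyMeasurable
      (ae_of_all _ hVb)
  rw [← integral_const_mul, ← integral_add ((hint h.c1_rho.1).const_mul _) (hint hScont)] at hle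
  -- The discount term `β ρ V` cancels the `-β ρ V` coming from the Liouville equation.
  refine le_trans (le_of_eq (integral_congr_ae (ae_of_all _ fun x => ?_))) hle
  ring

/-- Every feasible point of the density program bounds the integral of the value function. -/
theorem integral_V_le_lpCost (hm : 0 < m) (hV : IntegrableOn D.V D.X) :
    ∫ x in D.X, D.V x ≤ D.lpCost ρ ρT σ := by
  have hΩ : MeasurableSet (D.posSet ρ) := h.isOpen_posSet.measurableSet
  have hΩX : D.posSet ρ ⊆ D.X := posSet_subset
  have hVm : Measurable D.Vext := (lowerSemicontinuous_Vext hM hl hubar hβ hX).measurable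
  have hT : IntegrableOn ρT D.X := h.continuousOn_rhoT.integrableOn_compact hX
  have hint : IntegrableOn (fun x => (ρ₀ x - ρT x) * D.Vext x) D.X :=
    ((h.continuousOn_rho0.sub h.continuousOn_rhoT).integrableOn_compact hX).mul_bdd
      hVm.aestronglyMeasurable (ae_of_all _ fun x => by
        rw [Real.norm_eq_abs, abs_of_nonneg (Vext_nonneg hM hl x)]
        exact Vext_le_M hM hl hubar x)
  have hcost : ∫ x in D.posSet ρ, D.costDensity ρ σ x = ∫ x in D.X, D.costDensity ρ σ x := by
    refine (setIntegral_eq_of_subset_of_forall_sdiff_eq_zero D.isClosed_X.measurableSet hΩX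
      fun x hx => ?_).symm
    have hρ : ρ x = 0 := by
      by_contra hne
      exact hx.2 (h.mem_posSet hx.1 (lt_of_le_of_ne (h.rho_nonneg hm hubar hx.1) (Ne.symm hne)))
    simp [costDensity, hρ, h.sigma_eq_zero hx.1 hρ]
  have hsplit : D.lpCost ρ ρT σ = (∫ x in D.X, D.costDensity ρ σ x) + D.M * ∫ x in D.X, ρT x := by
    have hi : ∀ i, IntegrableOn (fun x => MvPolynomial.eval x (D.lu i) * σ i x) D.X := fun i =>
      ((contDiff_eval (k := 1) (D.lu i)).continuous.continuousOn.mul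
        (h.c1_sigma i).1).integrableOn_compact hX
    have h0 : IntegrableOn (fun x => MvPolynomial.eval x D.lx * ρ x) D.X :=
      ((contDiff_eval (k := 1) D.lx).continuous.continuousOn.mul h.c1_rho.1).integrableOn_compact hX
    simp only [lpCost, costDensity]
    rw [integral_add h0 (integrable_finsetSum _ fun i _ => hi i),
      integral_finsetSum _ fun i _ => hi i]
  -- The Liouville equation is available only in the interior; the boundary is negligible because it
  -- lies in zero sets of nonzero polynomials.
  have hae : ∀ᵐ x ∂volume.restrict D.X, x ∈ interior D.X := by
    rw [ae_restrict_iff' D.isClosed_X.measurableSet]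
    filter_upwards [measure_eq_zero_iff_ae_notMem.1 D.volume_frontier_X] with x hx hxX
    by_contra hn
    rw [D.isClosed_X.frontier_eq] at hx
    exact hx ⟨hxX, hn⟩
  calc ∫ x in D.X, D.V x
      ≤ ∫ x in D.X, (D.M * ρT x
          + (D.posSet ρ).indicator (fun x => (ρ₀ x - ρT x) * D.Vext x) x) := by
        refine integral_mono_ae hV ((hT.const_mul _).add (hint.indicator hΩ)) ?_
        filter_upwards [hae] with x hx
        have hxX := interior_subset hx
        have hV0 := V_nonneg hM hl x
        have hVM := V_le_M hM hl hubar hxX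
        have h1 := h.one_le_rho0 x hxX
        have hT0 := h.rhoT_nonneg x hxX
        by_cases hxΩ : x ∈ D.posSet ρ
        · rw [indicator_of_mem hxΩ, Vext_of_mem hxX]
          -- The difference of the two sides is `(ρ₀ - 1) V + ρT (M - V)`.
          nlinarith [mul_nonneg hV0 (sub_nonneg.2 h1), mul_nonneg hT0 (sub_nonneg.2 hVM)]
        · have hρ : ρ x = 0 := by
            by_contra hne
            exact hxΩ (h.mem_posSet hxX
              (lt_of_le_of_ne (h.rho_nonneg hm hubar hxX) (Ne.symm hne)))
          -- Where the density vanishes `ρT = ρ₀ ≥ 1`: all mass stops at once, and its cost `M ρT`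
          -- is at least `M ≥ V`.
          have hs := h.source_eq_zero hm hubar hx hρ
          rw [hρ, mul_zero, sub_zero, sub_eq_zero] at hs
          rw [indicator_of_notMem hxΩ, add_zero, ← hs]
          nlinarith [mul_nonneg hM (sub_nonneg.2 h1)]
    _ = D.M * (∫ x in D.X, ρT x) + ∫ x in D.posSet ρ, (ρ₀ x - ρT x) * D.Vext x := by
        rw [integral_add (hT.const_mul _) (hint.indicator hΩ), integral_const_mul,
          setIntegral_indicator hΩ, inter_eq_right.2 hΩX]
    _ ≤ D.lpCost ρ ρT σ := by
        rw [hsplit, ← hcost, add_comm]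
        exact add_le_add_left (h.setIntegral_posSet_le hubar hβ hX hM hl) _

end Data.LPFeasible

theorem Data.integrableOn_V {D : Data n m ng} (hubar : 0 < D.ubar) (hβ : 0 < D.β)
    (hX : IsCompact D.X) (hM : 0 ≤ D.M) (hl : ∀ x ∈ D.X, ∀ u ∈ D.U, 0 ≤ D.l x u) :
    IntegrableOn D.V D.X := by
  have hV : IntegrableOn D.Vext D.X := by
    refine Measure.integrableOn_of_bounded (M := D.M) hX.measure_lt_top.ne
      (lowerSemicontinuous_Vext hM hl hubar hβ hX).measurable.aestronglyMeasurable
      (ae_of_all _ fun x => ?_)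
    rw [Real.norm_eq_abs, abs_of_nonneg (Vext_nonneg hM hl x)]
    exact Vext_le_M hM hl hubar x
  exact hV.congr_fun (fun x hx => Vext_of_mem hx) D.isClosed_X.measurableSet

end DensityLP

theorem theorem3 {n m ng : ℕ} (D : DensityLP.Data n m ng)
    (hm : 0 < m) (hubar : 0 < D.ubar) (hβ : 0 < D.β)
    (hX : IsCompact D.X)
    (hl : ∀ x ∈ D.X, ∀ u ∈ D.U, 0 ≤ D.l x u)
    (hM : D.β⁻¹ * sSup {c | ∃ x ∈ D.X, ∃ u ∈ D.U, D.l x u = c} < D.M) :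
    MeasureTheory.IntegrableOn D.V D.X MeasureTheory.volume ∧
      ((∫ x in D.X, D.V x : ℝ) : EReal) ≤ D.pStar ∧
      ∀ d : ℕ, D.pStar ≤ D.pSOS d := by
  have hM0 : 0 ≤ D.M := DensityLP.Data.M_nonneg hβ hl hM
  have hV := DensityLP.Data.integrableOn_V hubar hβ hX hM0 hl
  refine ⟨hV, le_sInf ?_, D.pStar_le_pSOS⟩
  rintro _ ⟨ρ, ρ₀, ρT, σ, hfeas, rfl⟩
  exact EReal.coe_le_coe_iff.2 (hfeas.integral_V_le_lpCost hubar hβ hX hM0 hl hm hV)
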